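/- \textbf{Theorem.} For $N\ge 1$ let $\hat U(N)$ be the set of signatures $\lambda=(\lambda_1\ge\dots\ge\lambda_N)\in\mathbb Z^N$, let $\chi^\lambda(u_1,\dots,u_N)=\det(u_i^{\lambda_j+N-j})_{i,j}/\prod_{i<j}(u_i-u_j)$ be the rational Schur functions (Laurent polynomials), and for $q\in[-1,1]$ let $$m_{N,PP(q)}[\lambda]=\frac1N\sum_{i=1}^N\Big(\prod_{j\ne i}\frac{(\lambda_i-i)-(\lambda_j-j)-q}{(\lambda_i-i)-(\lambda_j-j)}\Big)\,\delta\Big(\frac{\lambda_i+N-i}{N}\Big),$$ a probability measure on $\mathbb R$. For each $N$ let $\varrho(N)$ be a probability measure on $\hat U(N)$ whose Schur generating function $$S_{\varrho(N)}(u)=\sum_{\lambda\in\hat U(N)}\varrho(N)[\lambda]\,\frac{\chi^\lambda(u)}{\chi^\lambda(1^N)}$$ converges uniformly in a neighbourhood of $1^N=(1,\dots,1)$ in $\mathbb C^N$. Assume that there are numbers $a_k,b_k$ such that $$\lim_{N\to\infty}\big(\partial_{i_0}^k\log S_{\varrho(N)}(1^N)-N a_k\big)=b_k,\qquad \lim_{N\to\infty}\partial_{i_1}\cdots\partial_{i_m}\log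 S_{\varrho(N)}(1^N)=0$$ for all $k\ge1$ and all fixed indices $i_0,\dots,i_m$ with $|\{i_1,\dots,i_m\}|\ge2$, and that the power series $\Psi(z)=\sum_{k\ge0}a_k\frac{(z-1)^k}{k!}$ and $\Phi(z)=\sum_{k\ge0}b_k\frac{(z-1)^k}{k!}$ converge in a neighbourhood of $1$ (the values $a_0,b_0$ play no role). For $q\in[-1,1]$ and $P\in\mathbb C[t]$ put $$\varphi^{(q)}_N(P)=\sum_{\lambda}\varrho(N)[\lambda]\int_{\mathbb R}P(t)\,m_{N,PP(q)}[\lambda](dt).$$ Then these series converge absolutely and, for every $q\in[-1,1]$, there is an infinitesimal limit: linear functionals $\varphi_q,\varphi_q'$ on $\mathbb C[t]$ with $$\varphi_q(P)=\lim_{N\to\infty}\varphi^{(q)}_N(P),\qquad \varphi'_q(P)=\lim_{N\to\infty}N\big(\varphi_N^{(q)}(P)-\varphi_q(P)\big)\qquad\text{for all }P\in\mathbb C[t].$$ For every $k\ge0$, $$\varphi_q(t^k)=\sum_{m=0}^k\binom km\frac1{(m+1)!}\frac{d^m}{du^m}\Big(u^{k-q}\,\Psi'(u)^{k-m}\Big)\Big|_{u=1},$$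 $$\varphi_q'(t^k)=\sum_{m=0}^{k-1}\binom k{m+1}\frac1{m!}\frac{d^m}{du^m}\Big(u^{k-q}\Big(\Phi'(u)-\frac{1-q}{2u}\Big)\Psi'(u)^{k-m-1}\Big)\Big|_{u=1}.$$ Moreover, with $\mu^{(q)}_k=\varphi_q(t^k)$ and ${\mu^{(q)}_k}'=\varphi'_q(t^k)$, for all $z\in\mathbb C$ in a neighbourhood of $0$ the following series converge and $$\exp\Big(q\sum_{k\ge0}\mu^{(0)}_kz^{k+1}\Big)\sum_{k\ge0}{\mu_k^{(q)}}'z^{k+1}=\sum_{k\ge0}{\mu_k^{(0)}}'z^{k+1}+\frac q2\sum_{k\ge0}(k+1)\mu_k^{(0)}z^{k+2}.$$ -/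

import Mathlib

open Filter Topology Polynomial

/-! ### Rational Schur functions -/

/-- The Vandermonde product `∏_{i<j} (X_i - X_j)`. -/
noncomputable def vandermondePoly (N : ℕ) : MvPolynomial (Fin N) ℂ :=
  ∏ p : Fin N × Fin N with p.1 < p.2, (MvPolynomial.X p.1 - MvPolynomial.X p.2)

/-- The alternant `det (X_i ^ {e_j})`. -/
noncomputable def alternant {N : ℕ} (e : Fin N → ℕ) : MvPolynomial (Fin N) ℂ :=
  Matrix.det (Matrix.of fun i j => (MvPolynomial.X i : MvPolynomial (Fin N) ℂ) ^ e j)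

theorem X_sub_X_dvd_alternant {N : ℕ} (e : Fin N → ℕ) {i j : Fin N} (h : i ≠ j) :
    (MvPolynomial.X i - MvPolynomial.X j : MvPolynomial (Fin N) ℂ) ∣ alternant e := by
  rw [← Ideal.mem_span_singleton, ← Ideal.Quotient.eq_zero_iff_mem, alternant, RingHom.map_det]
  refine Matrix.det_zero_of_row_eq h ?_
  ext k
  have hx : Ideal.Quotient.mk (Ideal.span {(MvPolynomial.X i - MvPolynomial.X j :
      MvPolynomial (Fin N) ℂ)}) (MvPolynomial.X i) = Ideal.Quotient.mk _ (MvPolynomial.X j) :=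
    Ideal.Quotient.eq.2 (Ideal.mem_span_singleton_self _)
  simp [hx]

theorem irreducible_X_sub_X {N : ℕ} {i j : Fin N} (h : i ≠ j) :
    Irreducible (MvPolynomial.X i - MvPolynomial.X j : MvPolynomial (Fin N) ℂ) := by
  classical
  have hc : MvPolynomial.coeff (Finsupp.single i 1)
      (MvPolynomial.X i - MvPolynomial.X j : MvPolynomial (Fin N) ℂ) = 1 := by
    rw [MvPolynomial.coeff_sub, MvPolynomial.coeff_X, MvPolynomial.coeff_X, if_pos rfl,
      if_neg (fun h' => h ((Finsupp.single_left_injective one_ne_zero h').symm)), sub_zero]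
  refine MvPolynomial.irreducible_of_totalDegree_eq_one (le_antisymm ?_ ?_) fun x hx =>
    isUnit_of_dvd_one (hc ▸ hx (Finsupp.single i 1))
  · refine (MvPolynomial.totalDegree_sub _ _).trans ?_
    simp [MvPolynomial.totalDegree_X]
  · have := MvPolynomial.le_totalDegree (MvPolynomial.mem_support_iff.2 (hc ▸ one_ne_zero))
    simpa using this

theorem vandermondePoly_dvd_alternant {N : ℕ} (e : Fin N → ℕ) :
    vandermondePoly N ∣ alternant e := by
  refine Finset.prod_dvd_of_isRelPrime ?_ ?_
  · rintro ⟨i, j⟩ hij ⟨k, l⟩ hkl hne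
    simp only [Finset.coe_filter, Finset.mem_univ, true_and, Set.mem_ofPred_eq] at hij hkl
    refine (irreducible_X_sub_X hij.ne).isRelPrime_iff_not_dvd.2 fun hd => ?_
    have key : ∀ t : Fin N, t ≠ i → t ≠ j → (t = k ∨ t = l) → False := by
      intro t hi hj ht
      have h2 := map_dvd (MvPolynomial.eval (Pi.single t (1 : ℂ))) hd
      simp only [map_sub, MvPolynomial.eval_X, Pi.single_eq_of_ne hi.symm,
        Pi.single_eq_of_ne hj.symm, sub_zero, zero_dvd_iff] at h2
      rcases ht with rfl | rfl
      · simp [Pi.single_eq_of_ne hkl.ne'] at h2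
      · simp [Pi.single_eq_of_ne hkl.ne] at h2
    have h1 := key k
    have h2 := key l
    grind
  · rintro ⟨i, j⟩ hij
    simp only [Finset.mem_filter, Finset.mem_univ, true_and] at hij
    exact X_sub_X_dvd_alternant e hij.ne

/-- The polynomial `det (X_i ^ {e_j}) / ∏_{i<j} (X_i - X_j)`. -/
noncomputable def alternantQuotient {N : ℕ} (e : Fin N → ℕ) : MvPolynomial (Fin N) ℂ :=
  (vandermondePoly_dvd_alternant e).choose

theorem vandermondePoly_mul_alternantQuotient {N : ℕ} (e : Fin N → ℕ) :
    vandermondePoly N * alternantQuotient e = alternant e :=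
  (vandermondePoly_dvd_alternant e).choose_spec.symm

/-- Signatures of length `N`: non-increasing `N`-tuples of integers. -/
abbrev Signature (N : ℕ) : Type := {lam : Fin N → ℤ // Antitone lam}

/-- The shifted coordinate `λ_i + N - i` (the index `i` is `0`-based here, whence the `- 1`). -/
def Signature.shifted {N : ℕ} (lam : Signature N) (i : Fin N) : ℤ :=
  lam.1 i + N - 1 - (i : ℕ)

/-- A natural number with `λ_i + offset ≥ 0` for all `i`. -/
def Signature.offset {N : ℕ} (lam : Signature N) : ℕ := ∑ i, (lam.1 i).natAbs

theorem Signature.shifted_add_offset_nonneg {N : ℕ} (lam : Signature N) (i : Fin N) :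
    0 ≤ lam.shifted i + lam.offset := by
  have h : (lam.1 i).natAbs ≤ lam.offset :=
    Finset.single_le_sum (f := fun i => (lam.1 i).natAbs) (fun _ _ => Nat.zero_le _)
      (Finset.mem_univ i)
  unfold Signature.shifted
  omega

/-- The rational Schur function `det (u_i ^ {λ_j + N - j}) / ∏_{i<j} (u_i - u_j)`, as a Laurent
polynomial, so that it is also defined where some of the `u_i` coincide: the exponents are first
raised by a constant, and the factor `∏_i u_i` to that power is then divided out. -/
noncomputable def schurChar {N : ℕ} (lam : Signature N) (u : Fin N → ℂ) : ℂ :=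
  MvPolynomial.eval u (alternantQuotient fun j => (lam.shifted j + lam.offset).toNat) /
    (∏ i, u i) ^ lam.offset

/-- `schurChar` satisfies the defining formula of the rational Schur function. -/
theorem prod_mul_schurChar {N : ℕ} (lam : Signature N) (u : Fin N → ℂ) (hu : ∀ i, u i ≠ 0) :
    (∏ p : Fin N × Fin N with p.1 < p.2, (u p.1 - u p.2)) * schurChar lam u =
      Matrix.det (Matrix.of fun i j => u i ^ lam.shifted j) := by
  have h := congrArg (MvPolynomial.eval u)
    (vandermondePoly_mul_alternantQuotient fun j => (lam.shifted j + lam.offset).toNat)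
  have h0 : (∏ i, u i) ^ lam.offset ≠ 0 := pow_ne_zero _ (Finset.prod_ne_zero_iff.2 fun i _ => hu i)
  have hV : MvPolynomial.eval u (vandermondePoly N) =
      ∏ p : Fin N × Fin N with p.1 < p.2, (u p.1 - u p.2) := by
    simp [vandermondePoly, map_prod]
  rw [map_mul, hV] at h
  rw [schurChar, mul_div_assoc', h, div_eq_iff h0, alternant, RingHom.map_det, ← Finset.prod_pow,
    mul_comm, ← Matrix.det_mul_column]
  congr 1
  ext i j
  have : (((lam.shifted j + lam.offset).toNat : ℕ) : ℤ) = lam.shifted j + lam.offset :=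
    Int.toNat_of_nonneg (lam.shifted_add_offset_nonneg j)
  simp only [RingHom.mapMatrix_apply, Matrix.map_apply, Matrix.of_apply, map_pow,
    MvPolynomial.eval_X]
  rw [← zpow_natCast, this, zpow_add₀ (hu i), zpow_natCast, mul_comm]

/-! ### Schur generating functions -/

/-- The summand `ρ[λ] χ^λ(u) / χ^λ(1^N)` of the Schur generating function. -/
noncomputable def schurTerm {N : ℕ} (ρ : PMF (Signature N)) (lam : Signature N)
    (u : Fin N → ℂ) : ℂ :=
  ((ρ lam).toReal : ℂ) * (schurChar lam u / schurChar lam 1)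

/-- The Schur generating function `S_ρ`. -/
noncomputable def schurGen {N : ℕ} (ρ : PMF (Signature N)) (u : Fin N → ℂ) : ℂ :=
  ∑' lam, schurTerm ρ lam u

/-- The series defining `S_ρ` converges uniformly in a (complex) neighbourhood of `1^N`. -/
def SchurGenConverges {N : ℕ} (ρ : PMF (Signature N)) : Prop :=
  ∃ U ∈ 𝓝 (1 : Fin N → ℂ), SummableUniformlyOn (schurTerm ρ) U

/-- The direction of the coordinate `i` in `ℂ^N` (`0` if there is no such coordinate). -/
def coordDir (N i : ℕ) : Fin N → ℂ := fun j => if (j : ℕ) = i then 1 else 0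

/-- The mixed partial derivative `∂_{i_1} ⋯ ∂_{i_m} (log S_ρ) (1^N)`. -/
noncomputable def logSchurDeriv {N m : ℕ} (ρ : PMF (Signature N)) (i : Fin m → ℕ) : ℂ :=
  iteratedFDeriv ℂ m (fun u : Fin N → ℂ => Complex.log (schurGen ρ u)) 1
    fun s => coordDir N (i s)

/-! ### Deformed Perelomov-Popov measures -/

/-- The weight `∏_{j≠i} ((λ_i - i) - (λ_j - j) - q) / ((λ_i - i) - (λ_j - j))`; it is nonnegative
for `q ∈ [-1, 1]`. -/
noncomputable def ppWeight {N : ℕ} (q : ℝ) (lam : Signature N) (i : Fin N) : ℝ :=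
  ∏ j ∈ Finset.univ.erase i,
    ((lam.shifted i : ℝ) - lam.shifted j - q) / ((lam.shifted i : ℝ) - lam.shifted j)

/-- The `q`-deformed Perelomov-Popov measure of a signature, for `q ∈ [-1, 1]`. -/
noncomputable def ppMeasure {N : ℕ} (q : ℝ) (lam : Signature N) : MeasureTheory.Measure ℝ :=
  ∑ i, ENNReal.ofReal (ppWeight q lam i / N) •
    MeasureTheory.Measure.dirac ((lam.shifted i : ℝ) / N)

/-- `∫ P dm` for the `q`-deformed Perelomov-Popov measure `m` of a signature. -/
noncomputable def ppIntegral {N : ℕ} (q : ℝ) (lam : Signature N) (P : ℂ[X]) : ℂ :=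
  ∫ t, P.eval (t : ℂ) ∂(ppMeasure q lam)

/-- The expectation of `∫ P dm` for a random signature with law `ρ`. -/
noncomputable def ppExpect {N : ℕ} (q : ℝ) (ρ : PMF (Signature N)) (P : ℂ[X]) : ℂ :=
  ∑' lam, ((ρ lam).toReal : ℂ) * ppIntegral q lam P

/-- `(ℂ[t], φ, φ')` is the infinitesimal limit of the sequence `φN` of functionals on `ℂ[t]`. -/
def IsInfinitesimalLimit (φN : ℕ → ℂ[X] → ℂ) (φ φ' : ℂ[X] →ₗ[ℂ] ℂ) : Prop :=
  (∀ P, Tendsto (fun N => φN N P) atTop (𝓝 (φ P))) ∧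
    ∀ P, Tendsto (fun N : ℕ => (N : ℂ) * (φN N P - φ P)) atTop (𝓝 (φ' P))

/-! ### The limiting moments -/

/-- The series `∑_k c_k (z - 1)^k / k!`. -/
noncomputable def taylorOne (c : ℕ → ℂ) (z : ℂ) : ℂ := ∑' k : ℕ, c k * (z - 1) ^ k / k.factorial

/-- The series `∑_k c_k (z - 1)^k / k!` converges in a neighbourhood of `1`. -/
def TaylorOneConverges (c : ℕ → ℂ) : Prop :=
  ∀ᶠ z in 𝓝 (1 : ℂ), Summable fun k : ℕ => c k * (z - 1) ^ k / k.factorial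

/-- `∑_{m=0}^k C(k,m) / (m+1)! * (d/du)^m (u^{k-q} Ψ'(u)^{k-m}) |_{u=1}`. -/
noncomputable def limitMoment (Ψ : ℂ → ℂ) (q : ℝ) (k : ℕ) : ℂ :=
  ∑ m ∈ Finset.range (k + 1), (k.choose m : ℂ) / (m + 1).factorial *
    iteratedDeriv m (fun u : ℂ => u ^ ((k : ℂ) - q) * deriv Ψ u ^ (k - m)) 1

/-- `∑_{m=0}^{k-1} C(k,m+1) / m! * (d/du)^m (u^{k-q} (Φ'(u) - (1-q)/(2u)) Ψ'(u)^{k-m-1}) |_{u=1}`. -/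
noncomputable def infinitesimalMoment (Ψ Φ : ℂ → ℂ) (q : ℝ) (k : ℕ) : ℂ :=
  ∑ m ∈ Finset.range k, (k.choose (m + 1) : ℂ) / m.factorial *
    iteratedDeriv m (fun u : ℂ => u ^ ((k : ℂ) - q) * (deriv Φ u - (1 - q) / (2 * u)) *
      deriv Ψ u ^ (k - m - 1)) 1

/-!
Let `V` be the Vandermonde product. The operator `V⁻¹ ∑ᵢ uᵢ^(n-q) ∂ᵢⁿ V` turns the numerator
`det (uᵢ^mⱼ)` of a character, where `mⱼ = λⱼ + N - j`, into the sum over `b` of the determinants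
with `m_b` shifted by `-q`, multiplied by `m_b (m_b - 1) ⋯ (m_b - n + 1)`. At `1^N` the quotients of
these determinants by the original one are the weights of the Perelomov-Popov measure, so the values
of the operators on the Schur generating function `S` at `1^N` are factorial moments of these
measures.

On a product `∏ⱼ g(uⱼ)` the operator gives sums of divided differences, whose values at `1^N` are
Taylor coefficients. A symmetric function has the same Taylor jet at `1^N` as a linear combination
of such products, with coefficients linear in its partial derivatives. This is applied to
`S(u) = exp (R u) ∏ⱼ g(uⱼ)`, where `log g` is the restriction of `log S` to a coordinate axis: the
hypotheses make `log g` equal to `N Ψ + Φ + o(1)`, and all partial derivatives of `R` at `1^N`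
tend to `0`, whence the moments up to `o(1 / N)`. Lagrange inversion for
`z = (u - 1) / (u ((u - 1) Ψ' u + 1))` then turns the Taylor coefficients into the identity of
generating functions.
-/

/-! ### Taylor series of analytic functions -/

section Taylor

variable {𝕜 : Type*} [NontriviallyNormedField 𝕜] {c : 𝕜} {f g : 𝕜 → 𝕜}

/-- The Taylor series of `f` at `c`, as a formal power series in `u - c`. -/
noncomputable def taylorAt (c : 𝕜) (f : 𝕜 → 𝕜) : PowerSeries 𝕜 :=
  PowerSeries.mk fun n => iteratedDeriv n f c / n.factorial

theorem coeff_taylorAt (c : 𝕜) (f : 𝕜 → 𝕜) (n : ℕ) :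
    PowerSeries.coeff n (taylorAt c f) = iteratedDeriv n f c / n.factorial :=
  PowerSeries.coeff_mk _ _

theorem constantCoeff_taylorAt (c : 𝕜) (f : 𝕜 → 𝕜) :
    PowerSeries.constantCoeff (taylorAt c f) = f c := by
  rw [← PowerSeries.coeff_zero_eq_constantCoeff_apply, coeff_taylorAt]
  simp

theorem taylorAt_congr (h : f =ᶠ[𝓝 c] g) : taylorAt c f = taylorAt c g := by
  ext n
  rw [coeff_taylorAt, coeff_taylorAt, h.iteratedDeriv_eq]

theorem taylorAt_const (c a : 𝕜) : taylorAt c (fun _ => a) = PowerSeries.C a := by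
  ext n
  rw [coeff_taylorAt, iteratedDeriv_const, PowerSeries.coeff_C]
  split_ifs with h <;> simp [h]

theorem taylorAt_const_mul (a : 𝕜) (f : 𝕜 → 𝕜) :
    taylorAt c (fun u => a * f u) = PowerSeries.C a * taylorAt c f := by
  ext n
  rw [PowerSeries.coeff_C_mul, coeff_taylorAt, coeff_taylorAt, iteratedDeriv_const_mul_field,
    mul_div_assoc]

theorem taylorAt_id (c : 𝕜) : taylorAt c (fun u => u) = PowerSeries.C c + PowerSeries.X := by
  ext n
  rw [coeff_taylorAt, map_add, PowerSeries.coeff_C, PowerSeries.coeff_X]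
  rcases n with _ | _ | n
  · simp
  · simp
  · simp [iteratedDeriv_succ', iteratedDeriv_const]

theorem analyticAt_sub_const (c a : 𝕜) : AnalyticAt 𝕜 (fun u : 𝕜 => u - a) c :=
  analyticAt_id.fun_sub analyticAt_const

section CharZero

variable [CharZero 𝕜]

theorem iteratedDeriv_eq_coeff_taylorAt (c : 𝕜) (f : 𝕜 → 𝕜) (n : ℕ) :
    iteratedDeriv n f c = n.factorial * PowerSeries.coeff n (taylorAt c f) := by
  rw [coeff_taylorAt, mul_div_cancel₀ _ (Nat.cast_ne_zero.2 n.factorial_ne_zero)]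

theorem taylorAt_deriv (c : 𝕜) (f : 𝕜 → 𝕜) :
    taylorAt c (deriv f) = PowerSeries.derivative 𝕜 (taylorAt c f) := by
  ext n
  rw [PowerSeries.coeff_derivative, coeff_taylorAt, coeff_taylorAt, ← iteratedDeriv_succ',
    Nat.factorial_succ]
  push_cast
  field_simp

end CharZero

variable [CompleteSpace 𝕜]

theorem taylorAt_add (hf : AnalyticAt 𝕜 f c) (hg : AnalyticAt 𝕜 g c) :
    taylorAt c (fun u => f u + g u) = taylorAt c f + taylorAt c g := by
  ext n
  rw [map_add, coeff_taylorAt, coeff_taylorAt, coeff_taylorAt,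
    iteratedDeriv_fun_add hf.contDiffAt hg.contDiffAt, add_div]

theorem taylorAt_sub (hf : AnalyticAt 𝕜 f c) (hg : AnalyticAt 𝕜 g c) :
    taylorAt c (fun u => f u - g u) = taylorAt c f - taylorAt c g := by
  ext n
  rw [map_sub, coeff_taylorAt, coeff_taylorAt, coeff_taylorAt,
    iteratedDeriv_fun_sub hf.contDiffAt hg.contDiffAt, sub_div]

theorem taylorAt_sum {ι : Type*} (s : Finset ι) {f : ι → 𝕜 → 𝕜}
    (hf : ∀ i ∈ s, AnalyticAt 𝕜 (f i) c) :
    taylorAt c (fun u => ∑ i ∈ s, f i u) = ∑ i ∈ s, taylorAt c (f i) := by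
  ext n
  simp only [map_sum, coeff_taylorAt]
  rw [iteratedDeriv_fun_sum fun i hi => (hf i hi).contDiffAt, Finset.sum_div]

theorem taylorAt_sub_self (c : 𝕜) : taylorAt c (fun u => u - c) = PowerSeries.X := by
  rw [taylorAt_sub (f := fun u => u) analyticAt_id analyticAt_const, taylorAt_const, taylorAt_id,
    add_sub_cancel_left]

variable [CharZero 𝕜]

theorem taylorAt_mul (hf : AnalyticAt 𝕜 f c) (hg : AnalyticAt 𝕜 g c) :
    taylorAt c (fun u => f u * g u) = taylorAt c f * taylorAt c g := by
  ext n
  rw [PowerSeries.coeff_mul, coeff_taylorAt,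
    iteratedDeriv_fun_mul hf.contDiffAt hg.contDiffAt,
    Finset.Nat.sum_antidiagonal_eq_sum_range_succ_mk, Finset.sum_div]
  refine Finset.sum_congr rfl fun i hi => ?_
  have hin : i ≤ n := Nat.lt_succ_iff.1 (Finset.mem_range.1 hi)
  have hn : (n.factorial : 𝕜) ≠ 0 := Nat.cast_ne_zero.2 n.factorial_ne_zero
  rw [coeff_taylorAt, coeff_taylorAt, Nat.cast_choose 𝕜 hin]
  field_simp

theorem taylorAt_pow (hf : AnalyticAt 𝕜 f c) (k : ℕ) :
    taylorAt c (fun u => f u ^ k) = taylorAt c f ^ k := by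
  induction k with
  | zero => simpa using taylorAt_const c 1
  | succ k ih =>
    simp only [pow_succ]
    rw [taylorAt_mul (hf.fun_pow k) hf, ih]

theorem taylorAt_sub_self_mul (hf : AnalyticAt 𝕜 f c) :
    taylorAt c (fun u => (u - c) * f u) = PowerSeries.X * taylorAt c f := by
  rw [taylorAt_mul (analyticAt_sub_const c c) hf, taylorAt_sub_self]

theorem eventually_hasSum_taylorAt (hf : AnalyticAt 𝕜 f c) :
    ∀ᶠ z in 𝓝 (0 : 𝕜), HasSum (fun n => PowerSeries.coeff n (taylorAt c f) * z ^ n)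
      (f (c + z)) := by
  obtain ⟨r, hr⟩ := hf.hasFPowerSeriesAt
  filter_upwards [Metric.eball_mem_nhds (0 : 𝕜) hr.r_pos] with z hz
  simpa [FormalMultilinearSeries.ofScalars_apply_eq, coeff_taylorAt, mul_comm] using hr.hasSum hz

theorem exists_eq_taylorAt_add_pow_mul (hf : AnalyticAt 𝕜 f c) (s : ℕ) :
    ∃ v : 𝕜 → 𝕜, AnalyticAt 𝕜 v c ∧
      (∀ u, f u = ∑ n ∈ Finset.range s, PowerSeries.coeff n (taylorAt c f) * (u - c) ^ n +
        (u - c) ^ s * v u) ∧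
      ∀ k, PowerSeries.coeff k (taylorAt c v) = PowerSeries.coeff (k + s) (taylorAt c f) := by
  induction s with
  | zero => exact ⟨f, hf, by simp, by simp⟩
  | succ s ih =>
    obtain ⟨w, hw, hfw, hcoeff⟩ := ih
    obtain ⟨p, hp⟩ := hw
    have hv : AnalyticAt 𝕜 (dslope w c) c := ⟨_, hp.has_fpower_series_dslope_fslope⟩
    have hwv : ∀ u, w u = w c + (u - c) * dslope w c u := fun u => by
      rw [← smul_eq_mul, sub_smul_dslope, add_sub_cancel]
    have hT : taylorAt c w = PowerSeries.C (w c) + PowerSeries.X * taylorAt c (dslope w c) := by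
      rw [← taylorAt_sub_self_mul hv, ← taylorAt_const c (w c),
        ← taylorAt_add analyticAt_const ((analyticAt_sub_const c c).fun_mul hv)]
      exact taylorAt_congr (.of_forall hwv)
    have hwc : PowerSeries.coeff s (taylorAt c f) = w c := by
      simpa [constantCoeff_taylorAt] using (hcoeff 0).symm
    refine ⟨dslope w c, hv, fun u => ?_, fun k => ?_⟩
    · rw [hfw u, hwv u, Finset.sum_range_succ, hwc]
      ring
    · rw [add_comm s, ← add_assoc, ← hcoeff, hT, map_add, PowerSeries.coeff_succ_X_mul,
        PowerSeries.coeff_C, if_neg k.succ_ne_zero, zero_add]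

end Taylor

theorem taylorAt_deriv_div {g : ℂ → ℂ} {c : ℂ} (hg : AnalyticAt ℂ g c)
    (hc : g c ∈ Complex.slitPlane) :
    taylorAt c (fun u => deriv g u / g u) =
      PowerSeries.derivative ℂ (taylorAt c fun z => Complex.log (g z)) := by
  rw [← taylorAt_deriv]
  refine taylorAt_congr ?_
  filter_upwards [hg.continuousAt.eventually_mem (Complex.isOpen_slitPlane.mem_nhds hc),
    hg.eventually_analyticAt] with z hz hgz
  exact (hgz.differentiableAt.hasDerivAt.clog hz).deriv.symm

/-! ### Lagrange inversion -/

theorem coeff_derivative_mul_pow {R : Type*} [CommRing R] [IsDomain R] [CharZero R]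
    (f : PowerSeries R) (k : ℕ) :
    PowerSeries.coeff k (PowerSeries.derivative R f * f ^ k) =
      PowerSeries.coeff (k + 1) (f ^ (k + 1)) := by
  have h := congrArg (PowerSeries.coeff k)
    (Derivation.leibniz_pow (PowerSeries.derivative R) f (k + 1))
  rw [PowerSeries.coeff_derivative, Nat.add_sub_cancel, smul_eq_mul, nsmul_eq_mul,
    ← map_natCast (PowerSeries.C (R := R)), PowerSeries.coeff_C_mul, Nat.cast_succ, mul_comm] at h
  rw [mul_comm]
  exact (mul_left_cancel₀ (Nat.cast_add_one_ne_zero k) h).symm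

section Lagrange

variable {𝕜 : Type*} [NontriviallyNormedField 𝕜] {c : 𝕜} {H : 𝕜 → 𝕜}

/-- The change of variables `u ↦ (u - c) / H u` near `c`, whose local inverse is expanded by the
Lagrange-Bürmann formula. -/
noncomputable def lagrangeMap (c : 𝕜) (H : 𝕜 → 𝕜) (u : 𝕜) : 𝕜 := (u - c) / H u

theorem lagrangeMap_self (c : 𝕜) (H : 𝕜 → 𝕜) : lagrangeMap c H c = 0 := by
  simp [lagrangeMap]

theorem leftInverse_lagrangeMap_zero {v : 𝕜 → 𝕜}
    (hinv : ∀ᶠ u in 𝓝 c, v (lagrangeMap c H u) = u) : v 0 = c := by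
  simpa [lagrangeMap_self] using hinv.self_of_nhds

theorem analyticAt_lagrangeMap (hH : AnalyticAt 𝕜 H c) (h0 : H c ≠ 0) :
    AnalyticAt 𝕜 (lagrangeMap c H) c :=
  (analyticAt_sub_const c c).fun_div hH h0

theorem deriv_lagrangeMap {u : 𝕜} (hH : DifferentiableAt 𝕜 H u) (h0 : H u ≠ 0) :
    deriv (lagrangeMap c H) u = (H u - (u - c) * deriv H u) / H u ^ 2 := by
  unfold lagrangeMap
  rw [deriv_fun_div (by fun_prop) hH h0, deriv_sub_const, deriv_id'', one_mul]

variable [CompleteSpace 𝕜] [CharZero 𝕜]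

theorem coeff_taylorAt_deriv_lagrangeMap_mul_pow (hH : AnalyticAt 𝕜 H c) (h0 : H c ≠ 0) (k : ℕ) :
    PowerSeries.coeff k (taylorAt c fun u => deriv (lagrangeMap c H) u * H u ^ (k + 1)) =
      if k = 0 then 1 else 0 := by
  rcases k with _ | k
  · simp [constantCoeff_taylorAt, deriv_lagrangeMap hH.differentiableAt h0, sq, h0]
  have hpow : taylorAt c (fun u => deriv (lagrangeMap c H) u * H u ^ (k + 1 + 1)) =
      taylorAt c fun u => H u ^ (k + 1) - (u - c) * (deriv H u * H u ^ k) := by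
    refine taylorAt_congr ?_
    filter_upwards [hH.eventually_analyticAt, hH.continuousAt.eventually_ne h0] with u hu hu0
    rw [deriv_lagrangeMap hu.differentiableAt hu0]
    field_simp
    ring
  have hHd := hH.deriv.fun_mul (hH.fun_pow k)
  rw [if_neg k.succ_ne_zero, hpow, taylorAt_sub (hH.fun_pow _)
      ((analyticAt_sub_const c c).fun_mul hHd), taylorAt_sub_self_mul hHd, map_sub,
    PowerSeries.coeff_succ_X_mul, taylorAt_mul hH.deriv (hH.fun_pow k), taylorAt_deriv,
    taylorAt_pow hH, taylorAt_pow hH, coeff_derivative_mul_pow, sub_self]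

-- With `z = lagrangeMap c H u`, both sides are the residue of `w(z) z^(-k-1) dz`.
theorem coeff_taylorAt_comp_lagrangeMap (hH : AnalyticAt 𝕜 H c) (h0 : H c ≠ 0) (k : ℕ)
    {w : 𝕜 → 𝕜} (hw : AnalyticAt 𝕜 w 0) :
    PowerSeries.coeff k (taylorAt c fun u =>
      w (lagrangeMap c H u) * (deriv (lagrangeMap c H) u * H u ^ (k + 1))) =
      PowerSeries.coeff k (taylorAt 0 w) := by
  have hz := analyticAt_lagrangeMap hH h0
  have hzpow (k : ℕ) := hz.deriv.fun_mul (hH.fun_pow k)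
  induction k generalizing w with
  | zero =>
    simp [constantCoeff_taylorAt, lagrangeMap_self, deriv_lagrangeMap hH.differentiableAt h0, sq,
      h0]
  | succ k ih =>
    obtain ⟨v, hv, hwv, hcoeff⟩ := exists_eq_taylorAt_add_pow_mul hw 1
    have hvz : AnalyticAt 𝕜 (fun u => v (lagrangeMap c H u)) c :=
      AnalyticAt.fun_comp (by rwa [lagrangeMap_self]) hz
    have hsplit : taylorAt c (fun u => w (lagrangeMap c H u) *
        (deriv (lagrangeMap c H) u * H u ^ (k + 1 + 1))) =
        taylorAt c fun u => w 0 * (deriv (lagrangeMap c H) u * H u ^ (k + 1 + 1)) +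
          (u - c) * (v (lagrangeMap c H u) * (deriv (lagrangeMap c H) u * H u ^ (k + 1))) := by
      refine taylorAt_congr ?_
      filter_upwards [hH.continuousAt.eventually_ne h0] with u hu0
      have hu : lagrangeMap c H u * H u = u - c := div_mul_cancel₀ _ hu0
      have hw0 : w (lagrangeMap c H u) = w 0 + lagrangeMap c H u * v (lagrangeMap c H u) := by
        simpa [constantCoeff_taylorAt] using hwv (lagrangeMap c H u)
      rw [hw0, ← hu]
      ring
    have ha := hvz.fun_mul (hzpow (k + 1))
    have hb := (analyticAt_const (v := w 0)).fun_mul (hzpow (k + 1 + 1))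
    rw [hsplit, taylorAt_add hb ((analyticAt_sub_const c c).fun_mul ha), taylorAt_const_mul,
      taylorAt_sub_self_mul ha, map_add, PowerSeries.coeff_C_mul, PowerSeries.coeff_succ_X_mul,
      ih hv, coeff_taylorAt_deriv_lagrangeMap_mul_pow hH h0, if_neg k.succ_ne_zero, mul_zero,
      zero_add, hcoeff]

theorem exists_analyticAt_leftInverse_lagrangeMap (hH : AnalyticAt 𝕜 H c) (h0 : H c ≠ 0) :
    ∃ v : 𝕜 → 𝕜, AnalyticAt 𝕜 v 0 ∧ ∀ᶠ u in 𝓝 c, v (lagrangeMap c H u) = u := by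
  have hz := analyticAt_lagrangeMap hH h0
  have hd : deriv (lagrangeMap c H) c ≠ 0 := by
    simp [deriv_lagrangeMap hH.differentiableAt h0, h0]
  have hinv := hz.analyticAt_localInverse hd
  rw [lagrangeMap_self] at hinv
  exact ⟨_, hinv, (hz.hasStrictDerivAt.hasStrictFDerivAt_equiv hd).eventually_left_inverse⟩

theorem coeff_taylorAt_mul_pow_eq_leftInverse {g v : 𝕜 → 𝕜} (hH : AnalyticAt 𝕜 H c)
    (h0 : H c ≠ 0) (hg : AnalyticAt 𝕜 g c) (hv : AnalyticAt 𝕜 v 0)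
    (hinv : ∀ᶠ u in 𝓝 c, v (lagrangeMap c H u) = u) (k : ℕ) :
    PowerSeries.coeff k (taylorAt c fun u => g u * H u ^ (k + 1)) =
      PowerSeries.coeff k (taylorAt 0 fun z => g (v z) * deriv v z) := by
  have hz := analyticAt_lagrangeMap hH h0
  have hv0 := leftInverse_lagrangeMap_zero hinv
  have hw : AnalyticAt 𝕜 (fun z => g (v z) * deriv v z) 0 :=
    (AnalyticAt.fun_comp (by rwa [hv0]) hv).fun_mul hv.deriv
  have hvz : ∀ᶠ u in 𝓝 c, AnalyticAt 𝕜 v (lagrangeMap c H u) :=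
    hz.continuousAt.eventually (by simpa [lagrangeMap_self] using hv.eventually_analyticAt)
  rw [← coeff_taylorAt_comp_lagrangeMap hH h0 k hw]
  congr 1
  refine taylorAt_congr ?_
  filter_upwards [hinv.eventually_nhds, hvz, hz.eventually_analyticAt] with u hu hvu hzu
  have hderiv : deriv v (lagrangeMap c H u) * deriv (lagrangeMap c H) u = 1 := by
    have hid : v ∘ lagrangeMap c H =ᶠ[𝓝 u] fun u => u := hu
    rw [← deriv_comp u hvu.differentiableAt hzu.differentiableAt, hid.deriv_eq, deriv_id'']
  rw [hu.self_of_nhds, mul_assoc, ← mul_assoc (deriv v _), hderiv, one_mul]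

end Lagrange

/-! ### First order expansions in `1 / N` -/

theorem choose_succ_mul_inv_pow_succ {𝕜 : Type*} [Field 𝕜] [CharZero 𝕜] {N : ℕ} (hN : N ≠ 0)
    (r : ℕ) : (N.choose (r + 1) : 𝕜) * (N : 𝕜)⁻¹ ^ (r + 1) =
      N.choose r * (N : 𝕜)⁻¹ ^ r * (1 / (r + 1) * (1 - r * (N : 𝕜)⁻¹)) := by
  have hN0 : (N : 𝕜) ≠ 0 := Nat.cast_ne_zero.2 hN
  have hr : (r : 𝕜) + 1 ≠ 0 := Nat.cast_add_one_ne_zero r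
  have hchoose : (N.choose (r + 1) : 𝕜) * (r + 1) = N.choose r * (N - r) := by
    rcases le_or_gt r N with h | h
    · rw [← Nat.cast_sub h]
      exact_mod_cast Nat.choose_succ_right_eq N r
    · simp [Nat.choose_eq_zero_of_lt h, Nat.choose_eq_zero_of_lt (Nat.lt_succ_of_lt h)]
  rw [pow_succ (N : 𝕜)⁻¹ r, eq_div_of_mul_eq hr hchoose]
  field_simp

/-- First order asymptotics `y N = a + b / N + o(1 / N)`. -/
def HasExpansion {𝕜 : Type*} [RCLike 𝕜] (y : ℕ → 𝕜) (a b : 𝕜) : Prop :=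
  Tendsto (fun N : ℕ => (N : 𝕜) * (y N - a)) atTop (𝓝 b)

namespace HasExpansion

variable {𝕜 : Type*} [RCLike 𝕜] {y y' : ℕ → 𝕜} {a b a' b' : 𝕜}

theorem tendsto (h : HasExpansion y a b) : Tendsto y atTop (𝓝 a) := by
  have h1 : Tendsto (fun N : ℕ => (N : 𝕜)⁻¹ * ((N : 𝕜) * (y N - a)) + a) atTop (𝓝 (0 * b + a)) :=
    (tendsto_inv_atTop_nhds_zero_nat.mul h).add_const a
  rw [zero_mul, zero_add] at h1
  refine h1.congr' ?_
  filter_upwards [eventually_ne_atTop 0] with N hN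
  rw [inv_mul_cancel_left₀ (Nat.cast_ne_zero.2 hN), sub_add_cancel]

theorem congr' (h : HasExpansion y a b) (he : y =ᶠ[atTop] y') : HasExpansion y' a b :=
  Tendsto.congr' (he.mono fun N hN => by rw [hN]) h

theorem const (a : 𝕜) : HasExpansion (fun _ => a) a 0 := by
  simp [HasExpansion]

theorem add (h : HasExpansion y a b) (h' : HasExpansion y' a' b') :
    HasExpansion (fun N => y N + y' N) (a + a') (b + b') :=
  (Tendsto.add h h').congr fun N => by ring

theorem mul (h : HasExpansion y a b) (h' : HasExpansion y' a' b') :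
    HasExpansion (fun N => y N * y' N) (a * a') (a * b' + b * a') :=
  ((Tendsto.const_mul a h').add (Tendsto.mul h h'.tendsto)).congr fun N => by ring

theorem const_mul (c : 𝕜) (h : HasExpansion y a b) :
    HasExpansion (fun N => c * y N) (c * a) (c * b) := by
  simpa using (const c).mul h

theorem sum {ι : Type*} (s : Finset ι) {y : ι → ℕ → 𝕜} {a b : ι → 𝕜}
    (h : ∀ i ∈ s, HasExpansion (y i) (a i) (b i)) :
    HasExpansion (fun N => ∑ i ∈ s, y i N) (∑ i ∈ s, a i) (∑ i ∈ s, b i) := by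
  refine (tendsto_finsetSum s h).congr fun N => ?_
  rw [← Finset.sum_sub_distrib, Finset.mul_sum]

theorem natCast_inv : HasExpansion (fun N => (N : 𝕜)⁻¹) 0 1 := by
  refine tendsto_const_nhds.congr' ?_
  filter_upwards [eventually_ne_atTop 0] with N hN
  rw [sub_zero, mul_inv_cancel₀ (Nat.cast_ne_zero.2 hN)]

theorem natCast_inv_mul (h : HasExpansion y a b) :
    HasExpansion (fun N => (N : 𝕜)⁻¹ * y N) 0 a := by
  simpa using natCast_inv.mul h

theorem pow (h : HasExpansion y a b) (p : ℕ) :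
    HasExpansion (fun N => y N ^ p) (a ^ p) (p * a ^ (p - 1) * b) := by
  induction p with
  | zero => simpa using const (1 : 𝕜)
  | succ p ih =>
    have hpow : (p : 𝕜) * a ^ (p - 1) * a = p * a ^ p := by
      rcases p with _ | p
      · simp
      · rw [Nat.add_sub_cancel, mul_assoc, pow_succ]
    simp only [pow_succ, Nat.add_sub_cancel]
    convert ih.mul h using 1
    push_cast
    linear_combination -b * hpow

theorem choose (s : ℕ) :
    HasExpansion (fun N => (N.choose (s + 1) : 𝕜) * (N : 𝕜)⁻¹ ^ (s + 1))
      (1 / (s + 1).factorial) (-(s / (2 * s.factorial))) := by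
  induction s with
  | zero =>
    have h1 := (const (1 : 𝕜)).congr' (y' := fun N => (N.choose 1 : 𝕜) * (N : 𝕜)⁻¹ ^ 1) <| by
      filter_upwards [eventually_ne_atTop 0] with N hN
      rw [Nat.choose_one_right, pow_one, mul_inv_cancel₀ (Nat.cast_ne_zero.2 hN)]
    simpa using h1
  | succ s ih =>
    have hfactor : HasExpansion (fun N => 1 / ((s : 𝕜) + 1 + 1) * (1 + -((s : 𝕜) + 1) * (N : 𝕜)⁻¹))
        (1 / ((s : 𝕜) + 1 + 1) * (1 + -((s : 𝕜) + 1) * 0))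
        (1 / ((s : 𝕜) + 1 + 1) * (0 + -((s : 𝕜) + 1) * 1)) :=
      ((const 1).add (natCast_inv.const_mul _)).const_mul _
    have hs : (s : 𝕜) + 1 + 1 ≠ 0 := by exact_mod_cast (s + 1).succ_ne_zero
    have hs' : (s : 𝕜) + 1 ≠ 0 := by exact_mod_cast s.succ_ne_zero
    have hf : (s.factorial : 𝕜) ≠ 0 := by exact_mod_cast s.factorial_ne_zero
    have hrec := (ih.mul hfactor).congr'
      (y' := fun N => (N.choose (s + 1 + 1) : 𝕜) * (N : 𝕜)⁻¹ ^ (s + 1 + 1)) <| by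
        filter_upwards [eventually_ne_atTop 0] with N hN
        rw [choose_succ_mul_inv_pow_succ hN (s + 1)]
        push_cast
        ring
    convert hrec using 1 <;>
    · simp only [Nat.factorial_succ]
      push_cast
      field_simp
      ring

end HasExpansion

/-- Coefficientwise first order asymptotics `Y N = A + B / N + o(1 / N)` of power series. -/
def SeriesExpansion {𝕜 : Type*} [RCLike 𝕜] (Y : ℕ → PowerSeries 𝕜) (A B : PowerSeries 𝕜) : Prop :=
  ∀ j, HasExpansion (fun N => PowerSeries.coeff j (Y N)) (PowerSeries.coeff j A)
    (PowerSeries.coeff j B)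

namespace SeriesExpansion

variable {𝕜 : Type*} [RCLike 𝕜] {Y Y' : ℕ → PowerSeries 𝕜} {A B A' B' : PowerSeries 𝕜}

theorem congr' (h : SeriesExpansion Y A B) (he : Y =ᶠ[atTop] Y') : SeriesExpansion Y' A B :=
  fun j => (h j).congr' (he.mono fun N hN => by simp only [hN])

theorem const (A : PowerSeries 𝕜) : SeriesExpansion (fun _ => A) A 0 := fun j => by
  simpa using HasExpansion.const _

theorem add (h : SeriesExpansion Y A B) (h' : SeriesExpansion Y' A' B') :
    SeriesExpansion (fun N => Y N + Y' N) (A + A') (B + B') := fun j => by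
  simpa using (h j).add (h' j)

theorem mul (h : SeriesExpansion Y A B) (h' : SeriesExpansion Y' A' B') :
    SeriesExpansion (fun N => Y N * Y' N) (A * A') (A * B' + B * A') := fun j => by
  simp only [PowerSeries.coeff_mul, map_add, ← Finset.sum_add_distrib]
  exact HasExpansion.sum _ fun p _ => (h p.1).mul (h' p.2)

theorem derivative (h : SeriesExpansion Y A B) :
    SeriesExpansion (fun N => PowerSeries.derivative 𝕜 (Y N)) (PowerSeries.derivative 𝕜 A)
      (PowerSeries.derivative 𝕜 B) := fun j => by
  simp only [PowerSeries.coeff_derivative]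
  simpa [mul_comm] using (h (j + 1)).const_mul ((j : 𝕜) + 1)

theorem natCast_inv_mul (h : SeriesExpansion Y A B) :
    SeriesExpansion (fun N => PowerSeries.C ((N : 𝕜)⁻¹) * Y N) 0 A := fun j => by
  simpa [PowerSeries.coeff_C_mul] using (h j).natCast_inv_mul

end SeriesExpansion

/-! ### The value of the difference operators on multiplicative functions -/

section LogDerivatives

variable {𝕜 : Type*}

theorem analyticAt_iteratedDeriv [NontriviallyNormedField 𝕜] [CompleteSpace 𝕜] {c : 𝕜}
    {g : 𝕜 → 𝕜} (hg : AnalyticAt 𝕜 g c) (r : ℕ) : AnalyticAt 𝕜 (iteratedDeriv r g) c := by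
  rw [iteratedDeriv_eq_iterate]
  exact hg.iterated_deriv r

theorem taylorAt_iteratedDeriv_div [NontriviallyNormedField 𝕜] [CompleteSpace 𝕜] [CharZero 𝕜]
    {c : 𝕜} {g : 𝕜 → 𝕜} (hg : AnalyticAt 𝕜 g c) (h0 : g c ≠ 0) (r : ℕ) :
    taylorAt c (fun u => iteratedDeriv (r + 1) g u / g u) =
      PowerSeries.derivative 𝕜 (taylorAt c fun u => iteratedDeriv r g u / g u) +
        taylorAt c (fun u => deriv g u / g u) * taylorAt c fun u => iteratedDeriv r g u / g u := by
  have hr := analyticAt_iteratedDeriv hg r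
  rw [← taylorAt_deriv, ← taylorAt_mul (hg.deriv.fun_div hg h0) (hr.fun_div hg h0),
    ← taylorAt_add (hr.fun_div hg h0).deriv ((hg.deriv.fun_div hg h0).fun_mul (hr.fun_div hg h0))]
  refine taylorAt_congr ?_
  filter_upwards [hg.eventually_analyticAt, hr.eventually_analyticAt,
    hg.continuousAt.eventually_ne h0] with u hu hu' hu0
  rw [deriv_fun_div hu'.differentiableAt hu.differentiableAt hu0, iteratedDeriv_succ]
  field_simp
  ring

theorem choose_two_succ_mul_pow_mul_derivative [RCLike 𝕜] (ψ : PowerSeries 𝕜) (r : ℕ) :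
    PowerSeries.C ((r + 1).choose 2 : 𝕜) * (ψ ^ (r + 1 - 2) * PowerSeries.derivative 𝕜 ψ) =
      PowerSeries.derivative 𝕜 (ψ ^ r) +
        ψ * (PowerSeries.C (r.choose 2 : 𝕜) * (ψ ^ (r - 2) * PowerSeries.derivative 𝕜 ψ)) := by
  have hpow : PowerSeries.C (r.choose 2 : 𝕜) * ψ ^ (r - 1) =
      ψ * (PowerSeries.C (r.choose 2 : 𝕜) * ψ ^ (r - 2)) := by
    rcases r with _ | _ | r
    · simp
    · simp
    · rw [Nat.add_sub_cancel, mul_left_comm, ← pow_succ']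
      rfl
  rw [Nat.add_sub_add_right r 1 1, PowerSeries.derivative_pow, Nat.choose_succ_succ' r 1,
    Nat.choose_one_right, Nat.cast_add, map_add, map_natCast]
  linear_combination PowerSeries.derivative 𝕜 ψ * hpow

theorem seriesExpansion_iteratedDeriv_div [RCLike 𝕜] {c : 𝕜} {g : ℕ → 𝕜 → 𝕜}
    {ψ φ : PowerSeries 𝕜} (hg : ∀ᶠ N in atTop, AnalyticAt 𝕜 (g N) c)
    (h0 : ∀ᶠ N in atTop, g N c ≠ 0)
    (h : SeriesExpansion (fun N => PowerSeries.C ((N : 𝕜)⁻¹) *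
      taylorAt c fun u => deriv (g N) u / g N u) ψ φ) (r : ℕ) :
    SeriesExpansion (fun N => PowerSeries.C ((N : 𝕜)⁻¹ ^ r) *
      taylorAt c fun u => iteratedDeriv r (g N) u / g N u) (ψ ^ r)
      (PowerSeries.C (r : 𝕜) * (ψ ^ (r - 1) * φ) +
        PowerSeries.C (r.choose 2 : 𝕜) * (ψ ^ (r - 2) * PowerSeries.derivative 𝕜 ψ)) := by
  induction r with
  | zero =>
    have hone : SeriesExpansion (fun _ => (1 : PowerSeries 𝕜)) 1 0 := SeriesExpansion.const 1
    simp only [pow_zero, Nat.cast_zero, Nat.choose_zero_succ, map_zero, zero_mul, add_zero]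
    refine hone.congr' ?_
    filter_upwards [hg, h0] with N hN hN0
    have hdiv : taylorAt c (fun u => iteratedDeriv 0 (g N) u / g N u) = taylorAt c fun _ => 1 := by
      refine taylorAt_congr ?_
      filter_upwards [hN.continuousAt.eventually_ne hN0] with u hu
      rw [iteratedDeriv_zero, div_self hu]
    rw [hdiv, taylorAt_const, map_one, one_mul]
  | succ r ih =>
    have hrec := ((ih.derivative.natCast_inv_mul).add (h.mul ih)).congr'
      (Y' := fun N => PowerSeries.C ((N : 𝕜)⁻¹ ^ (r + 1)) *
        taylorAt c fun u => iteratedDeriv (r + 1) (g N) u / g N u) <| by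
        filter_upwards [hg, h0] with N hN hN0
        rw [taylorAt_iteratedDeriv_div hN hN0, Derivation.leibniz, PowerSeries.derivative_C]
        simp only [smul_eq_mul, pow_succ, map_mul]
        ring
    convert hrec using 1
    · rw [zero_add, pow_succ']
    · rw [choose_two_succ_mul_pow_mul_derivative]
      rcases r with _ | r
      · simp
      · simp only [Nat.add_sub_cancel]
        push_cast [map_add, map_one]
        ring

end LogDerivatives

section Leibniz

variable {K : Type*} [Field K] [CharZero K]

theorem choose_two_mul_pow_mul_derivative (ψ : PowerSeries K) (r : ℕ) :
    PowerSeries.C (r.choose 2 : K) * (ψ ^ (r - 2) * PowerSeries.derivative K ψ) =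
      PowerSeries.C (r / 2 : K) * PowerSeries.derivative K (ψ ^ (r - 1)) := by
  rcases r with _ | r
  · simp
  have hchoose : PowerSeries.C ((r + 1).choose 2 : K) =
      PowerSeries.C ((r + 1 : ℕ) / 2 : K) * (r : PowerSeries K) := by
    rw [← map_natCast PowerSeries.C, ← map_mul, Nat.cast_choose_two]
    push_cast
    ring_nf
  rw [PowerSeries.derivative_pow, hchoose, Nat.sub_sub, Nat.add_sub_cancel]
  ring

theorem choose_mul_coeff_leibniz {U U' ψ φ : PowerSeries K} {p : K}
    (hU : PowerSeries.derivative K U = PowerSeries.C p * U') (n s : ℕ) :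
    (n.choose s : K) / (s + 1) * PowerSeries.coeff s
        (U * (PowerSeries.C ((n - s : ℕ) : K) * (ψ ^ (n - s - 1) * φ) +
          PowerSeries.C ((n - s).choose 2 : K) *
            (ψ ^ (n - s - 2) * PowerSeries.derivative K ψ))) =
      n.choose (s + 1) * (PowerSeries.coeff s (U * φ * ψ ^ (n - (s + 1))) -
        p / 2 * PowerSeries.coeff s (U' * ψ ^ (n - (s + 1)))) +
      n.choose (s + 1) * ((s + 1 : ℕ) / 2 : K) *
        PowerSeries.coeff (s + 1) (U * ψ ^ (n - (s + 1))) := by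
  have hchoose : (n.choose s : K) / (s + 1) * (n - s : ℕ) = n.choose (s + 1) := by
    rw [div_mul_eq_mul_div, div_eq_iff (Nat.cast_add_one_ne_zero s)]
    exact_mod_cast (Nat.choose_succ_right_eq n s).symm
  have hleibniz : PowerSeries.coeff s (U * PowerSeries.derivative K (ψ ^ (n - (s + 1)))) =
      PowerSeries.coeff (s + 1) (U * ψ ^ (n - (s + 1))) * (s + 1) -
        p * PowerSeries.coeff s (U' * ψ ^ (n - (s + 1))) := by
    rw [← PowerSeries.coeff_derivative, ← PowerSeries.coeff_C_mul, ← map_sub, Derivation.leibniz,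
      hU]
    simp only [smul_eq_mul]
    congr 1
    ring
  rw [choose_two_mul_pow_mul_derivative, mul_add, mul_left_comm U (PowerSeries.C _),
    mul_left_comm U (PowerSeries.C _), map_add,
    PowerSeries.coeff_C_mul, PowerSeries.coeff_C_mul, Nat.sub_sub, hleibniz, ← hchoose,
    mul_right_comm U, mul_assoc U]
  push_cast
  ring

theorem sum_choose_mul_coeff_leibniz {U U' ψ φ : PowerSeries K} {p : K}
    (hU : PowerSeries.derivative K U = PowerSeries.C p * U') (n : ℕ) :
    ∑ s ∈ Finset.range (n + 1), ((n.choose s : K) / (s + 1) * PowerSeries.coeff s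
        (U * (PowerSeries.C ((n - s : ℕ) : K) * (ψ ^ (n - s - 1) * φ) +
          PowerSeries.C ((n - s).choose 2 : K) *
            (ψ ^ (n - s - 2) * PowerSeries.derivative K ψ))) -
        n.choose s * (s / 2 : K) * PowerSeries.coeff s (U * ψ ^ (n - s))) =
      ∑ s ∈ Finset.range n, (n.choose (s + 1) : K) *
        (PowerSeries.coeff s (U * φ * ψ ^ (n - (s + 1))) -
          p / 2 * PowerSeries.coeff s (U' * ψ ^ (n - (s + 1)))) := by
  simp only [choose_mul_coeff_leibniz hU, add_sub_assoc]
  rw [Finset.sum_add_distrib, Finset.sum_range_sub fun s : ℕ =>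
    (n.choose s : K) * (s / 2 : K) * PowerSeries.coeff s (U * ψ ^ (n - s)), Finset.sum_range_succ]
  simp

end Leibniz

/-- The Taylor series of `u ^ p` at `u = 1`. -/
noncomputable def cpowSeries (p : ℂ) : PowerSeries ℂ := taylorAt 1 fun u => u ^ p

theorem analyticAt_cpow_one (p : ℂ) : AnalyticAt ℂ (fun u : ℂ => u ^ p) 1 :=
  analyticAt_id.cpow analyticAt_const Complex.one_mem_slitPlane

theorem derivative_cpowSeries (p : ℂ) :
    PowerSeries.derivative ℂ (cpowSeries p) = PowerSeries.C p * cpowSeries (p - 1) := by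
  rw [cpowSeries, cpowSeries, ← taylorAt_deriv, ← taylorAt_const_mul]
  refine taylorAt_congr ?_
  filter_upwards [Complex.isOpen_slitPlane.mem_nhds Complex.one_mem_slitPlane] with u hu
  simpa using ((hasDerivAt_id u).cpow_const (c := p) hu).deriv

/-- The value at `1^N` of the operator `V⁻¹ ∑ᵢ uᵢ^(n-q) ∂ᵢⁿ V` on the function `∏ⱼ g(uⱼ) / g(1)`,
where `V` is the Vandermonde product. -/
noncomputable def productValue (N n : ℕ) (q : ℂ) (g : ℂ → ℂ) : ℂ :=
  ∑ s ∈ Finset.range (n + 1), (n.choose s : ℂ) * N.choose (s + 1) *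
    iteratedDeriv s (fun u => u ^ ((n : ℂ) - q) * (iteratedDeriv (n - s) g u / g u)) 1

/-- The limit of `N^(-n-1) * productValue N n q g`, in terms of the limit `ψ` of the Taylor series
of `N⁻¹ (log g)'`. -/
noncomputable def limitValue (n : ℕ) (q : ℂ) (ψ : PowerSeries ℂ) : ℂ :=
  ∑ s ∈ Finset.range (n + 1), (n.choose s : ℂ) / (s + 1) *
    PowerSeries.coeff s (cpowSeries (n - q) * ψ ^ (n - s))

/-- The coefficient of `1 / N` in `N^(-n-1) * productValue N n q g`, where `ψ + φ / N` are the first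
two terms of the Taylor series of `N⁻¹ (log g)'`. -/
noncomputable def correctionValue (n : ℕ) (q : ℂ) (ψ φ : PowerSeries ℂ) : ℂ :=
  ∑ s ∈ Finset.range n, (n.choose (s + 1) : ℂ) *
    (PowerSeries.coeff s (cpowSeries (n - q) * φ * ψ ^ (n - (s + 1))) -
      (n - q) / 2 * PowerSeries.coeff s (cpowSeries (n - q - 1) * ψ ^ (n - (s + 1))))

theorem inv_pow_mul_productValue {g : ℂ → ℂ} (hg : AnalyticAt ℂ g 1) (h0 : g 1 ≠ 0) (N n : ℕ)
    (q : ℂ) :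
    (N : ℂ)⁻¹ ^ (n + 1) * productValue N n q g = ∑ s ∈ Finset.range (n + 1), (n.choose s : ℂ) *
      ((N.choose (s + 1) * (N : ℂ)⁻¹ ^ (s + 1)) * (s.factorial * PowerSeries.coeff s
        (cpowSeries (n - q) * (PowerSeries.C ((N : ℂ)⁻¹ ^ (n - s)) *
          taylorAt 1 fun u => iteratedDeriv (n - s) g u / g u)))) := by
  rw [productValue, Finset.mul_sum]
  refine Finset.sum_congr rfl fun s hs => ?_
  have hsn : n + 1 = (s + 1) + (n - s) := by grind
  rw [iteratedDeriv_eq_coeff_taylorAt, taylorAt_mul (analyticAt_cpow_one _)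
    ((analyticAt_iteratedDeriv hg _).fun_div hg h0), mul_left_comm (cpowSeries _),
    PowerSeries.coeff_C_mul, cpowSeries, hsn, pow_add]
  ring

theorem hasExpansion_productValue {g : ℕ → ℂ → ℂ} {ψ φ : PowerSeries ℂ} (n : ℕ) (q : ℂ)
    (hg : ∀ᶠ N in atTop, AnalyticAt ℂ (g N) 1) (h0 : ∀ᶠ N in atTop, g N 1 ≠ 0)
    (h : SeriesExpansion (fun N => PowerSeries.C ((N : ℂ)⁻¹) *
      taylorAt 1 fun u => deriv (g N) u / g N u) ψ φ) :
    HasExpansion (fun N => (N : ℂ)⁻¹ ^ (n + 1) * productValue N n q (g N))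
      (limitValue n q ψ) (correctionValue n q ψ φ) := by
  have hsum := HasExpansion.sum (Finset.range (n + 1)) fun s _ =>
    ((HasExpansion.choose s).mul ((((SeriesExpansion.const (cpowSeries (n - q))).mul
      (seriesExpansion_iteratedDeriv_div hg h0 h (n - s))) s).const_mul
        (s.factorial : ℂ))).const_mul (n.choose s : ℂ)
  have hfac (s : ℕ) : (s.factorial : ℂ) ≠ 0 := Nat.cast_ne_zero.2 s.factorial_ne_zero
  have hs1 (s : ℕ) : (s : ℂ) + 1 ≠ 0 := Nat.cast_add_one_ne_zero s
  convert hsum.congr' (y' := fun N => (N : ℂ)⁻¹ ^ (n + 1) * productValue N n q (g N)) ?_ using 1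
  · refine Finset.sum_congr rfl fun s _ => ?_
    rw [Nat.factorial_succ]
    push_cast
    have := hfac s
    have := hs1 s
    field_simp
  · rw [correctionValue, ← sum_choose_mul_coeff_leibniz (derivative_cpowSeries _)]
    refine Finset.sum_congr rfl fun s _ => ?_
    rw [Nat.factorial_succ, zero_mul, add_zero]
    push_cast
    have := hfac s
    have := hs1 s
    field_simp
    ring
  · filter_upwards [hg, h0] with N hN hN0
    exact (inv_pow_mul_productValue hN hN0 N n q).symm

/-! ### The functions `Ψ` and `Φ` -/

theorem radius_ofScalars_pos_of_eventually_summable {𝕜 : Type*} [NontriviallyNormedField 𝕜]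
    {p : ℕ → 𝕜} (h : ∀ᶠ z in 𝓝 (0 : 𝕜), Summable fun n => p n * z ^ n) :
    0 < (FormalMultilinearSeries.ofScalars 𝕜 p).radius := by
  obtain ⟨r, hr, hball⟩ := Metric.eventually_nhds_iff.1 h
  obtain ⟨z, hz, hzr⟩ := NormedField.exists_norm_lt 𝕜 hr
  have htendsto := (hball (by simpa using hzr)).tendsto_atTop_zero.norm
  have hle : (‖z‖₊ : ENNReal) ≤ (FormalMultilinearSeries.ofScalars 𝕜 p).radius :=
    FormalMultilinearSeries.le_radius_of_tendsto _ (by simpa using htendsto)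
  exact lt_of_lt_of_le (by simpa using norm_pos_iff.1 hz) hle

theorem hasFPowerSeriesAt_taylorOne {c : ℕ → ℂ} (h : TaylorOneConverges c) :
    HasFPowerSeriesAt (taylorOne c)
      (FormalMultilinearSeries.ofScalars ℂ fun n => c n / n.factorial) 1 := by
  have hshift : Tendsto (fun z : ℂ => 1 + z) (𝓝 0) (𝓝 1) :=
    (continuous_const.add continuous_id).tendsto' _ _ (add_zero 1)
  have hrad := radius_ofScalars_pos_of_eventually_summable
    (p := fun n => c n / n.factorial) <| (hshift.eventually h).mono fun z hz =>
      hz.congr fun n => by rw [add_sub_cancel_left, div_mul_eq_mul_div]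
  have hat := (FormalMultilinearSeries.hasFPowerSeriesOnBall _ hrad).comp_sub 1
  rw [zero_add] at hat
  refine hat.hasFPowerSeriesAt.congr (Eventually.of_forall fun z => tsum_congr fun n => ?_)
  rw [FormalMultilinearSeries.ofScalars_apply_eq, smul_eq_mul]
  ring

theorem analyticAt_taylorOne {c : ℕ → ℂ} (h : TaylorOneConverges c) :
    AnalyticAt ℂ (taylorOne c) 1 :=
  (hasFPowerSeriesAt_taylorOne h).analyticAt

theorem coeff_taylorAt_taylorOne {c : ℕ → ℂ} (h : TaylorOneConverges c) (n : ℕ) :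
    PowerSeries.coeff n (taylorAt 1 (taylorOne c)) = c n / n.factorial := by
  have hseries := (analyticAt_taylorOne h).hasFPowerSeriesAt.eq_formalMultilinearSeries
    (hasFPowerSeriesAt_taylorOne h)
  simpa [FormalMultilinearSeries.coeff_ofScalars, coeff_taylorAt] using
    congrArg (fun p => FormalMultilinearSeries.coeff p n) hseries

/-! ### The limiting moments -/

theorem eventually_ne_zero_nhds_one : ∀ᶠ u : ℂ in 𝓝 1, u ≠ 0 :=
  eventually_ne_nhds one_ne_zero

theorem limitMoment_eq_limitValue {Ψ : ℂ → ℂ} (hΨ : AnalyticAt ℂ Ψ 1) (q : ℝ) (k : ℕ) :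
    limitMoment Ψ q k = limitValue k q (taylorAt 1 (deriv Ψ)) := by
  refine Finset.sum_congr rfl fun m _ => ?_
  have hm : (m.factorial : ℂ) ≠ 0 := Nat.cast_ne_zero.2 m.factorial_ne_zero
  have hm1 : (m : ℂ) + 1 ≠ 0 := Nat.cast_add_one_ne_zero m
  rw [iteratedDeriv_eq_coeff_taylorAt, taylorAt_mul (analyticAt_cpow_one _) (hΨ.deriv.fun_pow _),
    taylorAt_pow hΨ.deriv, Nat.factorial_succ, cpowSeries]
  push_cast
  field_simp

theorem analyticAt_cpow_mul_sub_div {φ : ℂ → ℂ} (hφ : AnalyticAt ℂ φ 1) (p a : ℂ) :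
    AnalyticAt ℂ (fun u => u ^ p * (φ u - a / (2 * u))) 1 :=
  (analyticAt_cpow_one p).fun_mul <| hφ.fun_sub <|
    analyticAt_const.fun_div (analyticAt_const.fun_mul analyticAt_id) (by simp)

theorem taylorAt_cpow_mul_sub_div {φ : ℂ → ℂ} (hφ : AnalyticAt ℂ φ 1) (p a : ℂ) :
    taylorAt 1 (fun u => u ^ p * (φ u - a / (2 * u))) =
      cpowSeries p * taylorAt 1 φ - PowerSeries.C (a / 2) * cpowSeries (p - 1) := by
  rw [cpowSeries, cpowSeries, ← taylorAt_mul (analyticAt_cpow_one p) hφ, ← taylorAt_const_mul,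
    ← taylorAt_sub ((analyticAt_cpow_one p).fun_mul hφ)
      (analyticAt_const.fun_mul (analyticAt_cpow_one (p - 1)))]
  refine taylorAt_congr ?_
  filter_upwards [eventually_ne_zero_nhds_one] with u hu
  rw [Complex.cpow_sub p 1 hu, Complex.cpow_one]
  field_simp

theorem infinitesimalMoment_eq_sum {Ψ Φ : ℂ → ℂ} (hΨ : AnalyticAt ℂ Ψ 1)
    (hΦ : AnalyticAt ℂ Φ 1) (q : ℝ) (k : ℕ) :
    infinitesimalMoment Ψ Φ q k = ∑ m ∈ Finset.range k, (k.choose (m + 1) : ℂ) *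
      (PowerSeries.coeff m (cpowSeries (k - q) * taylorAt 1 (deriv Φ) *
          taylorAt 1 (deriv Ψ) ^ (k - (m + 1))) -
        (1 - q) / 2 * PowerSeries.coeff m (cpowSeries (k - q - 1) *
          taylorAt 1 (deriv Ψ) ^ (k - (m + 1)))) := by
  refine Finset.sum_congr rfl fun m _ => ?_
  have hm : (m.factorial : ℂ) ≠ 0 := Nat.cast_ne_zero.2 m.factorial_ne_zero
  rw [iteratedDeriv_eq_coeff_taylorAt, taylorAt_mul (analyticAt_cpow_mul_sub_div hΦ.deriv _ _)
    (hΨ.deriv.fun_pow _), taylorAt_pow hΨ.deriv, taylorAt_cpow_mul_sub_div hΦ.deriv, sub_mul,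
    map_sub, mul_assoc (PowerSeries.C _), PowerSeries.coeff_C_mul, Nat.sub_sub, ← mul_assoc,
    div_mul_cancel₀ _ hm]

theorem choose_two_mul_limitValue (q : ℂ) (ψ : PowerSeries ℂ) (k : ℕ) :
    k.choose 2 * limitValue (k - 1) q ψ = ∑ s ∈ Finset.range k, (k.choose (s + 1) : ℂ) *
      ((k - 1) / 2 * PowerSeries.coeff s (cpowSeries (k - q - 1) * ψ ^ (k - (s + 1)))) := by
  rcases k with _ | k
  · simp
  rw [Nat.add_sub_cancel, limitValue, Finset.mul_sum]
  refine Finset.sum_congr rfl fun s _ => ?_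
  have hchoose : ((k + 1).choose (s + 1) : ℂ) = (k + 1) * k.choose s / (s + 1) := by
    rw [eq_div_iff (Nat.cast_add_one_ne_zero s)]
    exact_mod_cast (Nat.add_one_mul_choose_eq k s).symm
  have hexp : ((k + 1 : ℕ) : ℂ) - q - 1 = k - q := by
    push_cast
    ring
  rw [hchoose, hexp, Nat.cast_choose_two, Nat.add_sub_add_right]
  push_cast
  ring

theorem correctionValue_add_limitValue {Ψ Φ : ℂ → ℂ} (hΨ : AnalyticAt ℂ Ψ 1)
    (hΦ : AnalyticAt ℂ Φ 1) (q : ℝ) (k : ℕ) :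
    correctionValue k q (taylorAt 1 (deriv Ψ)) (taylorAt 1 (deriv Φ)) +
      k.choose 2 * limitValue (k - 1) q (taylorAt 1 (deriv Ψ)) = infinitesimalMoment Ψ Φ q k := by
  rw [infinitesimalMoment_eq_sum hΨ hΦ, choose_two_mul_limitValue, correctionValue,
    ← Finset.sum_add_distrib]
  refine Finset.sum_congr rfl fun s _ => ?_
  ring

/-! ### The generating functions of the limiting moments -/

theorem sum_choose_mul_coeff {R : Type*} [CommRing R] (k : ℕ) (A ψ : PowerSeries R) :
    ∑ s ∈ Finset.range (k + 1), ((k + 1).choose (s + 1) : R) *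
      PowerSeries.coeff s (A * ψ ^ (k - s)) =
      PowerSeries.coeff k (A * (PowerSeries.X * ψ + 1) ^ (k + 1)) := by
  have hbinom : (PowerSeries.X * ψ + 1) ^ (k + 1) = PowerSeries.X ^ (k + 1) * ψ ^ (k + 1) +
      ∑ s ∈ Finset.range (k + 1), PowerSeries.C ((k + 1).choose (s + 1) : R) *
        (PowerSeries.X ^ (k - s) * ψ ^ (k - s)) := by
    rw [add_comm (PowerSeries.X * ψ), add_pow, Finset.sum_range_succ', add_comm]
    congr 1
    · simp [mul_pow]
    · refine Finset.sum_congr rfl fun s _ => ?_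
      rw [one_pow, one_mul, Nat.add_sub_add_right, mul_pow, map_natCast]
      ring
  rw [hbinom, mul_add, map_add, mul_left_comm, PowerSeries.coeff_X_pow_mul',
    if_neg (by lia), zero_add, Finset.mul_sum, map_sum]
  refine Finset.sum_congr rfl fun s hs => ?_
  rw [mul_left_comm, PowerSeries.coeff_C_mul, mul_left_comm, PowerSeries.coeff_X_pow_mul',
    if_pos (by lia), Nat.sub_sub_self (Finset.mem_range_succ_iff.1 hs)]

/-- The function `H u = u ((u - 1) ψ u + 1)` whose powers produce the limiting moments as Taylor
coefficients, in the form required for Lagrange inversion. -/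
noncomputable def inversionKernel (ψ : ℂ → ℂ) (u : ℂ) : ℂ := u * ((u - 1) * ψ u + 1)

theorem inversionKernel_one_ne_zero (ψ : ℂ → ℂ) : inversionKernel ψ 1 ≠ 0 := by
  simp [inversionKernel]

theorem analyticAt_inversionKernel {ψ : ℂ → ℂ} (hψ : AnalyticAt ℂ ψ 1) :
    AnalyticAt ℂ (inversionKernel ψ) 1 := by
  unfold inversionKernel
  fun_prop

theorem taylorAt_mul_inversionKernel_pow {ψ g f : ℂ → ℂ} (hψ : AnalyticAt ℂ ψ 1)
    (hf : AnalyticAt ℂ f 1) (k : ℕ) (hfg : ∀ᶠ u in 𝓝 1, f u = g u * u ^ k) :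
    taylorAt 1 (fun u => g u * inversionKernel ψ u ^ k) =
      taylorAt 1 f * (PowerSeries.X * taylorAt 1 ψ + 1) ^ k := by
  have hfactor : AnalyticAt ℂ (fun u => (u - 1) * ψ u + 1) 1 := by fun_prop
  have htaylor : taylorAt 1 (fun u => (u - 1) * ψ u + 1) = PowerSeries.X * taylorAt 1 ψ + 1 := by
    rw [taylorAt_add (by fun_prop) (by fun_prop), taylorAt_sub_self_mul hψ, taylorAt_const, map_one]
  rw [← htaylor, ← taylorAt_pow hfactor, ← taylorAt_mul hf (hfactor.fun_pow k)]
  refine taylorAt_congr ?_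
  filter_upwards [hfg] with u hu
  rw [hu, inversionKernel, mul_pow]
  ring

theorem succ_mul_limitMoment_zero {Ψ : ℂ → ℂ} (hΨ : AnalyticAt ℂ Ψ 1) (k : ℕ) :
    ((k : ℂ) + 1) * limitMoment Ψ 0 k =
      PowerSeries.coeff k (taylorAt 1 fun u => u⁻¹ * inversionKernel (deriv Ψ) u ^ (k + 1)) := by
  rw [taylorAt_mul_inversionKernel_pow hΨ.deriv (analyticAt_cpow_one (k - (0 : ℝ))),
    ← sum_choose_mul_coeff, limitMoment_eq_limitValue hΨ, limitValue, Finset.mul_sum]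
  · refine Finset.sum_congr rfl fun s _ => ?_
    have hchoose : ((k + 1).choose (s + 1) : ℂ) = (k + 1) * k.choose s / (s + 1) := by
      rw [eq_div_iff (Nat.cast_add_one_ne_zero s)]
      exact_mod_cast (Nat.add_one_mul_choose_eq k s).symm
    rw [hchoose, cpowSeries]
    ring
  · filter_upwards [eventually_ne_zero_nhds_one] with u hu
    rw [Complex.ofReal_zero, sub_zero, Complex.cpow_natCast, pow_succ]
    field_simp

theorem infinitesimalMoment_zero (Ψ Φ : ℂ → ℂ) (q : ℝ) : infinitesimalMoment Ψ Φ q 0 = 0 :=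
  Finset.sum_range_zero _

theorem infinitesimalMoment_succ {Ψ Φ : ℂ → ℂ} (hΨ : AnalyticAt ℂ Ψ 1) (hΦ : AnalyticAt ℂ Φ 1)
    (q : ℝ) (k : ℕ) :
    infinitesimalMoment Ψ Φ q (k + 1) = PowerSeries.coeff k (taylorAt 1 fun u =>
      u ^ (-(q : ℂ)) * (deriv Φ u - (1 - q) / (2 * u)) *
        inversionKernel (deriv Ψ) u ^ (k + 1)) := by
  have hf := analyticAt_cpow_mul_sub_div hΦ.deriv (((k + 1 : ℕ) : ℂ) - q) (1 - q)
  rw [taylorAt_mul_inversionKernel_pow hΨ.deriv hf, ← sum_choose_mul_coeff, infinitesimalMoment]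
  · refine Finset.sum_congr rfl fun s _ => ?_
    have hs : (s.factorial : ℂ) ≠ 0 := Nat.cast_ne_zero.2 s.factorial_ne_zero
    rw [iteratedDeriv_eq_coeff_taylorAt, taylorAt_mul hf (hΨ.deriv.fun_pow _),
      taylorAt_pow hΨ.deriv, Nat.sub_sub, Nat.add_sub_add_right, ← mul_assoc,
      div_mul_cancel₀ _ hs]
  · filter_upwards [eventually_ne_zero_nhds_one] with u hu
    rw [sub_eq_add_neg, Complex.cpow_add _ _ hu, Complex.cpow_natCast]
    ring

section GeneratingFunctions

variable {Ψ Φ v : ℂ → ℂ}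

theorem eventually_hasSum_succ_mul_limitMoment (hΨ : AnalyticAt ℂ Ψ 1) (hv : AnalyticAt ℂ v 0)
    (hinv : ∀ᶠ u in 𝓝 1, v (lagrangeMap 1 (inversionKernel (deriv Ψ)) u) = u) :
    ∀ᶠ z in 𝓝 (0 : ℂ), HasSum (fun k : ℕ => ((k : ℂ) + 1) * limitMoment Ψ 0 k * z ^ k)
      ((v z)⁻¹ * deriv v z) := by
  have hvinv : AnalyticAt ℂ (fun z => (v z)⁻¹ * deriv v z) 0 :=
    (hv.fun_inv (by simp [leftInverse_lagrangeMap_zero hinv])).fun_mul hv.deriv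
  filter_upwards [eventually_hasSum_taylorAt hvinv] with z hz
  simpa only [zero_add, succ_mul_limitMoment_zero hΨ, coeff_taylorAt_mul_pow_eq_leftInverse
    (analyticAt_inversionKernel hΨ.deriv) (inversionKernel_one_ne_zero _)
    (analyticAt_inv one_ne_zero) hv hinv] using hz

theorem eventually_hasSum_limitMoment (hΨ : AnalyticAt ℂ Ψ 1) (hv : AnalyticAt ℂ v 0)
    (hinv : ∀ᶠ u in 𝓝 1, v (lagrangeMap 1 (inversionKernel (deriv Ψ)) u) = u) :
    ∀ᶠ z in 𝓝 (0 : ℂ), HasSum (fun k : ℕ => limitMoment Ψ 0 k * z ^ (k + 1))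
      (Complex.log (v z)) := by
  have hv0 := leftInverse_lagrangeMap_zero hinv
  have hslit : v 0 ∈ Complex.slitPlane := by simp [hv0]
  have hderiv : taylorAt 0 (fun z => (v z)⁻¹ * deriv v z) =
      PowerSeries.derivative ℂ (taylorAt 0 fun z => Complex.log (v z)) := by
    simpa only [div_eq_inv_mul] using taylorAt_deriv_div hv hslit
  have hcoeff (k : ℕ) : limitMoment Ψ 0 k =
      PowerSeries.coeff (k + 1) (taylorAt 0 fun z => Complex.log (v z)) := by
    refine mul_left_cancel₀ (Nat.cast_add_one_ne_zero k) ?_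
    rw [succ_mul_limitMoment_zero hΨ, coeff_taylorAt_mul_pow_eq_leftInverse
      (analyticAt_inversionKernel hΨ.deriv) (inversionKernel_one_ne_zero _)
      (analyticAt_inv one_ne_zero) hv hinv, hderiv, PowerSeries.coeff_derivative, mul_comm]
  filter_upwards [eventually_hasSum_taylorAt (hv.clog hslit)] with z hz
  simpa [hcoeff, constantCoeff_taylorAt, hv0] using (hasSum_nat_add_iff' 1).2 hz

theorem eventually_hasSum_infinitesimalMoment (hΨ : AnalyticAt ℂ Ψ 1) (hΦ : AnalyticAt ℂ Φ 1)
    (hv : AnalyticAt ℂ v 0)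
    (hinv : ∀ᶠ u in 𝓝 1, v (lagrangeMap 1 (inversionKernel (deriv Ψ)) u) = u) (q : ℝ) :
    ∀ᶠ z in 𝓝 (0 : ℂ), HasSum (fun k : ℕ => infinitesimalMoment Ψ Φ q k * z ^ (k + 1)) (z ^ 2 *
      (v z ^ (-(q : ℂ)) * (deriv Φ (v z) - (1 - q) / (2 * v z)) * deriv v z)) := by
  have hg := analyticAt_cpow_mul_sub_div hΦ.deriv (-(q : ℂ)) (1 - q)
  have hgv := (AnalyticAt.fun_comp
    (by rwa [leftInverse_lagrangeMap_zero hinv]) hv).fun_mul hv.deriv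
  filter_upwards [eventually_hasSum_taylorAt hgv] with z hz
  refine (hasSum_nat_add_iff' 1).1 ?_
  simp only [Finset.sum_range_one, infinitesimalMoment_zero, zero_mul, sub_zero,
    infinitesimalMoment_succ hΨ hΦ, coeff_taylorAt_mul_pow_eq_leftInverse
    (analyticAt_inversionKernel hΨ.deriv) (inversionKernel_one_ne_zero _) hg hv hinv]
  rw [zero_add] at hz
  refine (hz.mul_left (z ^ 2)).congr_fun fun k => ?_
  ring

end GeneratingFunctions

-- The common inverse function `v` turns both sides into elementary expressions in `v`, `v'` and
-- `Φ' ∘ v`, because `∑ μ_k^{(0)} z^{k+1} = log v(z)`.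
theorem eventually_generating_identity {Ψ Φ : ℂ → ℂ} (hΨ : AnalyticAt ℂ Ψ 1)
    (hΦ : AnalyticAt ℂ Φ 1) (q : ℝ) :
    ∀ᶠ z in 𝓝 (0 : ℂ),
      Summable (fun k : ℕ => limitMoment Ψ 0 k * z ^ (k + 1)) ∧
      Summable (fun k : ℕ => infinitesimalMoment Ψ Φ 0 k * z ^ (k + 1)) ∧
      Summable (fun k : ℕ => infinitesimalMoment Ψ Φ q k * z ^ (k + 1)) ∧
      Summable (fun k : ℕ => ((k : ℂ) + 1) * limitMoment Ψ 0 k * z ^ (k + 2)) ∧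
      Complex.exp (q * ∑' k : ℕ, limitMoment Ψ 0 k * z ^ (k + 1)) *
          (∑' k : ℕ, infinitesimalMoment Ψ Φ q k * z ^ (k + 1)) =
        (∑' k : ℕ, infinitesimalMoment Ψ Φ 0 k * z ^ (k + 1)) +
          (q : ℂ) / 2 * (∑' k : ℕ, ((k : ℂ) + 1) * limitMoment Ψ 0 k * z ^ (k + 2)) := by
  obtain ⟨v, hv, hinv⟩ := exists_analyticAt_leftInverse_lagrangeMap
    (analyticAt_inversionKernel hΨ.deriv) (inversionKernel_one_ne_zero _)
  have hv0 : v 0 ≠ 0 := by simp [leftInverse_lagrangeMap_zero hinv]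
  filter_upwards [hv.continuousAt.eventually_ne hv0, eventually_hasSum_limitMoment hΨ hv hinv,
    eventually_hasSum_succ_mul_limitMoment hΨ hv hinv,
    eventually_hasSum_infinitesimalMoment hΨ hΦ hv hinv q,
    eventually_hasSum_infinitesimalMoment hΨ hΦ hv hinv 0] with z hz hlog hinvsum hq h0
  have hinvsum' : HasSum (fun k : ℕ => ((k : ℂ) + 1) * limitMoment Ψ 0 k * z ^ (k + 2))
      (z ^ 2 * ((v z)⁻¹ * deriv v z)) := by
    refine (hinvsum.mul_left (z ^ 2)).congr_fun fun k => ?_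
    ring
  have hexp : Complex.exp (q * Complex.log (v z)) * v z ^ (-(q : ℂ)) = 1 := by
    rw [Complex.cpow_def_of_ne_zero hz, ← Complex.exp_add, mul_neg, mul_comm, add_neg_cancel,
      Complex.exp_zero]
  refine ⟨hlog.summable, h0.summable, hq.summable, hinvsum'.summable, ?_⟩
  rw [hlog.tsum_eq, hq.tsum_eq, h0.tsum_eq, hinvsum'.tsum_eq, Complex.ofReal_zero, neg_zero,
    Complex.cpow_zero]
  calc _ = Complex.exp (q * Complex.log (v z)) * v z ^ (-(q : ℂ)) *
        (z ^ 2 * ((deriv Φ (v z) - (1 - q) / (2 * v z)) * deriv v z)) := by ring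
    _ = _ := by
      rw [hexp]
      field_simp
      ring

/-! ### The difference operators -/

/-- The operator `V⁻¹ ∑ᵢ uᵢ^(n-q) ∂ᵢⁿ V`, where `V` is the Vandermonde product, which has the
characters as eigenfunctions up to a shift. Only the factor of `V` depending on `uᵢ` is kept in the
`i`-th summand, since the other factors cancel. -/
noncomputable def diffOp {N : ℕ} (n : ℕ) (q : ℂ) (f : (Fin N → ℂ) → ℂ) (u : Fin N → ℂ) : ℂ :=
  ∑ i, u i ^ ((n : ℂ) - q) * (∏ j ∈ Finset.univ.erase i, (u i - u j))⁻¹ *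
    iteratedDeriv n (fun z => (∏ j ∈ Finset.univ.erase i, (z - u j)) * f (Function.update u i z))
      (u i)

/-- A ray starting at `1^N`, with distinct coordinates away from its origin. -/
noncomputable def ray (N : ℕ) (ε : ℂ) : Fin N → ℂ := fun j => 1 + ε * (j : ℕ)

/-- `L` is the value of `diffOp n q f` at `1^N`. Since `diffOp` is a junk value where two
coordinates coincide, this value is a limit along the ray. -/
def HasDiffOpValue {N : ℕ} (n : ℕ) (q : ℂ) (f : (Fin N → ℂ) → ℂ) (L : ℂ) : Prop :=
  Tendsto (fun ε => diffOp n q f (ray N ε)) (𝓝[≠] 0) (𝓝 L)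

/-- `f` is holomorphic in a neighbourhood of `1^N`. -/
def HolNearOne {N : ℕ} (f : (Fin N → ℂ) → ℂ) : Prop :=
  ∀ᶠ u in 𝓝 (1 : Fin N → ℂ), DifferentiableAt ℂ f u

theorem one_le_norm_natCast_sub_natCast {a b : ℕ} (h : a ≠ b) : 1 ≤ ‖(a : ℂ) - b‖ := by
  have hint : (1 : ℤ) ≤ |(a : ℤ) - b| := Int.one_le_abs (by omega)
  have hnorm := Complex.norm_intCast ((a : ℤ) - b)
  push_cast at hnorm
  rw [hnorm]
  exact_mod_cast hint

theorem norm_natCast_sub_natCast_le {a b n : ℕ} (ha : a ≤ n) (hb : b ≤ n) :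
    ‖(a : ℂ) - b‖ ≤ n := by
  have hint : |(a : ℤ) - b| ≤ n := abs_le.2 ⟨by omega, by omega⟩
  have hnorm := Complex.norm_intCast ((a : ℤ) - b)
  push_cast at hnorm
  rw [hnorm]
  exact_mod_cast hint

section Ray

variable {N : ℕ} {ε : ℂ}

theorem tendsto_ray (N : ℕ) : Tendsto (ray N) (𝓝[≠] 0) (𝓝 1) := by
  have hcont : Continuous (ray N) := by unfold ray; fun_prop
  have hzero : ray N 0 = 1 := by ext j; simp [ray]
  exact hzero ▸ (hcont.tendsto 0).mono_left nhdsWithin_le_nhds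

theorem tendsto_ray_apply (N : ℕ) (i : Fin N) : Tendsto (fun ε => ray N ε i) (𝓝[≠] 0) (𝓝 1) :=
  ((continuous_apply i).tendsto (1 : Fin N → ℂ)).comp (tendsto_ray N)

theorem ray_sub_ray (N : ℕ) (ε : ℂ) (i j : Fin N) :
    ray N ε i - ray N ε j = ε * ((i : ℕ) - (j : ℕ)) := by
  simp only [ray]; ring

theorem ray_injective (hε : ε ≠ 0) : Function.Injective (ray N ε) := fun _ _ hij =>
  Fin.ext (Nat.cast_injective (R := ℂ) (mul_left_cancel₀ hε (add_left_cancel hij)))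

theorem card_univ_erase (i : Fin N) : (Finset.univ.erase i).card = N - 1 := by
  rw [Finset.card_erase_of_mem (Finset.mem_univ i), Finset.card_fin]

theorem norm_pow_le_norm_prod_ray_sub_ray (ε : ℂ) (i : Fin N) :
    ‖ε‖ ^ (N - 1) ≤ ‖∏ j ∈ Finset.univ.erase i, (ray N ε i - ray N ε j)‖ := by
  rw [norm_prod, ← card_univ_erase i, ← Finset.prod_const]
  refine Finset.prod_le_prod (fun _ _ => norm_nonneg ε) fun j hj => ?_
  rw [ray_sub_ray, norm_mul]
  exact le_mul_of_one_le_right (norm_nonneg ε)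
    (one_le_norm_natCast_sub_natCast (Fin.val_ne_of_ne (Finset.ne_of_mem_erase hj).symm))

theorem norm_prod_sub_ray_le {i : Fin N} {z : ℂ} (hz : ‖z - ray N ε i‖ ≤ ‖ε‖) :
    ‖∏ j ∈ Finset.univ.erase i, (z - ray N ε j)‖ ≤ (‖ε‖ * (N + 1)) ^ (N - 1) := by
  rw [norm_prod, ← card_univ_erase i, ← Finset.prod_const]
  refine Finset.prod_le_prod (fun _ _ => norm_nonneg _) fun j _ => ?_
  calc ‖z - ray N ε j‖ = ‖(z - ray N ε i) + ε * ((i : ℕ) - (j : ℕ))‖ := by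
        rw [← ray_sub_ray, sub_add_sub_cancel]
    _ ≤ ‖ε‖ + ‖ε‖ * N := by
        refine (norm_add_le _ _).trans (add_le_add hz ?_)
        rw [norm_mul]
        gcongr
        exact norm_natCast_sub_natCast_le i.2.le j.2.le
    _ = ‖ε‖ * (N + 1) := by ring

theorem norm_update_ray_sub_one_le {i : Fin N} {z : ℂ} (hz : ‖z - ray N ε i‖ ≤ ‖ε‖) :
    ‖Function.update (ray N ε) i z - 1‖ ≤ ‖ε‖ * (N + 1) := by
  have hray (j : Fin N) : ‖ray N ε j - 1‖ ≤ ‖ε‖ * N := by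
    rw [ray, add_sub_cancel_left, norm_mul, Complex.norm_natCast]
    gcongr
    exact j.2.le
  refine (pi_norm_le_iff_of_nonneg (by positivity)).2 fun j => ?_
  rw [Pi.sub_apply, Pi.one_apply]
  rcases eq_or_ne j i with rfl | hji
  · rw [Function.update_self]
    calc ‖z - 1‖ ≤ ‖z - ray N ε j‖ + ‖ray N ε j - 1‖ := norm_sub_le_norm_sub_add_norm_sub _ _ _
      _ ≤ ‖ε‖ + ‖ε‖ * N := add_le_add hz (hray j)
      _ = ‖ε‖ * (N + 1) := by ring
  · rw [Function.update_of_ne hji]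
    refine (hray j).trans ?_
    gcongr
    exact le_add_of_nonneg_right zero_le_one

end Ray

section Holomorphy

variable {N : ℕ} {f : (Fin N → ℂ) → ℂ}

theorem differentiableAt_comp_update {u : Fin N → ℂ} {i : Fin N} {z : ℂ}
    (hf : DifferentiableAt ℂ f (Function.update u i z)) :
    DifferentiableAt ℂ (fun z => f (Function.update u i z)) z :=
  hf.comp z (hasFDerivAt_update u z).differentiableAt

theorem HolNearOne.eventually_analyticAt_update (hf : HolNearOne f) :
    ∀ᶠ u in 𝓝 (1 : Fin N → ℂ), ∀ i, AnalyticAt ℂ (fun z => f (Function.update u i z)) (u i) := by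
  filter_upwards [hf.eventually_nhds] with u hu i
  rw [Complex.analyticAt_iff_eventually_differentiableAt]
  have hupdate : Tendsto (Function.update u i) (𝓝 (u i)) (𝓝 u) := by
    have hcont : Continuous (Function.update u i) := continuous_const.update i continuous_id
    simpa only [Function.update_eq_self] using hcont.tendsto (u i)
  exact (hupdate.eventually hu).mono fun z hz => differentiableAt_comp_update hz

theorem HolNearOne.sum {ι : Type*} (s : Finset ι) (c : ι → ℂ) {f : ι → (Fin N → ℂ) → ℂ}
    (hf : ∀ a ∈ s, HolNearOne (f a)) : HolNearOne fun u => ∑ a ∈ s, c a * f a u := by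
  filter_upwards [(Finset.eventually_all s).2 hf] with u hu
  exact DifferentiableAt.fun_sum fun a ha => (hu a ha).const_mul _

end Holomorphy

section Linearity

variable {N n : ℕ} {q : ℂ}

theorem diffOp_sum {ι : Type*} (s : Finset ι) (c : ι → ℂ) {f : ι → (Fin N → ℂ) → ℂ} {u : Fin N → ℂ}
    (hf : ∀ a ∈ s, ∀ i, AnalyticAt ℂ (fun z => f a (Function.update u i z)) (u i)) :
    diffOp n q (fun u => ∑ a ∈ s, c a * f a u) u = ∑ a ∈ s, c a * diffOp n q (f a) u := by
  simp only [diffOp, Finset.mul_sum]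
  rw [Finset.sum_comm]
  refine Finset.sum_congr rfl fun i _ => ?_
  simp only [mul_left_comm _ (c _)]
  rw [iteratedDeriv_fun_sum, Finset.mul_sum]
  · refine Finset.sum_congr rfl fun a _ => ?_
    rw [iteratedDeriv_const_mul_field, mul_left_comm]
  · intro a ha
    have hprod : AnalyticAt ℂ (fun z => ∏ j ∈ Finset.univ.erase i, (z - u j)) (u i) := by
      fun_prop
    exact (analyticAt_const.fun_mul (hprod.fun_mul (hf a ha i))).contDiffAt

theorem HasDiffOpValue.sum {ι : Type*} (s : Finset ι) (c : ι → ℂ) {f : ι → (Fin N → ℂ) → ℂ}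
    {L : ι → ℂ} (hf : ∀ a ∈ s, HolNearOne (f a)) (h : ∀ a ∈ s, HasDiffOpValue n q (f a) (L a)) :
    HasDiffOpValue n q (fun u => ∑ a ∈ s, c a * f a u) (∑ a ∈ s, c a * L a) := by
  refine (tendsto_finsetSum s fun a ha => (h a ha).const_mul (c a)).congr' ?_
  filter_upwards [(tendsto_ray N).eventually
    ((Finset.eventually_all s).2 fun a ha => (hf a ha).eventually_analyticAt_update)] with ε hε
  exact (diffOp_sum s c hε).symm

theorem HasDiffOpValue.add {f g : (Fin N → ℂ) → ℂ} {L M : ℂ} (hf : HolNearOne f)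
    (hg : HolNearOne g) (h : HasDiffOpValue n q f L) (h' : HasDiffOpValue n q g M) :
    HasDiffOpValue n q (fun u => f u + g u) (L + M) := by
  simpa using HasDiffOpValue.sum Finset.univ (fun _ : Bool => 1)
    (f := fun b => cond b f g) (L := fun b => cond b L M)
    (fun b _ => by cases b <;> assumption) (fun b _ => by cases b <;> assumption)

theorem HasDiffOpValue.const_mul {f : (Fin N → ℂ) → ℂ} {L : ℂ} (c : ℂ) (hf : HolNearOne f)
    (h : HasDiffOpValue n q f L) : HasDiffOpValue n q (fun u => c * f u) (c * L) := by
  simpa using HasDiffOpValue.sum Finset.univ (fun _ : Unit => c) (fun _ _ => hf) (fun _ _ => h)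

theorem HasDiffOpValue.unique {f : (Fin N → ℂ) → ℂ} {L M : ℂ} (h : HasDiffOpValue n q f L)
    (h' : HasDiffOpValue n q f M) : L = M :=
  tendsto_nhds_unique h h'

end Linearity

section Vanishing

variable {N n k : ℕ} {q ε : ℂ} {f : (Fin N → ℂ) → ℂ} {c δ : ℝ}

theorem norm_iteratedDeriv_prod_sub_ray_mul_le (n : ℕ) (hε : ε ≠ 0) (hεδ : ‖ε‖ * (N + 1) < δ)
    (hc : 0 ≤ c)
    (hf : ∀ ⦃u⦄, dist u 1 < δ → DifferentiableAt ℂ f u ∧ ‖f u‖ ≤ c * ‖u - 1‖ ^ k) (i : Fin N) :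
    ‖iteratedDeriv n (fun z => (∏ j ∈ Finset.univ.erase i, (z - ray N ε j)) *
      f (Function.update (ray N ε) i z)) (ray N ε i)‖ ≤
      n.factorial * ((‖ε‖ * (N + 1)) ^ (N - 1) * (c * (‖ε‖ * (N + 1)) ^ k)) / ‖ε‖ ^ n := by
  have hpos : 0 < ‖ε‖ := norm_pos_iff.2 hε
  have hball {z : ℂ} (hz : ‖z - ray N ε i‖ ≤ ‖ε‖) :
      dist (Function.update (ray N ε) i z) 1 < δ := by
    rw [dist_eq_norm]
    exact (norm_update_ray_sub_one_le hz).trans_lt hεδ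
  refine Complex.norm_iteratedDeriv_le_of_forall_mem_sphere_norm_le n hpos
    (DifferentiableOn.diffContOnCl fun z hz => ?_) fun z hz => ?_
  · rw [closure_ball _ hpos.ne', mem_closedBall_iff_norm] at hz
    have hprod : DifferentiableAt ℂ (fun z => ∏ j ∈ Finset.univ.erase i, (z - ray N ε j)) z := by
      fun_prop
    exact (hprod.fun_mul (differentiableAt_comp_update (hf (hball hz)).1)).differentiableWithinAt
  · rw [mem_sphere_iff_norm] at hz
    rw [norm_mul]
    gcongr
    · exact norm_prod_sub_ray_le hz.le
    · refine (hf (hball hz.le)).2.trans ?_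
      gcongr
      exact norm_update_ray_sub_one_le hz.le

theorem norm_diffOp_ray_le (hε : ε ≠ 0) (hε1 : ‖ε‖ ≤ 1) (hεδ : ‖ε‖ * (N + 1) < δ) (hnk : n ≤ k)
    (hc : 0 ≤ c)
    (hf : ∀ ⦃u⦄, dist u 1 < δ → DifferentiableAt ℂ f u ∧ ‖f u‖ ≤ c * ‖u - 1‖ ^ k)
    (hpow : ∀ i, ‖ray N ε i ^ ((n : ℂ) - q)‖ ≤ 2) :
    ‖diffOp n q f (ray N ε)‖ ≤ N * (2 * (n.factorial * (N + 1) ^ (N - 1 + k))) * c := by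
  have hpos : 0 < ‖ε‖ := norm_pos_iff.2 hε
  rw [diffOp]
  refine (norm_sum_le_of_le (n := fun _ => 2 * (n.factorial * (N + 1) ^ (N - 1 + k)) * c) _
    fun i _ => ?_).trans (by simp [mul_assoc])
  rw [norm_mul, norm_mul, norm_inv]
  calc _ ≤ 2 * (‖ε‖ ^ (N - 1))⁻¹ * (n.factorial * ((‖ε‖ * (N + 1)) ^ (N - 1) *
        (c * (‖ε‖ * (N + 1)) ^ k)) / ‖ε‖ ^ n) := by
        gcongr
        · exact hpow i
        · exact norm_pow_le_norm_prod_ray_sub_ray ε i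
        · exact norm_iteratedDeriv_prod_sub_ray_mul_le n hε hεδ hc hf i
    _ = 2 * (n.factorial * (N + 1) ^ (N - 1 + k)) * c * ‖ε‖ ^ (k - n) := by
        rw [mul_pow, mul_pow, ← pow_sub_mul_pow ‖ε‖ hnk, pow_add]
        field_simp
    _ ≤ 2 * (n.factorial * (N + 1) ^ (N - 1 + k)) * c :=
        mul_le_of_le_one_right (by positivity) (pow_le_one₀ hpos.le hε1)

theorem HasDiffOpValue.of_isLittleO (hf : HolNearOne f) (hnk : n ≤ k)
    (ho : f =o[𝓝 1] fun u => ‖u - 1‖ ^ k) : HasDiffOpValue n q f 0 := by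
  set C : ℝ := N * (2 * (n.factorial * (N + 1) ^ (N - 1 + k))) with hC
  have hpow : ∀ᶠ ε in 𝓝[≠] (0 : ℂ), ∀ i, ‖ray N ε i ^ ((n : ℂ) - q)‖ ≤ 2 := by
    refine eventually_all.2 fun i => ?_
    have hlim := ((analyticAt_cpow_one ((n : ℂ) - q)).continuousAt.tendsto.comp
      (tendsto_ray_apply N i)).norm
    rw [Complex.one_cpow, norm_one] at hlim
    exact hlim.eventually (ge_mem_nhds one_lt_two)
  have hsmall (r : ℝ) (hr : 0 < r) : ∀ᶠ ε in 𝓝[≠] (0 : ℂ), ‖ε‖ < r :=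
    nhdsWithin_le_nhds (by simpa [Metric.ball] using Metric.ball_mem_nhds (0 : ℂ) hr)
  refine (Asymptotics.isLittleO_one_iff ℝ).1 (Asymptotics.isLittleO_iff.2 fun c hc => ?_)
  have hc' : 0 < c / (C + 1) := by positivity
  obtain ⟨δ, hδ, hball⟩ := Metric.eventually_nhds_iff.1 (hf.and (ho.bound hc'))
  filter_upwards [self_mem_nhdsWithin, hsmall 1 one_pos, hsmall (δ / (N + 1)) (by positivity),
    hpow] with ε hε hε1 hεδ hεpow
  refine (norm_diffOp_ray_le hε hε1.le ((lt_div_iff₀ (by positivity)).1 hεδ) hnk hc'.le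
    (fun u hu => by simpa using hball hu) hεpow).trans ?_
  rw [← hC, norm_one, mul_one, mul_div_assoc', div_le_iff₀ (by positivity)]
  nlinarith

theorem HasDiffOpValue.congr_of_isLittleO {g : (Fin N → ℂ) → ℂ} {L : ℂ} (hf : HolNearOne f)
    (hg : HolNearOne g) (hnk : n ≤ k) (ho : (fun u => g u - f u) =o[𝓝 1] fun u => ‖u - 1‖ ^ k)
    (h : HasDiffOpValue n q f L) : HasDiffOpValue n q g L := by
  have hgf : HolNearOne fun u => g u - f u := by
    filter_upwards [hf, hg] with u hu hu' using hu'.fun_sub hu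
  simpa using h.add hf hgf (.of_isLittleO hgf hnk ho)

end Vanishing

/-! ### The value on multiplicative functions -/

section DividedDifference

variable {𝕜 ι : Type*} [DecidableEq ι] {K : Finset ι} {s : ℕ}

/-- The divided difference of `h` at the nodes `x i`, `i ∈ K`. It has its usual meaning only for
distinct nodes. -/
def dividedDifference [Field 𝕜] (h : 𝕜 → 𝕜) (x : ι → 𝕜) (K : Finset ι) : 𝕜 :=
  ∑ i ∈ K, h (x i) * (∏ j ∈ K.erase i, (x i - x j))⁻¹

theorem dividedDifference_pow [Field 𝕜] {x : ι → 𝕜} (hx : Set.InjOn x K) {m : ℕ}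
    (hm : m < K.card) :
    dividedDifference (fun u => u ^ m) x K = if m = K.card - 1 then 1 else 0 := by
  have hcoeff := Lagrange.coeff_eq_sum hx (P := (X : 𝕜[X]) ^ m)
    (by rw [degree_X_pow]; exact_mod_cast hm)
  simpa only [dividedDifference, coeff_X_pow, eval_pow, eval_X, div_eq_mul_inv,
    eq_comm (b := m)] using hcoeff.symm

theorem dividedDifference_const_add_mul [Field 𝕜] {x : ι → 𝕜} (hx : Set.InjOn x K)
    (hK : K.card = s + 1) {h v : 𝕜 → 𝕜} {c : 𝕜} {a : ℕ → 𝕜}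
    (hv : ∀ u, h u = ∑ m ∈ Finset.range s, a m * (u - c) ^ m + (u - c) ^ s * v u) {ε : 𝕜}
    (hε : ε ≠ 0) :
    dividedDifference h (fun i => c + ε * x i) K =
      ∑ i ∈ K, v (c + ε * x i) * (x i ^ s * (∏ j ∈ K.erase i, (x i - x j))⁻¹) := by
  have hscale (i : ι) (hi : i ∈ K) : (∏ j ∈ K.erase i, ((c + ε * x i) - (c + ε * x j)))⁻¹ =
      (ε ^ s)⁻¹ * (∏ j ∈ K.erase i, (x i - x j))⁻¹ := by
    simp only [add_sub_add_left_eq_sub, ← mul_sub]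
    rw [Finset.prod_mul_distrib, Finset.prod_const, Finset.card_erase_of_mem hi, hK,
      Nat.add_sub_cancel, mul_inv]
  have hterm (i : ι) (hi : i ∈ K) :
      h (c + ε * x i) * (∏ j ∈ K.erase i, ((c + ε * x i) - (c + ε * x j)))⁻¹ =
      ∑ m ∈ Finset.range s, a m * (ε ^ m * (ε ^ s)⁻¹) *
        (x i ^ m * (∏ j ∈ K.erase i, (x i - x j))⁻¹) +
      v (c + ε * x i) * (x i ^ s * (∏ j ∈ K.erase i, (x i - x j))⁻¹) := by
    rw [hscale i hi, hv, add_sub_cancel_left, add_mul, Finset.sum_mul]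
    congr 1
    · refine Finset.sum_congr rfl fun m _ => ?_
      rw [mul_pow]
      ring
    · rw [mul_pow]
      field_simp
  have hlow (m : ℕ) (hm : m ∈ Finset.range s) :
      ∑ i ∈ K, x i ^ m * (∏ j ∈ K.erase i, (x i - x j))⁻¹ = 0 := by
    have hms := Finset.mem_range.1 hm
    exact (dividedDifference_pow hx (by omega)).trans (if_neg (by omega))
  rw [dividedDifference, Finset.sum_congr rfl hterm, Finset.sum_add_distrib, Finset.sum_comm,
    Finset.sum_eq_zero fun m hm => by rw [← Finset.mul_sum, hlow m hm, mul_zero], zero_add]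

theorem tendsto_dividedDifference [NontriviallyNormedField 𝕜] [CompleteSpace 𝕜] [CharZero 𝕜]
    {x : ι → 𝕜} (hx : Set.InjOn x K) (hK : K.card = s + 1) {h : 𝕜 → 𝕜} {c : 𝕜}
    (hh : AnalyticAt 𝕜 h c) :
    Tendsto (fun ε => dividedDifference h (fun i => c + ε * x i) K) (𝓝[≠] 0)
      (𝓝 (PowerSeries.coeff s (taylorAt c h))) := by
  obtain ⟨v, hv, hhv, hcoeff⟩ := exists_eq_taylorAt_add_pow_mul hh s
  have hvc : v c = PowerSeries.coeff s (taylorAt c h) := by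
    rw [← constantCoeff_taylorAt c v, ← PowerSeries.coeff_zero_eq_constantCoeff_apply, hcoeff,
      zero_add]
  have hlim (i : ι) : Tendsto (fun ε : 𝕜 => v (c + ε * x i)) (𝓝[≠] 0) (𝓝 (v c)) := by
    have hnode : Tendsto (fun ε : 𝕜 => c + ε * x i) (𝓝 0) (𝓝 c) := by
      simpa using (by fun_prop : Continuous fun ε : 𝕜 => c + ε * x i).tendsto 0
    exact hv.continuousAt.tendsto.comp (hnode.mono_left nhdsWithin_le_nhds)
  have hsum : ∑ i ∈ K, v c * (x i ^ s * (∏ j ∈ K.erase i, (x i - x j))⁻¹) =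
      PowerSeries.coeff s (taylorAt c h) := by
    rw [← Finset.mul_sum, hvc]
    exact (congrArg _ ((dividedDifference_pow hx (by omega)).trans (if_pos (by omega)))).trans
      (mul_one _)
  rw [← hsum]
  refine (tendsto_finsetSum K fun i _ => (hlim i).mul_const _).congr' ?_
  filter_upwards [self_mem_nhdsWithin] with ε hε
  exact (dividedDifference_const_add_mul hx hK hhv hε).symm

end DividedDifference

theorem iteratedDeriv_prod_sub {𝕜 ι : Type*} [NontriviallyNormedField 𝕜] [CharZero 𝕜]
    [CompleteSpace 𝕜] [DecidableEq ι] (A : Finset ι) (x : ι → 𝕜) (c : 𝕜) (s : ℕ) :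
    iteratedDeriv s (fun z => ∏ j ∈ A, (z - x j)) c =
      s.factorial * ∑ J ∈ A.powersetCard s, ∏ j ∈ A \ J, (c - x j) := by
  have hexpand : (fun z => ∏ j ∈ A, (z - x j)) =
      fun z => ∑ J ∈ A.powerset, (∏ j ∈ A \ J, (c - x j)) * (z - c) ^ J.card := by
    funext z
    rw [Finset.prod_congr rfl fun j _ => (sub_add_sub_cancel z c (x j)).symm, Finset.prod_add]
    simp only [Finset.prod_const, mul_comm]
  rw [iteratedDeriv_eq_coeff_taylorAt, hexpand, taylorAt_sum _ fun J _ => by fun_prop, map_sum,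
    Finset.powersetCard_eq_filter, Finset.sum_filter]
  congr 1
  refine Finset.sum_congr rfl fun J _ => ?_
  rw [taylorAt_const_mul, taylorAt_pow (analyticAt_sub_const c c), taylorAt_sub_self,
    PowerSeries.coeff_C_mul, PowerSeries.coeff_X_pow]
  simp [eq_comm]

theorem sum_sum_powersetCard_erase {ι M : Type*} [Fintype ι] [DecidableEq ι] [AddCommMonoid M]
    (s : ℕ) (F : ι → Finset ι → M) :
    ∑ i, ∑ J ∈ (Finset.univ.erase i).powersetCard s, F i J =
      ∑ K ∈ Finset.univ.powersetCard (s + 1), ∑ i ∈ K, F i (K.erase i) := by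
  rw [Finset.sum_sigma', Finset.sum_sigma']
  have hnotMem {i : ι} {J : Finset ι}
      (h : (⟨i, J⟩ : Σ _ : ι, Finset ι) ∈
        Finset.univ.sigma fun i => (Finset.univ.erase i).powersetCard s) : i ∉ J := fun hi =>
    Finset.notMem_erase i _ ((Finset.mem_powersetCard.1 (Finset.mem_sigma.1 h).2).1 hi)
  refine Finset.sum_bij' (fun p _ => ⟨insert p.1 p.2, p.1⟩) (fun p _ => ⟨p.2, p.1.erase p.2⟩)
    ?_ ?_ ?_ ?_ ?_
  · rintro ⟨i, J⟩ h
    have hcard := (Finset.mem_powersetCard.1 (Finset.mem_sigma.1 h).2).2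
    simp [Finset.card_insert_of_notMem (hnotMem h), hcard]
  · rintro ⟨K, i⟩ h
    simp only [Finset.mem_sigma, Finset.mem_univ, true_and, Finset.mem_powersetCard,
      Finset.subset_univ] at h ⊢
    exact ⟨Finset.erase_subset_erase _ (Finset.subset_univ _),
      by rw [Finset.card_erase_of_mem h.2, h.1, Nat.add_sub_cancel]⟩
  · rintro ⟨i, J⟩ h
    simp [Finset.erase_insert (hnotMem h)]
  · rintro ⟨K, i⟩ h
    simp [Finset.insert_erase (Finset.mem_sigma.1 h).2]
  · rintro ⟨i, J⟩ h
    simp [Finset.erase_insert (hnotMem h)]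

section Multiplicative

variable {N : ℕ} {g : ℂ → ℂ}

theorem prod_apply_update (g : ℂ → ℂ) (u : Fin N → ℂ) (i : Fin N) (z : ℂ) :
    ∏ j, g (Function.update u i z j) = g z * ∏ j ∈ Finset.univ.erase i, g (u j) := by
  rw [← Finset.mul_prod_erase _ _ (Finset.mem_univ i), Function.update_self]
  congr 1
  exact Finset.prod_congr rfl fun j hj => by
    rw [Function.update_of_ne (Finset.ne_of_mem_erase hj)]

theorem inv_prod_sub_mul_iteratedDeriv {n : ℕ} {u : Fin N → ℂ} (hu : Function.Injective u)
    {i : Fin N} (hg : AnalyticAt ℂ g (u i)) (hg0 : g (u i) ≠ 0) :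
    (∏ j ∈ Finset.univ.erase i, (u i - u j))⁻¹ *
      iteratedDeriv n (fun z => (∏ j ∈ Finset.univ.erase i, (z - u j)) *
        ∏ j, g (Function.update u i z j)) (u i) =
      (∏ j, g (u j)) * ∑ s ∈ Finset.range (n + 1), ∑ J ∈ (Finset.univ.erase i).powersetCard s,
        (n.choose s : ℂ) * s.factorial * ((iteratedDeriv (n - s) g (u i) / g (u i)) *
          (∏ j ∈ J, (u i - u j))⁻¹) := by
  have hprod : AnalyticAt ℂ (fun z => ∏ j ∈ Finset.univ.erase i, (z - u j)) (u i) := by fun_prop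
  have hne : ∏ j ∈ Finset.univ.erase i, (u i - u j) ≠ 0 := Finset.prod_ne_zero_iff.2 fun j hj =>
    sub_ne_zero.2 (hu.ne (Finset.ne_of_mem_erase hj).symm)
  simp only [prod_apply_update]
  rw [iteratedDeriv_fun_mul hprod.contDiffAt (hg.fun_mul analyticAt_const).contDiffAt,
    ← Finset.mul_prod_erase Finset.univ (fun j => g (u j)) (Finset.mem_univ i), Finset.mul_sum,
    Finset.mul_sum]
  refine Finset.sum_congr rfl fun s _ => ?_
  rw [iteratedDeriv_prod_sub, iteratedDeriv_mul_const_field, Finset.mul_sum, Finset.mul_sum,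
    Finset.sum_mul, Finset.mul_sum, Finset.mul_sum]
  refine Finset.sum_congr rfl fun J hJ => ?_
  rw [← Finset.prod_sdiff (Finset.mem_powersetCard.1 hJ).1] at hne ⊢
  have hdiff := left_ne_zero_of_mul hne
  have hJne := right_ne_zero_of_mul hne
  field_simp

theorem diffOp_prod (n : ℕ) (q : ℂ) {u : Fin N → ℂ} (hu : Function.Injective u)
    (hg : ∀ i, AnalyticAt ℂ g (u i)) (hg0 : ∀ i, g (u i) ≠ 0) :
    diffOp n q (fun u => ∏ j, g (u j)) u = (∏ j, g (u j)) * ∑ s ∈ Finset.range (n + 1),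
      (n.choose s : ℂ) * s.factorial * ∑ K ∈ Finset.univ.powersetCard (s + 1),
        dividedDifference (fun z => z ^ ((n : ℂ) - q) * (iteratedDeriv (n - s) g z / g z)) u K := by
  have hterm (i : Fin N) := inv_prod_sub_mul_iteratedDeriv (n := n) hu (hg i) (hg0 i)
  simp only [diffOp, mul_assoc, hterm, dividedDifference, Finset.mul_sum]
  rw [Finset.sum_comm]
  refine Finset.sum_congr rfl fun s _ => ?_
  rw [sum_sum_powersetCard_erase]
  refine Finset.sum_congr rfl fun K _ => Finset.sum_congr rfl fun i _ => ?_
  ring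

theorem tendsto_sum_dividedDifference_ray (N n : ℕ) (q : ℂ) (hg : AnalyticAt ℂ g 1)
    (h1 : g 1 ≠ 0) :
    Tendsto (fun ε => ∑ s ∈ Finset.range (n + 1), (n.choose s : ℂ) * s.factorial *
      ∑ K ∈ Finset.univ.powersetCard (s + 1),
        dividedDifference (fun z => z ^ ((n : ℂ) - q) * (iteratedDeriv (n - s) g z / g z))
          (ray N ε) K) (𝓝[≠] 0) (𝓝 (productValue N n q g)) := by
  refine tendsto_finsetSum _ fun s _ => ?_
  have hanalytic : AnalyticAt ℂ
      (fun z => z ^ ((n : ℂ) - q) * (iteratedDeriv (n - s) g z / g z)) 1 :=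
    (analyticAt_cpow_one _).fun_mul ((analyticAt_iteratedDeriv hg _).fun_div hg h1)
  have hlim := (tendsto_finsetSum (Finset.univ.powersetCard (s + 1)) fun K hK =>
    tendsto_dividedDifference (x := fun i : Fin N => ((i : ℕ) : ℂ))
      (Nat.cast_injective.comp Fin.val_injective).injOn (Finset.mem_powersetCard.1 hK).2
      hanalytic).const_mul ((n.choose s : ℂ) * s.factorial)
  rw [Finset.sum_const, Finset.card_powersetCard, Finset.card_fin, nsmul_eq_mul] at hlim
  convert hlim using 2
  · rfl
  · rw [iteratedDeriv_eq_coeff_taylorAt]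
    ring

theorem hasDiffOpValue_prod (N n : ℕ) (q : ℂ) (hg : AnalyticAt ℂ g 1) (h1 : g 1 ≠ 0) :
    HasDiffOpValue n q (fun u : Fin N → ℂ => ∏ j, g (u j)) (g 1 ^ N * productValue N n q g) := by
  have hprod : Tendsto (fun ε => ∏ j, g (ray N ε j)) (𝓝[≠] 0) (𝓝 (g 1 ^ N)) := by
    simpa using tendsto_finsetProd Finset.univ fun j _ =>
      hg.continuousAt.tendsto.comp (tendsto_ray_apply N j)
  have hgood : ∀ᶠ ε in 𝓝[≠] (0 : ℂ), ∀ i, AnalyticAt ℂ g (ray N ε i) ∧ g (ray N ε i) ≠ 0 :=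
    eventually_all.2 fun i => (tendsto_ray_apply N i).eventually
      (hg.eventually_analyticAt.and (hg.continuousAt.eventually_ne h1))
  refine (hprod.mul (tendsto_sum_dividedDifference_ray N n q hg h1)).congr' ?_
  filter_upwards [self_mem_nhdsWithin, hgood] with ε hε hgε
  exact (diffOp_prod n q (ray_injective hε) (fun i => (hgε i).1) fun i => (hgε i).2).symm

theorem holNearOne_prod (N : ℕ) (hg : AnalyticAt ℂ g 1) :
    HolNearOne fun u : Fin N → ℂ => ∏ j, g (u j) := by
  have hcoord : ∀ᶠ u in 𝓝 (1 : Fin N → ℂ), ∀ j, AnalyticAt ℂ g (u j) :=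
    eventually_all.2 fun j => ((continuous_apply j).tendsto (1 : Fin N → ℂ)).eventually
      hg.eventually_analyticAt
  filter_upwards [hcoord] with u hu
  exact (HasFDerivAt.finsetProd fun j _ =>
    ((hu j).differentiableAt.comp u (differentiableAt_apply j u)).hasFDerivAt).differentiableAt

end Multiplicative

/-! ### The value on characters -/

section Vandermonde

variable {N : ℕ}

theorem det_vandermonde_update {𝕜 : Type*} [Field 𝕜] {u : Fin N → 𝕜} (hu : Function.Injective u)
    (i : Fin N) (z : 𝕜) :
    (Matrix.vandermonde (Function.update u i z)).det =
      (∏ j ∈ Finset.univ.erase i, (z - u j) / (u i - u j)) * (Matrix.vandermonde u).det := by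
  have hinterp (b : Fin N) : z ^ (b : ℕ) =
      ∑ k, (Lagrange.basis Finset.univ u k).eval z * u k ^ (b : ℕ) := by
    have hX : (X : 𝕜[X]) ^ (b : ℕ) = _ := Lagrange.eq_interpolate (s := Finset.univ) hu.injOn
      (by rw [degree_X_pow, Finset.card_fin]; exact_mod_cast b.2)
    simpa [Lagrange.interpolate_apply, eval_finsetSum, mul_comm] using congrArg (eval z) hX
  have hrow : Matrix.vandermonde (Function.update u i z) = (Matrix.vandermonde u).updateRow i
      (∑ k, (Lagrange.basis Finset.univ u k).eval z • Matrix.vandermonde u k) := by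
    ext a b
    obtain rfl | ha := eq_or_ne a i
    · simpa [Matrix.vandermonde_apply, Finset.sum_apply] using hinterp b
    · simp [Matrix.vandermonde_apply, ha]
  rw [hrow, Matrix.det_updateRow_sum, smul_eq_mul, Lagrange.basis, eval_prod]
  congr 1
  refine Finset.prod_congr rfl fun j _ => ?_
  rw [Lagrange.basisDivisor, eval_mul, eval_C, eval_sub, eval_X, eval_C, div_eq_inv_mul]

theorem det_vandermonde_const_add_mul {R : Type*} [CommRing R] (x : Fin N → R) (c ε : R) :
    (Matrix.vandermonde fun i => c + ε * x i).det =
      (∏ j : Fin N, ε ^ (j : ℕ)) * (Matrix.vandermonde x).det := by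
  have hscale : (Matrix.vandermonde fun i => ε * x i) =
      Matrix.of fun i j : Fin N => ε ^ (j : ℕ) * Matrix.vandermonde x i j := by
    ext i j
    simp [Matrix.vandermonde_apply, mul_pow]
  simp only [add_comm c]
  rw [Matrix.det_vandermonde_add, hscale, Matrix.det_mul_row]

section Taylor

variable {𝕜 : Type*} [NontriviallyNormedField 𝕜] {x : Fin N → 𝕜} {c : 𝕜}

/-- The matrix of the first `N` Taylor coefficients at `c` of `N` functions. -/
noncomputable def taylorMatrix (c : 𝕜) (f : Fin N → 𝕜 → 𝕜) : Matrix (Fin N) (Fin N) 𝕜 :=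
  Matrix.of fun j b => PowerSeries.coeff (j : ℕ) (taylorAt c (f b))

theorem of_apply_const_add_mul_eq_vandermonde_mul (hx : Function.Injective x)
    {f v : Fin N → 𝕜 → 𝕜}
    (hv : ∀ b u, f b u = ∑ n ∈ Finset.range N,
      PowerSeries.coeff n (taylorAt c (f b)) * (u - c) ^ n + (u - c) ^ N * v b u) (ε : 𝕜) :
    (Matrix.of fun a b => f b (c + ε * x a)) =
      Matrix.vandermonde x * (Matrix.diagonal (fun j : Fin N => ε ^ (j : ℕ)) *
        (taylorMatrix c f + Matrix.diagonal (fun j : Fin N => ε ^ (N - (j : ℕ))) *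
          ((Matrix.vandermonde x)⁻¹ * Matrix.of fun a b => x a ^ N * v b (c + ε * x a)))) := by
  have hunit : IsUnit (Matrix.vandermonde x).det :=
    isUnit_iff_ne_zero.2 (Matrix.det_vandermonde_ne_zero_iff.2 hx)
  have hdiag : Matrix.diagonal (fun j : Fin N => ε ^ (j : ℕ)) *
      Matrix.diagonal (fun j : Fin N => ε ^ (N - (j : ℕ))) = ε ^ N • 1 := by
    simp only [Matrix.diagonal_mul_diagonal, ← pow_add, Nat.add_sub_cancel' (Fin.is_lt _).le,
      ← Matrix.smul_one_eq_diagonal]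
  rw [Matrix.mul_add, Matrix.mul_add, ← Matrix.mul_assoc (Matrix.diagonal _) (Matrix.diagonal _),
    hdiag, Matrix.smul_mul, Matrix.one_mul, Matrix.mul_smul,
    Matrix.mul_nonsing_inv_cancel_left _ _ hunit]
  ext a b
  rw [Matrix.of_apply, hv, add_sub_cancel_left, ← Fin.sum_univ_eq_sum_range fun n =>
    PowerSeries.coeff n (taylorAt c (f b)) * (ε * x a) ^ n, mul_pow ε (x a) N, mul_assoc]
  simp only [Matrix.add_apply, Matrix.mul_apply (M := Matrix.vandermonde x), Matrix.diagonal_mul,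
    Matrix.vandermonde_apply, Matrix.smul_apply, Matrix.of_apply, taylorMatrix, smul_eq_mul]
  congr 1
  exact Finset.sum_congr rfl fun j _ => by rw [mul_pow]; ring

theorem tendsto_det_div_det_vandermonde [CompleteSpace 𝕜] [CharZero 𝕜]
    (hx : Function.Injective x) {f : Fin N → 𝕜 → 𝕜} (hf : ∀ b, AnalyticAt 𝕜 (f b) c) :
    Tendsto (fun ε => (Matrix.of fun a b => f b (c + ε * x a)).det /
      (Matrix.vandermonde fun a => c + ε * x a).det) (𝓝[≠] 0) (𝓝 (taylorMatrix c f).det) := by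
  choose v hv hfv _ using fun b => exists_eq_taylorAt_add_pow_mul (hf b) N
  set R : 𝕜 → Matrix (Fin N) (Fin N) 𝕜 := fun ε => Matrix.of fun a b => x a ^ N * v b (c + ε * x a)
  set T : 𝕜 → Matrix (Fin N) (Fin N) 𝕜 := fun ε => taylorMatrix c f +
    Matrix.diagonal (fun j : Fin N => ε ^ (N - (j : ℕ))) * ((Matrix.vandermonde x)⁻¹ * R ε)
    with hT
  have hnode (a : Fin N) : ContinuousAt (fun ε : 𝕜 => c + ε * x a) 0 := by fun_prop
  have hRcont : ContinuousAt R 0 := continuousAt_pi.2 fun a => continuousAt_pi.2 fun b =>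
    continuousAt_const.mul ((hv b).continuousAt.comp_of_eq (hnode a) (by simp))
  have hT0 : T 0 = taylorMatrix c f := by
    have hdiag : Matrix.diagonal (fun j : Fin N => (0 : 𝕜) ^ (N - (j : ℕ))) = 0 := by
      simp [zero_pow (Nat.sub_ne_zero_of_lt (Fin.is_lt _))]
    rw [hT]
    simp only [hdiag, zero_mul, add_zero]
  have hTcont : ContinuousAt T 0 := by
    have hdiag : Continuous fun ε : 𝕜 =>
        Matrix.diagonal (fun j : Fin N => ε ^ (N - (j : ℕ))) := by fun_prop
    exact continuousAt_const.add (hdiag.continuousAt.mul (continuousAt_const.mul hRcont))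
  have hdet : Tendsto (fun ε => (T ε).det) (𝓝[≠] 0) (𝓝 (taylorMatrix c f).det) :=
    hT0 ▸ (continuous_id.matrix_det.continuousAt.comp hTcont).tendsto.mono_left nhdsWithin_le_nhds
  refine hdet.congr' ?_
  filter_upwards [self_mem_nhdsWithin] with ε hε
  have hprod : ∏ j : Fin N, ε ^ (j : ℕ) ≠ 0 := Finset.prod_ne_zero_iff.2 fun j _ => pow_ne_zero _ hε
  have hV := Matrix.det_vandermonde_ne_zero_iff.2 hx
  rw [of_apply_const_add_mul_eq_vandermonde_mul hx hfv, det_vandermonde_const_add_mul,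
    Matrix.det_mul, Matrix.det_mul, Matrix.det_diagonal]
  field_simp
  rfl

end Taylor

/-- The sign relating the product `∏_{i<j} (u_i - u_j)`, by which the characters are defined, to the
determinant of the Vandermonde matrix. -/
def vandermondeSign (N : ℕ) : ℂ :=
  (-1) ^ (Finset.univ.filter fun p : Fin N × Fin N => p.1 < p.2).card

theorem prod_sub_eq_vandermondeSign_mul_det (u : Fin N → ℂ) :
    ∏ p : Fin N × Fin N with p.1 < p.2, (u p.1 - u p.2) =
      vandermondeSign N * (Matrix.vandermonde u).det := by
  have hdet : (Matrix.vandermonde u).det =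
      ∏ p : Fin N × Fin N with p.1 < p.2, (u p.2 - u p.1) := by
    rw [Matrix.det_vandermonde, Finset.prod_filter, Fintype.prod_prod_type]
    refine Finset.prod_congr rfl fun i _ => ?_
    rw [← Finset.prod_filter, Finset.filter_lt_eq_Ioi]
  rw [hdet, vandermondeSign, ← Finset.prod_const, ← Finset.prod_mul_distrib]
  exact Finset.prod_congr rfl fun p _ => by ring

end Vandermonde

theorem eval_mul_iteratedDeriv_zpow (n : ℕ) (q : ℂ) (m : ℤ) {x : ℂ} (hx : x ≠ 0) :
    x ^ ((n : ℂ) - q) * iteratedDeriv n (fun z : ℂ => z ^ (m : ℂ)) x =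
      (descPochhammer ℂ n).eval (m : ℂ) * x ^ ((m : ℂ) - q) := by
  have hpow : x ^ ((m : ℂ) - q) = x ^ ((n : ℂ) - q) * x ^ (m - n) := by
    rw [← Complex.cpow_intCast, ← Complex.cpow_add _ _ hx]
    push_cast
    ring_nf
  simp only [Complex.cpow_intCast]
  rw [iteratedDeriv_eq_iterate, iter_deriv_zpow, descPochhammer_eval_eq_prod_range, hpow]
  ring

theorem coeff_cpowSeries (j : ℕ) (m : ℂ) :
    PowerSeries.coeff j (cpowSeries m) = (descPochhammer ℂ j).eval m / j.factorial := by
  induction j generalizing m with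
  | zero => simp [cpowSeries, constantCoeff_taylorAt]
  | succ j ih =>
    have hrec := congrArg (PowerSeries.coeff j) (derivative_cpowSeries m)
    rw [PowerSeries.coeff_derivative, PowerSeries.coeff_C_mul, ih,
      ← eq_div_iff (Nat.cast_add_one_ne_zero j)] at hrec
    rw [hrec, descPochhammer_succ_left, Nat.factorial_succ, eval_mul, eval_X, eval_comp, eval_sub,
      eval_X, eval_one]
    push_cast
    field_simp

section PowerMatrix

variable {N : ℕ}

/-- The matrix `(uᵢ ^ mⱼ)`, whose determinants are the numerators of the characters. -/
noncomputable def powerMatrix (u m : Fin N → ℂ) : Matrix (Fin N) (Fin N) ℂ :=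
  Matrix.of fun i j => u i ^ m j

theorem powerMatrix_update_left (u m : Fin N → ℂ) (i : Fin N) (z : ℂ) :
    powerMatrix (Function.update u i z) m = (powerMatrix u m).updateRow i fun j => z ^ m j := by
  ext a b
  obtain rfl | ha := eq_or_ne a i
  · simp [powerMatrix]
  · simp [powerMatrix, ha]

theorem powerMatrix_update_right (u m : Fin N → ℂ) (b : Fin N) (c : ℂ) :
    powerMatrix u (Function.update m b c) = (powerMatrix u m).updateCol b fun i => u i ^ c := by
  ext i j
  obtain rfl | hj := eq_or_ne j b
  · simp [powerMatrix]
  · simp [powerMatrix, hj]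

theorem det_taylorMatrix_cpow (m : Fin N → ℂ) :
    (taylorMatrix 1 fun b u => u ^ m b).det =
      (∏ j : Fin N, ((j : ℕ).factorial : ℂ)⁻¹) * (Matrix.vandermonde m).det := by
  rw [Matrix.det_eval_matrixOfPolynomials_eq_det_vandermonde m (fun j => descPochhammer ℂ j)
    (fun j => descPochhammer_natDegree ℂ j) (fun j => monic_descPochhammer ℂ j),
    ← Matrix.det_transpose (taylorMatrix _ _), ← Matrix.det_mul_row]
  congr 1
  ext i j
  exact (coeff_cpowSeries j (m i)).trans (div_eq_inv_mul _ _)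

theorem tendsto_det_powerMatrix_ray (m : Fin N → ℂ) :
    Tendsto (fun ε => (powerMatrix (ray N ε) m).det / (Matrix.vandermonde (ray N ε)).det)
      (𝓝[≠] 0) (𝓝 ((∏ j : Fin N, ((j : ℕ).factorial : ℂ)⁻¹) * (Matrix.vandermonde m).det)) :=
  det_taylorMatrix_cpow m ▸ tendsto_det_div_det_vandermonde
    (x := fun i : Fin N => ((i : ℕ) : ℂ)) (Nat.cast_injective.comp Fin.val_injective)
    (f := fun b u => u ^ m b) fun b => analyticAt_cpow_one (m b)

end PowerMatrix

section Character

variable {N : ℕ} (lam : Signature N)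

theorem Signature.shifted_strictAnti : StrictAnti lam.shifted := fun i j hij => by
  have hle := lam.2 hij.le
  rw [Fin.lt_def] at hij
  unfold Signature.shifted
  omega

theorem Signature.shifted_cast_injective : Function.Injective fun i => (lam.shifted i : ℂ) :=
  Int.cast_injective.comp lam.shifted_strictAnti.injective

theorem det_vandermonde_update_shifted (q : ℝ) (i : Fin N) :
    (Matrix.vandermonde (Function.update (fun j => (lam.shifted j : ℂ)) i
      (lam.shifted i - q))).det =
      (ppWeight q lam i : ℂ) * (Matrix.vandermonde fun j => (lam.shifted j : ℂ)).det := by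
  rw [det_vandermonde_update lam.shifted_cast_injective, ppWeight]
  push_cast
  simp only [sub_right_comm]

theorem det_vandermonde_mul_schurChar {u : Fin N → ℂ} (hu : ∀ i, u i ≠ 0) :
    (Matrix.vandermonde u).det * schurChar lam u =
      vandermondeSign N * (powerMatrix u fun j => (lam.shifted j : ℂ)).det := by
  have hsign : vandermondeSign N * vandermondeSign N = 1 := by
    rw [vandermondeSign, ← mul_pow, neg_one_mul, neg_neg, one_pow]
  have hdef := prod_mul_schurChar lam u hu
  rw [prod_sub_eq_vandermondeSign_mul_det] at hdef
  simp only [powerMatrix, Complex.cpow_intCast, ← hdef]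
  rw [mul_assoc, ← mul_assoc (vandermondeSign N), hsign, one_mul]

theorem analyticAt_schurChar {u : Fin N → ℂ} (hu : ∀ i, u i ≠ 0) :
    AnalyticAt ℂ (schurChar lam) u := by
  have hprod : AnalyticAt ℂ (fun u : Fin N → ℂ => ∏ i, u i) u :=
    Finset.analyticAt_fun_prod _ fun i _ =>
      (ContinuousLinearMap.proj (R := ℂ) (φ := fun _ : Fin N => ℂ) i).analyticAt u
  exact (AnalyticOnNhd.eval_mvPolynomial _ u (Set.mem_univ u)).fun_div (hprod.fun_pow _)
    (pow_ne_zero _ (Finset.prod_ne_zero_iff.2 fun i _ => hu i))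

theorem holNearOne_schurChar : HolNearOne (schurChar lam) :=
  (analyticAt_schurChar lam fun _ => one_ne_zero).eventually_analyticAt.mono
    fun _ h => h.differentiableAt

theorem eventually_schurChar_update_eq {u : Fin N → ℂ} (hu : Function.Injective u)
    (hu0 : ∀ i, u i ≠ 0) (i : Fin N) :
    ∀ᶠ z in 𝓝 (u i), (Matrix.vandermonde u).det * ((∏ j ∈ Finset.univ.erase i, (u i - u j))⁻¹ *
        ((∏ j ∈ Finset.univ.erase i, (z - u j)) * schurChar lam (Function.update u i z))) =
      vandermondeSign N * ∑ b, (powerMatrix u fun j => (lam.shifted j : ℂ)).adjugate b i *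
        z ^ (lam.shifted b : ℂ) := by
  filter_upwards [continuousAt_id.eventually_ne (hu0 i)] with z hz
  have hz0 (j : Fin N) : Function.update u i z j ≠ 0 := by
    obtain rfl | hj := eq_or_ne j i
    · rwa [Function.update_self]
    · rw [Function.update_of_ne hj]
      exact hu0 j
  have hchar := det_vandermonde_mul_schurChar lam hz0
  rw [det_vandermonde_update hu, Finset.prod_div_distrib, powerMatrix_update_left,
    ← Matrix.cramer_transpose_apply, Matrix.cramer_eq_adjugate_mulVec,
    ← Matrix.adjugate_transpose] at hchar
  exact Eq.trans (by ring) hchar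

theorem det_vandermonde_mul_diffOp_schurChar (n : ℕ) (q : ℂ) {u : Fin N → ℂ}
    (hu : Function.Injective u) (hu0 : ∀ i, u i ≠ 0) :
    (Matrix.vandermonde u).det * diffOp n q (schurChar lam) u =
      vandermondeSign N * ∑ b, (descPochhammer ℂ n).eval (lam.shifted b : ℂ) *
        (powerMatrix u (Function.update (fun j => (lam.shifted j : ℂ)) b
          (lam.shifted b - q))).det := by
  set M := powerMatrix u fun j => (lam.shifted j : ℂ)
  have hpow (i b : Fin N) : AnalyticAt ℂ (fun z : ℂ => z ^ (lam.shifted b : ℂ)) (u i) := by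
    simp only [Complex.cpow_intCast]
    exact analyticAt_id.fun_zpow (hu0 i)
  have hterm (i : Fin N) : (Matrix.vandermonde u).det * (u i ^ ((n : ℂ) - q) *
      (∏ j ∈ Finset.univ.erase i, (u i - u j))⁻¹ * iteratedDeriv n (fun z =>
        (∏ j ∈ Finset.univ.erase i, (z - u j)) * schurChar lam (Function.update u i z)) (u i)) =
      vandermondeSign N * ∑ b, (descPochhammer ℂ n).eval (lam.shifted b : ℂ) *
        (M.adjugate b i * u i ^ ((lam.shifted b : ℂ) - q)) := by
    have hderiv := EventuallyEq.iteratedDeriv_eq n (eventually_schurChar_update_eq lam hu hu0 i)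
    rw [iteratedDeriv_const_mul_field, iteratedDeriv_const_mul_field, iteratedDeriv_const_mul_field,
      iteratedDeriv_fun_sum fun b _ => (analyticAt_const.fun_mul (hpow i b)).contDiffAt] at hderiv
    rw [mul_assoc, mul_left_comm, hderiv, mul_left_comm, Finset.mul_sum]
    congr 1
    refine Finset.sum_congr rfl fun b _ => ?_
    rw [iteratedDeriv_const_mul_field, mul_left_comm, eval_mul_iteratedDeriv_zpow n q _ (hu0 i),
      mul_left_comm]
  have hdet (b : Fin N) : (powerMatrix u (Function.update (fun j => (lam.shifted j : ℂ)) b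
      (lam.shifted b - q))).det = ∑ i, M.adjugate b i * u i ^ ((lam.shifted b : ℂ) - q) := by
    rw [powerMatrix_update_right, ← Matrix.cramer_apply, Matrix.cramer_eq_adjugate_mulVec]
    rfl
  rw [diffOp, Finset.mul_sum, Finset.sum_congr rfl fun i _ => hterm i, ← Finset.mul_sum,
    Finset.sum_comm]
  simp only [hdet, Finset.mul_sum]

theorem eventually_ray_ne_zero (N : ℕ) : ∀ᶠ ε in 𝓝[≠] (0 : ℂ), ∀ i, ray N ε i ≠ 0 :=
  eventually_all.2 fun i => (tendsto_ray_apply N i).eventually_ne one_ne_zero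

theorem det_vandermonde_ray_ne_zero {ε : ℂ} (hε : ε ≠ 0) : (Matrix.vandermonde (ray N ε)).det ≠ 0 :=
  Matrix.det_vandermonde_ne_zero_iff.2 (ray_injective hε)

theorem schurChar_one : schurChar lam 1 = vandermondeSign N *
    ((∏ j : Fin N, ((j : ℕ).factorial : ℂ)⁻¹) *
      (Matrix.vandermonde fun j => (lam.shifted j : ℂ)).det) := by
  have hcont : Tendsto (fun ε => schurChar lam (ray N ε)) (𝓝[≠] 0) (𝓝 (schurChar lam 1)) :=
    (analyticAt_schurChar lam fun _ => one_ne_zero).continuousAt.tendsto.comp (tendsto_ray N)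
  refine tendsto_nhds_unique hcont
    (((tendsto_det_powerMatrix_ray fun j => (lam.shifted j : ℂ)).const_mul _).congr' ?_)
  filter_upwards [eventually_ray_ne_zero N, self_mem_nhdsWithin] with ε hray hε
  rw [← mul_div_assoc, ← det_vandermonde_mul_schurChar lam hray,
    mul_div_cancel_left₀ _ (det_vandermonde_ray_ne_zero hε)]

theorem schurChar_one_ne_zero : schurChar lam 1 ≠ 0 := by
  rw [schurChar_one]
  refine mul_ne_zero (pow_ne_zero _ (neg_ne_zero.2 one_ne_zero)) (mul_ne_zero ?_
    (Matrix.det_vandermonde_ne_zero_iff.2 lam.shifted_cast_injective))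
  exact Finset.prod_ne_zero_iff.2 fun j _ =>
    inv_ne_zero (Nat.cast_ne_zero.2 (Nat.factorial_ne_zero j))

theorem hasDiffOpValue_schurChar (n : ℕ) (q : ℝ) :
    HasDiffOpValue n q (fun u => schurChar lam u / schurChar lam 1)
      (∑ i, (descPochhammer ℂ n).eval (lam.shifted i : ℂ) * (ppWeight q lam i : ℂ)) := by
  have hterm (b : Fin N) := (tendsto_det_powerMatrix_ray (Function.update
    (fun j => (lam.shifted j : ℂ)) b (lam.shifted b - q))).const_mul
      ((descPochhammer ℂ n).eval (lam.shifted b : ℂ))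
  have hlim := (tendsto_finsetSum Finset.univ fun b _ => hterm b).const_mul (vandermondeSign N)
  have hval : HasDiffOpValue n q (schurChar lam) (schurChar lam 1 *
      ∑ i, (descPochhammer ℂ n).eval (lam.shifted i : ℂ) * (ppWeight q lam i : ℂ)) := by
    have hlimit : vandermondeSign N * ∑ b, (descPochhammer ℂ n).eval (lam.shifted b : ℂ) *
        ((∏ j : Fin N, ((j : ℕ).factorial : ℂ)⁻¹) * (Matrix.vandermonde
          (Function.update (fun j => (lam.shifted j : ℂ)) b (lam.shifted b - q))).det) =
        schurChar lam 1 *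
          ∑ b, (descPochhammer ℂ n).eval (lam.shifted b : ℂ) * (ppWeight q lam b : ℂ) := by
      rw [schurChar_one, mul_assoc]
      congr 1
      rw [Finset.mul_sum]
      refine Finset.sum_congr rfl fun b _ => ?_
      rw [det_vandermonde_update_shifted]
      ring
    rw [hlimit] at hlim
    refine hlim.congr' ?_
    filter_upwards [eventually_ray_ne_zero N, self_mem_nhdsWithin] with ε hray hε
    rw [← mul_div_cancel_left₀ (diffOp n q _ _) (det_vandermonde_ray_ne_zero hε),
      det_vandermonde_mul_diffOp_schurChar lam n q (ray_injective hε) hray, mul_div_assoc,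
      Finset.sum_div]
    simp only [mul_div_assoc]
  have hnorm := hval.const_mul (schurChar lam 1)⁻¹ (holNearOne_schurChar lam)
  rw [inv_mul_cancel_left₀ (schurChar_one_ne_zero lam)] at hnorm
  simpa only [div_eq_inv_mul] using hnorm

end Character

/-! ### Symmetric functions near `1^N` -/

/-- The mixed partial derivative `∂_{i₁} ⋯ ∂_{iₘ} f (1^N)`; it is `0` if an index is not a
coordinate. -/
noncomputable def coordDeriv {N m : ℕ} (f : (Fin N → ℂ) → ℂ) (i : Fin m → ℕ) : ℂ :=
  iteratedFDeriv ℂ m f 1 fun a => coordDir N (i a)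

/-- `f` is invariant under permutations of the coordinates in a neighbourhood of `1^N`. -/
def SymmNearOne {N : ℕ} (f : (Fin N → ℂ) → ℂ) : Prop :=
  ∀ σ : Equiv.Perm (Fin N), (fun u : Fin N → ℂ => f (u ∘ σ)) =ᶠ[𝓝 1] f

theorem coordDir_val {N : ℕ} (i : Fin N) : coordDir N i = Pi.single i 1 := by
  ext j
  simp only [coordDir, Pi.single_apply, Fin.ext_iff]

theorem exists_perm_castLE {N r : ℕ} {j : Fin r → Fin N} (hj : Function.Injective j) :
    ∃ h : r ≤ N, ∃ σ : Equiv.Perm (Fin N), ∀ b, σ (Fin.castLE h b) = j b := by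
  have h : r ≤ N := by simpa using Fintype.card_le_of_injective j hj
  let e := (Equiv.ofInjective _ (Fin.castLE_injective h)).symm.trans (Equiv.ofInjective j hj)
  classical
  refine ⟨h, e.extendSubtype, fun b => ?_⟩
  rw [Equiv.extendSubtype_apply_of_mem e _ ⟨b, rfl⟩]
  exact congrArg (fun c => (Equiv.ofInjective j hj c : Fin N))
    (Equiv.ofInjective_symm_apply (Fin.castLE_injective h) b)

namespace SymmNearOne

variable {N m r : ℕ} {f : (Fin N → ℂ) → ℂ}

theorem iteratedFDeriv_perm (hf : SymmNearOne f) (σ : Equiv.Perm (Fin N)) (i : Fin m → Fin N) :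
    iteratedFDeriv ℂ m f 1 (fun a => Pi.single (σ (i a)) 1) =
      iteratedFDeriv ℂ m f 1 fun a => Pi.single (i a) 1 := by
  let e : (Fin N → ℂ) ≃L[ℂ] (Fin N → ℂ) :=
    (LinearEquiv.funCongrLeft ℂ ℂ σ).toContinuousLinearEquiv
  have hinvariant : iteratedFDeriv ℂ m (f ∘ e) 1 = iteratedFDeriv ℂ m f 1 :=
    (EventuallyEq.iteratedFDeriv ℂ (hf σ) m).eq_of_nhds
  have hcomp := e.iteratedFDerivWithin_comp_right f uniqueDiffOn_univ (Set.mem_univ (e 1)) m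
  have he : e 1 = 1 := rfl
  rw [Set.preimage_univ, iteratedFDerivWithin_univ, iteratedFDerivWithin_univ, he, hinvariant]
    at hcomp
  conv_lhs => rw [hcomp]
  rw [ContinuousMultilinearMap.compContinuousLinearMap_apply]
  congr 1
  ext a b
  simp [e, Pi.single_apply]

theorem iteratedFDeriv_single_comp (hf : SymmNearOne f) (κ : Fin m → Fin r) {j : Fin r → Fin N}
    (hj : Function.Injective j) :
    iteratedFDeriv ℂ m f 1 (fun a => Pi.single (j (κ a)) 1) =
      coordDeriv f fun a => (κ a : ℕ) := by
  obtain ⟨h, σ, hσ⟩ := exists_perm_castLE hj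
  simp only [← hσ]
  rw [hf.iteratedFDeriv_perm σ fun a => Fin.castLE h (κ a)]
  simp only [← coordDir_val, coordDeriv, Fin.val_castLE]

end SymmNearOne

/-! ### Taylor expansion in several variables -/

section Taylor

variable {E F : Type*} [NormedAddCommGroup E] [NormedAddCommGroup F] [CompleteSpace F]

theorem norm_sub_taylor_le [NormedSpace ℝ E] [NormedSpace ℝ F] {f : E → F} {x u : E} {k : ℕ}
    {C : ℝ} (hf : ∀ t ∈ Set.Icc (0 : ℝ) 1, ContDiffAt ℝ (k + 1) f (x + t • (u - x)))
    (hC : ∀ t ∈ Set.Icc (0 : ℝ) 1, ‖iteratedFDeriv ℝ (k + 1) f (x + t • (u - x))‖ ≤ C) :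
    ‖f u - ∑ m ∈ Finset.range (k + 1), (m.factorial : ℝ)⁻¹ •
      iteratedFDeriv ℝ m f x fun _ => u - x‖ ≤ C * ‖u - x‖ ^ (k + 1) := by
  have htaylor := map_add_eq_sum_add_integral_iteratedFDeriv (y := u - x) hf
  rw [add_sub_cancel] at htaylor
  rw [htaylor, add_sub_cancel_left, norm_smul]
  have hintegral : ‖∫ t in (0 : ℝ)..1, (1 - t) ^ k •
      iteratedFDeriv ℝ (k + 1) f (x + t • (u - x)) fun _ => u - x‖ ≤
      C * ‖u - x‖ ^ (k + 1) * |(1 : ℝ) - 0| := by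
    refine intervalIntegral.norm_integral_le_of_norm_le_const fun t ht => ?_
    rw [Set.uIoc_of_le zero_le_one] at ht
    rw [norm_smul, norm_pow, Real.norm_of_nonneg (by linarith [ht.2])]
    refine (mul_le_of_le_one_left (norm_nonneg _)
      (pow_le_one₀ (by linarith [ht.2]) (by linarith [ht.1]))).trans ?_
    refine ((iteratedFDeriv ℝ (k + 1) f _).le_opNorm _).trans ?_
    rw [Finset.prod_const, Finset.card_univ, Fintype.card_fin]
    gcongr
    exact hC t ⟨ht.1.le, ht.2⟩
  have hfactorial : ‖(k.factorial : ℝ)⁻¹‖ ≤ 1 := by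
    rw [norm_inv, Real.norm_natCast]
    exact inv_le_one_of_one_le₀ (by exact_mod_cast k.factorial_pos)
  refine (mul_le_of_le_one_left (norm_nonneg _) hfactorial).trans (hintegral.trans_eq ?_)
  rw [sub_zero, abs_one, mul_one]

theorem isBigO_sub_taylor_real [NormedSpace ℝ E] [NormedSpace ℝ F] {f : E → F} {x : E} {k : ℕ}
    (hf : ContDiffAt ℝ (k + 1) f x) :
    (fun u => f u - ∑ m ∈ Finset.range (k + 1), (m.factorial : ℝ)⁻¹ •
      iteratedFDeriv ℝ m f x fun _ => u - x) =O[𝓝 x] fun u => ‖u - x‖ ^ (k + 1) := by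
  have hcont : ContinuousAt (iteratedFDeriv ℝ (k + 1) f) x :=
    (hf.iteratedFDeriv_right (i := k + 1) (m := 0) (by simp)).continuousAt
  have hbound : ∀ᶠ u in 𝓝 x, ‖iteratedFDeriv ℝ (k + 1) f u‖ <
      ‖iteratedFDeriv ℝ (k + 1) f x‖ + 1 :=
    hcont.norm.eventually_lt_const (lt_add_one _)
  obtain ⟨δ, hδ, hball⟩ :=
    Metric.eventually_nhds_iff_ball.1 ((hf.eventually (by simp)).and hbound)
  refine Asymptotics.IsBigO.of_bound (‖iteratedFDeriv ℝ (k + 1) f x‖ + 1) ?_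
  filter_upwards [Metric.ball_mem_nhds x hδ] with u hu
  have hsegment : ∀ t ∈ Set.Icc (0 : ℝ) 1, x + t • (u - x) ∈ Metric.ball x δ := fun t ht =>
    (convex_ball x δ).add_smul_sub_mem (Metric.mem_ball_self hδ) hu ht
  rw [norm_pow, norm_norm]
  exact norm_sub_taylor_le (fun t ht => (hball _ (hsegment t ht)).1)
    fun t ht => (hball _ (hsegment t ht)).2.le

theorem isBigO_sub_taylor {𝕜 : Type*} [RCLike 𝕜] [NormedSpace 𝕜 E] [NormedSpace 𝕜 F] {f : E → F}
    {x : E} {k : ℕ} (hf : ContDiffAt 𝕜 (k + 1) f x) :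
    (fun u => f u - ∑ m ∈ Finset.range (k + 1), (m.factorial : 𝕜)⁻¹ •
      iteratedFDeriv 𝕜 m f x fun _ => u - x) =O[𝓝 x] fun u => ‖u - x‖ ^ (k + 1) := by
  let _ : NormedSpace ℝ E := NormedSpace.restrictScalars ℝ 𝕜 E
  let _ : NormedSpace ℝ F := NormedSpace.restrictScalars ℝ 𝕜 F
  refine (isBigO_sub_taylor_real (hf.restrict_scalars ℝ)).congr_left fun u => ?_
  congr 1
  refine Finset.sum_congr rfl fun m hm => ?_
  have hm' : ContDiffAt 𝕜 m f x := hf.of_le (by exact_mod_cast (Finset.mem_range.1 hm).le)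
  rw [← hm'.restrictScalars_iteratedFDeriv (𝕜 := ℝ), RCLike.real_smul_eq_coe_smul (K := 𝕜)]
  simp

end Taylor

/-! ### Sums over tuples and interpolation at the nodes `0, …, k` -/

section Tuples

variable {ι α : Type*} {r : ℕ}

/-- Writing a tuple `i` as an injective tuple of length `r` composed with a surjection onto `Fin r`
is the same as enumerating the range of `i` by `Fin r`. -/
noncomputable def factorizationEquiv (r : ℕ) (i : ι → α) :
    {p : (ι → Fin r) × (Fin r → α) // (Function.Surjective p.1 ∧ Function.Injective p.2) ∧
      p.2 ∘ p.1 = i} ≃ (Fin r ≃ Set.range i) where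
  toFun p := (Equiv.ofInjective p.1.2 p.2.1.2).trans (Equiv.setCongr
    ((p.2.1.1.range_comp p.1.2).symm.trans (congrArg Set.range p.2.2)))
  invFun e := ⟨(fun a => e.symm ⟨i a, Set.mem_range_self a⟩, fun b => e b), by
    refine ⟨⟨fun b => ?_, Subtype.val_injective.comp e.injective⟩, by ext a; simp⟩
    obtain ⟨a, ha⟩ := (e b).2
    exact ⟨a, (Equiv.symm_apply_eq e).2 (Subtype.ext ha)⟩⟩
  left_inv := by
    rintro ⟨⟨κ, j⟩, ⟨hκ, hj⟩, rfl⟩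
    refine Subtype.ext (Prod.ext (funext fun a => ?_) rfl)
    exact (Equiv.symm_apply_eq _).2 (Subtype.ext rfl)
  right_inv e := by
    ext b
    rfl

theorem card_factorization [Finite ι] (r : ℕ) (i : ι → α) :
    Nat.card {p : (ι → Fin r) × (Fin r → α) // (Function.Surjective p.1 ∧ Function.Injective p.2) ∧
      p.2 ∘ p.1 = i} = if r = Nat.card (Set.range i) then r.factorial else 0 := by
  rw [Nat.card_congr (factorizationEquiv r i)]
  split_ifs with h
  · have e : Fin r ≃ Set.range i := (Finite.equivFinOfCardEq h.symm).symm
    rw [Nat.card_congr (Equiv.equivCongr (Equiv.refl _) e.symm), Nat.card_perm, Nat.card_fin]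
  · have : IsEmpty (Fin r ≃ Set.range i) := ⟨fun e => h (by rw [← Nat.card_congr e, Nat.card_fin])⟩
    exact Nat.card_of_isEmpty

variable {𝕜 : Type*} [Field 𝕜] {m : ℕ} [Fintype α] [DecidableEq α]

theorem sum_surjective_injective (r : ℕ) (F : (Fin m → α) → 𝕜) :
    ∑ κ : Fin m → Fin r with Function.Surjective κ,
      ∑ j : Fin r → α with Function.Injective j, F (j ∘ κ) =
      ∑ i, (if r = Nat.card (Set.range i) then (r.factorial : 𝕜) else 0) * F i := by
  rw [← Finset.sum_product', ← Finset.sum_fiberwise _ fun p => p.2 ∘ p.1]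
  refine Finset.sum_congr rfl fun i _ => ?_
  rw [Finset.sum_congr rfl (g := fun _ => F i)
    (fun p hp => by rw [(Finset.mem_filter.1 hp).2]), Finset.sum_const, nsmul_eq_mul]
  have hcard := card_factorization r i
  rw [Nat.card_eq_fintype_card, Fintype.card_subtype] at hcard
  rw [← Finset.filter_product, Finset.filter_filter, Finset.univ_product_univ, hcard]
  push_cast
  rfl

theorem sum_tuple_eq_sum_surjective_injective [CharZero 𝕜] (F : (Fin m → α) → 𝕜) :
    ∑ i, F i = ∑ r ∈ Finset.range (m + 1), (r.factorial : 𝕜)⁻¹ *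
      ∑ κ : Fin m → Fin r with Function.Surjective κ,
        ∑ j : Fin r → α with Function.Injective j, F (j ∘ κ) := by
  simp_rw [sum_surjective_injective, Finset.mul_sum]
  rw [Finset.sum_comm]
  refine Finset.sum_congr rfl fun i _ => ?_
  have hrange : Nat.card (Set.range i) ∈ Finset.range (m + 1) := by
    rw [Finset.mem_range, Nat.lt_succ_iff]
    simpa using Finite.card_range_le i
  rw [Finset.sum_eq_single_of_mem _ hrange fun r _ hr => by rw [if_neg hr, zero_mul, mul_zero],
    if_pos rfl, inv_mul_cancel_left₀ (Nat.cast_ne_zero.2 (Nat.factorial_ne_zero _))]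

end Tuples

/-- The number of elements of the fibre of `c` over `b`. -/
def fiberCard {α β : Type*} [Fintype α] [DecidableEq β] (c : α → β) (b : β) : ℕ :=
  (Finset.univ.filter fun a => c a = b).card

theorem prod_comp_eq_prod_pow_fiberCard {α β R : Type*} [Fintype α] [Fintype β] [DecidableEq β]
    [CommMonoid R] (c : α → β) (y : β → R) : ∏ a, y (c a) = ∏ b, y b ^ fiberCard c b := by
  rw [← Finset.prod_fiberwise Finset.univ c]
  refine Finset.prod_congr rfl fun b _ => ?_
  rw [Finset.prod_congr rfl (g := fun _ => y b)
    (fun a ha => by rw [(Finset.mem_filter.1 ha).2]), Finset.prod_const, fiberCard]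

/-- Weights `γ` on the nodes `0, …, k` with `∑ γ(t) t ^ n = δ_{n,1}` for `n ≤ k`: they extract the
linear coefficient of a polynomial of degree at most `k`. -/
noncomputable def linearWeight (k : ℕ) : Fin (k + 1) → ℂ :=
  Matrix.vecMul (fun n : Fin (k + 1) => if (n : ℕ) = 1 then 1 else 0)
    (Matrix.vandermonde fun t : Fin (k + 1) => ((t : ℕ) : ℂ))⁻¹

theorem sum_linearWeight_mul_pow {k n : ℕ} (hn : n ≤ k) :
    ∑ t, linearWeight k t * ((t : ℕ) : ℂ) ^ n = if n = 1 then 1 else 0 := by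
  set V := Matrix.vandermonde fun t : Fin (k + 1) => ((t : ℕ) : ℂ)
  have hdet : IsUnit V.det := isUnit_iff_ne_zero.2
    (Matrix.det_vandermonde_ne_zero_iff.2 (Nat.cast_injective.comp Fin.val_injective))
  have h : Matrix.vecMul (linearWeight k) V =
      fun n : Fin (k + 1) => if (n : ℕ) = 1 then 1 else 0 := by
    rw [linearWeight, Matrix.vecMul_vecMul, Matrix.nonsing_inv_mul _ hdet, Matrix.vecMul_one]
  exact congrFun h ⟨n, Nat.lt_succ_of_le hn⟩

theorem sum_prod_linearWeight {r : ℕ} (hr : r ≠ 0) (k : ℕ) :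
    ∑ x : Fin r → Fin (k + 1), ∏ b, linearWeight k (x b) = 0 := by
  have hsum : ∑ t, linearWeight k t = 0 := by
    simpa using sum_linearWeight_mul_pow (Nat.zero_le k)
  rw [← Fintype.piFinset_univ, ← Finset.prod_univ_sum, hsum, Finset.prod_const, Finset.card_univ,
    Fintype.card_fin, zero_pow hr]

/-! ### Jets of symmetric functions -/

section Colouring

variable {α β R : Type*} [Fintype α]

theorem prod_partialInv_elim [Fintype β] [CommMonoid R] {j : β → α} (hj : Function.Injective j)
    (v : β → α → R) :
    ∏ a, (Function.partialInv j a).elim 1 (v · a) = ∏ b, v b (j b) := by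
  classical
  rw [← Finset.prod_subset (Finset.subset_univ (Finset.univ.image j)),
    Finset.prod_image fun a _ b _ h => hj h]
  · refine Finset.prod_congr rfl fun b _ => ?_
    rw [(hj.isPartialInv b (j b)).2 rfl, Option.elim_some]
  · intro a _ ha
    have hnone : Function.partialInv j a = none := Option.eq_none_iff_forall_not_mem.2 fun b hb =>
      ha (Finset.mem_image.2 ⟨b, Finset.mem_univ b, (hj.isPartialInv b a).1 hb⟩)
    rw [hnone, Option.elim_none]

variable [DecidableEq β]

theorem fiberCard_partialInv {j : β → α} (hj : Function.Injective j) (b : β) :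
    fiberCard (Function.partialInv j) (some b) = 1 := by
  rw [fiberCard, Finset.card_eq_one]
  refine ⟨j b, Finset.ext fun a => ?_⟩
  rw [Finset.mem_filter_univ, hj.isPartialInv b a, Finset.mem_singleton, eq_comm]

theorem exists_partialInv_eq {c : α → Option β} (hc : ∀ b, fiberCard c (some b) = 1) :
    ∃ j : β → α, Function.Injective j ∧ Function.partialInv j = c := by
  choose j hj using fun b => Finset.card_eq_one.1 (hc b)
  have hcj : ∀ a b, c a = some b ↔ j b = a := fun a b => by
    rw [← Finset.mem_filter_univ (p := fun a => c a = some b), hj, Finset.mem_singleton, eq_comm]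
  have hinj : Function.Injective j := fun b b' h =>
    Option.some.inj (((hcj _ b).2 rfl).symm.trans ((hcj _ b').2 h.symm))
  refine ⟨j, hinj, funext fun a => Option.ext fun b => ?_⟩
  rw [hinj.isPartialInv b a, hcj]

theorem isLittleO_prod_pow {k : ℕ} {s : β → ℕ} (hs : ∀ b, 1 ≤ s b) {c : α → Option β} {b : β}
    (hb : k < fiberCard c (some b)) :
    (fun y : α → ℂ => ∏ a, (c a).elim 1 fun b => y a ^ s b) =o[𝓝 0] fun y => ‖y‖ ^ k := by
  set d : α → ℕ := fun a => (c a).elim 0 s with hd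
  have hdeg : k < ∑ a, d a := by
    refine hb.trans_le ?_
    rw [fiberCard, Finset.card_eq_sum_ones, Finset.sum_filter]
    refine Finset.sum_le_sum fun a _ => ?_
    split_ifs with h
    · simp only [hd, h, Option.elim_some, hs b]
    · exact Nat.zero_le _
  have hO : (fun y : α → ℂ => ∏ a, (c a).elim 1 fun b => y a ^ s b) =O[𝓝 0]
      fun y => ‖y‖ ^ ∑ a, d a := by
    refine Asymptotics.IsBigO.of_bound 1 (Eventually.of_forall fun y => ?_)
    rw [one_mul, norm_pow, norm_norm, norm_prod, ← Finset.prod_pow_eq_pow_sum]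
    refine Finset.prod_le_prod (fun _ _ => norm_nonneg _) fun a _ => ?_
    cases h : c a with
    | none => simp only [hd, h, Option.elim_none, norm_one, pow_zero, le_refl]
    | some b =>
      simp only [hd, h, Option.elim_some, norm_pow]
      exact pow_le_pow_left₀ (norm_nonneg _) (norm_le_pi_norm y a) _
  exact hO.trans_isLittleO (Asymptotics.isLittleO_norm_pow_norm_pow (E' := α → ℂ) hdeg)

variable [Fintype β] [DecidableEq α] [CommRing R]

theorem sum_fiberCard_eq_one (v : β → α → R) :
    ∑ c : α → Option β with ∀ b, fiberCard c (some b) = 1, ∏ a, (c a).elim 1 (v · a) =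
      ∑ j : β → α with Function.Injective j, ∏ b, v b (j b) := by
  symm
  refine Finset.sum_bij (fun j _ => Function.partialInv j) ?_ ?_ ?_ ?_
  · intro j hj
    exact (Finset.mem_filter_univ _).2 (fiberCard_partialInv ((Finset.mem_filter_univ _).1 hj))
  · intro j hj j' hj' h
    funext b
    have hb := (((Finset.mem_filter_univ _).1 hj).isPartialInv b (j b)).2 rfl
    rw [h] at hb
    exact ((((Finset.mem_filter_univ _).1 hj').isPartialInv b (j b)).1 hb).symm
  · intro c hc
    obtain ⟨j, hj, rfl⟩ := exists_partialInv_eq ((Finset.mem_filter_univ _).1 hc)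
    exact ⟨j, (Finset.mem_filter_univ _).2 hj, rfl⟩
  · intro j hj
    exact (prod_partialInv_elim ((Finset.mem_filter_univ _).1 hj) v).symm

theorem prod_one_add_sum_eq_sum_colouring (x : β → R) (w : β → α → R) :
    ∏ a, (1 + ∑ b, x b * w b a) =
      ∑ c : α → Option β, (∏ b, x b ^ fiberCard c (some b)) * ∏ a, (c a).elim 1 (w · a) := by
  have hfactor : ∀ a, 1 + ∑ b, x b * w b a =
      ∑ o : Option β, o.elim 1 x * o.elim 1 (w · a) := fun a => by
    rw [Fintype.sum_option]
    simp only [Option.elim_none, Option.elim_some, mul_one]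
  simp_rw [hfactor]
  rw [Finset.prod_univ_sum, Fintype.piFinset_univ]
  refine Finset.sum_congr rfl fun c _ => ?_
  rw [Finset.prod_mul_distrib, prod_comp_eq_prod_pow_fiberCard c fun o => o.elim 1 x,
    Fintype.prod_option]
  simp only [Option.elim_none, Option.elim_some, one_pow, one_mul]

theorem sum_prod_one_add_eq_sum_colouring {τ : Type*} [Fintype τ] (γ p : τ → R)
    (w : β → α → R) :
    ∑ x : β → τ, (∏ b, γ (x b)) * ∏ a, (1 + ∑ b, p (x b) * w b a) =
      ∑ c : α → Option β, (∏ b, ∑ t, γ t * p t ^ fiberCard c (some b)) *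
        ∏ a, (c a).elim 1 (w · a) := by
  classical
  simp_rw [fun x : β → τ => prod_one_add_sum_eq_sum_colouring (fun b => p (x b)) w, Finset.mul_sum]
  rw [Finset.sum_comm]
  refine Finset.sum_congr rfl fun c _ => ?_
  rw [Finset.prod_univ_sum, Fintype.piFinset_univ, Finset.sum_mul]
  refine Finset.sum_congr rfl fun x _ => ?_
  rw [Finset.prod_mul_distrib, mul_assoc]

variable {k : ℕ} {s : β → ℕ}

theorem sum_injective_sub_sum_linearWeight (hk : 1 ≤ k) (y : α → ℂ) :
    (∑ j : β → α with Function.Injective j, ∏ b, y (j b) ^ s b) -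
      ∑ x : β → Fin (k + 1), (∏ b, linearWeight k (x b)) *
        ∏ a, (1 + ∑ b, ((x b : ℕ) : ℂ) * y a ^ s b) =
      ∑ c : α → Option β with ¬ ∀ b, fiberCard c (some b) = 1,
        -((∏ b, ∑ t, linearWeight k t * ((t : ℕ) : ℂ) ^ fiberCard c (some b)) *
          ∏ a, (c a).elim 1 fun b => y a ^ s b) := by
  have hinjective : ∑ c : α → Option β with ∀ b, fiberCard c (some b) = 1,
      (∏ b, ∑ t, linearWeight k t * ((t : ℕ) : ℂ) ^ fiberCard c (some b)) *
        ∏ a, (c a).elim 1 (fun b => y a ^ s b) =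
      ∑ j : β → α with Function.Injective j, ∏ b, y (j b) ^ s b := by
    refine Eq.trans (Finset.sum_congr rfl fun c hc => ?_)
      (sum_fiberCard_eq_one fun b a => y a ^ s b)
    rw [Finset.prod_eq_one fun b _ => by
      rw [(Finset.mem_filter_univ _).1 hc b, sum_linearWeight_mul_pow hk, if_pos rfl], one_mul]
  rw [sum_prod_one_add_eq_sum_colouring (linearWeight k) (fun t => ((t : ℕ) : ℂ))
    fun b a => y a ^ s b, ← Finset.sum_filter_add_sum_filter_not Finset.univ
    fun c : α → Option β => ∀ b, fiberCard c (some b) = 1, Finset.sum_neg_distrib, hinjective]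
  ring

theorem isLittleO_sum_injective_sub_sum_linearWeight (hk : 1 ≤ k) (hs : ∀ b, 1 ≤ s b) :
    (fun y : α → ℂ => (∑ j : β → α with Function.Injective j, ∏ b, y (j b) ^ s b) -
      ∑ x : β → Fin (k + 1), (∏ b, linearWeight k (x b)) *
        ∏ a, (1 + ∑ b, ((x b : ℕ) : ℂ) * y a ^ s b)) =o[𝓝 0] fun y => ‖y‖ ^ k := by
  simp_rw [sum_injective_sub_sum_linearWeight hk]
  refine Asymptotics.IsLittleO.fun_sum fun c hc => Asymptotics.isLittleO_neg_left.2 ?_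
  obtain ⟨b, hb⟩ := not_forall.1 (Finset.mem_filter.1 hc).2
  by_cases hbk : fiberCard c (some b) ≤ k
  · have hzero : ∏ b, ∑ t, linearWeight k t * ((t : ℕ) : ℂ) ^ fiberCard c (some b) = 0 :=
      Finset.prod_eq_zero (Finset.mem_univ b) (by rw [sum_linearWeight_mul_pow hbk, if_neg hb])
    simp only [hzero, zero_mul]
    exact Asymptotics.isLittleO_zero _ _
  · exact (isLittleO_prod_pow hs (not_le.1 hbk)).const_mul_left _

end Colouring

/-- The indices of the terms of order `1, …, k` in the Taylor expansion of a symmetric function: an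
order of derivation `m ≤ k`, and the pattern of equalities between the coordinates `i₁, …, iₘ` of a
partial derivative `∂_{i₁} ⋯ ∂_{iₘ}`, encoded as a surjection from `Fin m` onto the set `Fin r` of
distinct coordinates. -/
abbrev JetIndex (k : ℕ) : Type :=
  Σ m : Fin k, Σ r : Fin (m + 2), {κ : Fin (m + 1) → Fin r // Function.Surjective κ}

namespace JetIndex

variable {k N : ℕ} (s : JetIndex k)

/-- The order of derivation. -/
abbrev order : ℕ := s.1 + 1

/-- The number of distinct coordinates. -/
abbrev parts : ℕ := s.2.1

/-- The surjection recording which coordinates are equal. -/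
abbrev pattern : Fin s.order → Fin s.parts := s.2.2.1

/-- The partial derivative at `1^N` with the given pattern, in the first coordinates. -/
noncomputable def deriv (f : (Fin N → ℂ) → ℂ) : ℂ :=
  coordDeriv f fun a => (s.pattern a : ℕ)

/-- The weight of a tuple of nodes in the representation of the sum over all choices of distinct
coordinates as a combination of products of functions of one variable. -/
noncomputable def weight (x : Fin s.parts → Fin (k + 1)) : ℂ :=
  (s.order.factorial : ℂ)⁻¹ * (s.parts.factorial : ℂ)⁻¹ * ∏ b, linearWeight k (x b)

/-- The function of one variable attached to a tuple of nodes. -/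
noncomputable def factor (x : Fin s.parts → Fin (k + 1)) (z : ℂ) : ℂ :=
  1 + ∑ b, ((x b : ℕ) : ℂ) * (z - 1) ^ fiberCard s.pattern b

theorem sum_weight : ∑ x, s.weight x = 0 := by
  have hparts : s.parts ≠ 0 := (Nat.zero_le _).trans_lt (s.pattern 0).2 |>.ne'
  simp only [weight, ← Finset.mul_sum]
  rw [sum_prod_linearWeight hparts, mul_zero]

theorem one_le_fiberCard (b : Fin s.parts) : 1 ≤ fiberCard s.pattern b := by
  obtain ⟨a, ha⟩ := s.2.2.2 b
  exact Finset.card_pos.2 ⟨a, (Finset.mem_filter_univ _).2 ha⟩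

theorem factor_one (x : Fin s.parts → Fin (k + 1)) : s.factor x 1 = 1 := by
  rw [factor, Finset.sum_eq_zero, add_zero]
  intro b _
  rw [sub_self, zero_pow (Nat.one_le_iff_ne_zero.1 (s.one_le_fiberCard b)), mul_zero]

theorem analyticAt_factor (x : Fin s.parts → Fin (k + 1)) (z : ℂ) :
    AnalyticAt ℂ (s.factor x) z := by
  unfold factor
  fun_prop

end JetIndex

theorem iteratedFDeriv_diag_eq_sum {N m : ℕ} (f : (Fin N → ℂ) → ℂ) (y : Fin N → ℂ) :
    (iteratedFDeriv ℂ m f 1 fun _ => y) = ∑ i : Fin m → Fin N,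
      (∏ a, y (i a)) * iteratedFDeriv ℂ m f 1 fun a => Pi.single (i a) 1 := by
  conv_lhs => rw [pi_eq_sum_univ' y]
  rw [ContinuousMultilinearMap.map_sum]
  refine Finset.sum_congr rfl fun i _ => ?_
  rw [ContinuousMultilinearMap.map_smul_univ, smul_eq_mul]

namespace SymmNearOne

variable {N k : ℕ} {f : (Fin N → ℂ) → ℂ}

theorem iteratedFDeriv_diag (hf : SymmNearOne f) (m : ℕ) (y : Fin N → ℂ) :
    (iteratedFDeriv ℂ m f 1 fun _ => y) = ∑ r ∈ Finset.range (m + 1), (r.factorial : ℂ)⁻¹ *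
      ∑ κ : Fin m → Fin r with Function.Surjective κ, (coordDeriv f fun a => (κ a : ℕ)) *
        ∑ j : Fin r → Fin N with Function.Injective j, ∏ b, y (j b) ^ fiberCard κ b := by
  rw [iteratedFDeriv_diag_eq_sum, sum_tuple_eq_sum_surjective_injective]
  refine Finset.sum_congr rfl fun r _ => congrArg _ (Finset.sum_congr rfl fun κ _ => ?_)
  rw [Finset.mul_sum]
  refine Finset.sum_congr rfl fun j hj => ?_
  simp only [Function.comp_apply]
  rw [hf.iteratedFDeriv_single_comp κ ((Finset.mem_filter_univ _).1 hj),
    prod_comp_eq_prod_pow_fiberCard κ fun b => y (j b), mul_comm]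

theorem taylor_eq_sum_jetIndex (hf : SymmNearOne f) (k : ℕ) (y : Fin N → ℂ) :
    ∑ m ∈ Finset.range (k + 1), (m.factorial : ℂ)⁻¹ • (iteratedFDeriv ℂ m f 1 fun _ => y) =
      f 1 + ∑ s : JetIndex k, s.deriv f *
        ((s.order.factorial : ℂ)⁻¹ * (s.parts.factorial : ℂ)⁻¹ *
          ∑ j : Fin s.parts → Fin N with Function.Injective j,
            ∏ b, y (j b) ^ fiberCard s.pattern b) := by
  simp only [smul_eq_mul]
  rw [Finset.sum_range_succ', add_comm, Fintype.sum_sigma,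
    ← Fin.sum_univ_eq_sum_range fun m => ((m + 1).factorial : ℂ)⁻¹ *
      iteratedFDeriv ℂ (m + 1) f 1 fun _ => y]
  congr 1
  · simp
  refine Finset.sum_congr rfl fun m _ => ?_
  rw [hf.iteratedFDeriv_diag, Fintype.sum_sigma, Finset.mul_sum, Finset.sum_range]
  refine Finset.sum_congr rfl fun r _ => ?_
  rw [Finset.sum_subtype (p := fun κ : Fin (m + 1) → Fin r => Function.Surjective κ) _
    Finset.mem_filter_univ, Finset.mul_sum, Finset.mul_sum]
  refine Finset.sum_congr rfl fun κ _ => ?_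
  simp only [JetIndex.deriv]
  ring

theorem isLittleO_sub_jet (hf : SymmNearOne f) (hk : 1 ≤ k) (hdiff : ContDiffAt ℂ (k + 1) f 1) :
    (fun u => f u - (f 1 + ∑ s : JetIndex k, s.deriv f *
      ∑ x, s.weight x * ∏ n, s.factor x (u n))) =o[𝓝 1] fun u => ‖u - 1‖ ^ k := by
  have hlim : Tendsto (fun u : Fin N → ℂ => u - 1) (𝓝 1) (𝓝 0) := by
    simpa using (continuous_sub_right (1 : Fin N → ℂ)).tendsto 1
  have htaylor := (isBigO_sub_taylor hdiff).trans_isLittleO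
    ((Asymptotics.isLittleO_norm_pow_norm_pow (Nat.lt_succ_self k)).comp_tendsto hlim)
  have hjet := fun s : JetIndex k => Asymptotics.IsLittleO.const_mul_left
    ((isLittleO_sum_injective_sub_sum_linearWeight (α := Fin N) hk s.one_le_fiberCard).comp_tendsto
      hlim) (s.deriv f * ((s.order.factorial : ℂ)⁻¹ * (s.parts.factorial : ℂ)⁻¹))
  refine (htaylor.add (Asymptotics.IsLittleO.fun_sum fun s (_ : s ∈ Finset.univ) =>
    hjet s)).congr_left fun u => ?_
  have hweight : ∀ s : JetIndex k, ∑ x, s.weight x * ∏ n, s.factor x (u n) =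
      (s.order.factorial : ℂ)⁻¹ * (s.parts.factorial : ℂ)⁻¹ *
        ∑ x : Fin s.parts → Fin (k + 1), (∏ b, linearWeight k (x b)) *
          ∏ n, s.factor x (u n) := fun s => by
    simp only [JetIndex.weight, Finset.mul_sum, mul_assoc]
  simp_rw [hf.taylor_eq_sum_jetIndex k, hweight]
  simp only [Function.comp_apply, mul_sub, Finset.sum_sub_distrib, mul_assoc,
    JetIndex.factor, Pi.sub_apply, Pi.one_apply]
  ring

end SymmNearOne

/-! ### Locally uniform limits of holomorphic functions of several variables -/

section LocallyUniformLimit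

variable {E F ι : Type*} [NormedAddCommGroup E] [NormedSpace ℂ E] [LocallyCompactSpace E]
  [NormedAddCommGroup F] [NormedSpace ℂ F] {l : Filter ι} {U : Set E} {f : ι → E → F} {g : E → F}

theorem exists_uniformCauchySeqOn_fderiv (hU : IsOpen U) (hf : TendstoLocallyUniformlyOn f g l U)
    (hd : ∀ i, DifferentiableOn ℂ (f i) U) {x : E} (hx : x ∈ U) :
    ∃ t ∈ 𝓝 x, UniformCauchySeqOn (fun i => fderiv ℂ (f i)) l t := by
  obtain ⟨t, htc, hxt, htU⟩ := exists_compact_subset hU hx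
  have hunif := (tendstoLocallyUniformlyOn_iff_forall_isCompact hU).1 hf t htU htc
  obtain ⟨r, hr, hrt⟩ := Metric.mem_nhds_iff.1 (mem_interior_iff_mem_nhds.1 hxt)
  refine ⟨Metric.ball x (r / 2), Metric.ball_mem_nhds x (half_pos hr), fun V hV => ?_⟩
  obtain ⟨ε, hε, hεV⟩ := Metric.mem_uniformity_dist.1 hV
  filter_upwards [hunif.uniformCauchySeqOn {p | dist p.1 p.2 < ε * r / 8}
    (Metric.dist_mem_uniformity (by positivity))] with p hp y hy
  refine hεV ?_
  have hsub : Metric.ball y (r / 2) ⊆ t := (Metric.ball_subset_ball' (by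
    linarith [Metric.mem_ball.1 hy])).trans hrt
  have hyt : y ∈ t := hsub (Metric.mem_ball_self (half_pos hr))
  have hball : ∀ i, DifferentiableOn ℂ (f i) (Metric.ball y (r / 2)) := fun i =>
    (hd i).mono (hsub.trans htU)
  have hat : ∀ i, DifferentiableAt ℂ (f i) y := fun i =>
    (hball i).differentiableAt (Metric.ball_mem_nhds y (half_pos hr))
  have hmaps : Set.MapsTo (f p.1 - f p.2) (Metric.ball y (r / 2))
      (Metric.closedBall ((f p.1 - f p.2) y) (ε * r / 4)) := fun z hz => by
    have hz' := hp z (hsub hz)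
    have hy' := hp y hyt
    simp only [dist_eq_norm] at hz' hy'
    rw [mem_closedBall_iff_norm, Pi.sub_apply, Pi.sub_apply]
    exact (norm_sub_le _ _).trans (by linarith)
  have hcauchy := Complex.norm_fderiv_le_div_of_mapsTo_ball ((hball p.1).sub (hball p.2)) hmaps
    (half_pos hr)
  rw [fderiv_sub (hat _) (hat _)] at hcauchy
  rw [dist_eq_norm]
  refine hcauchy.trans_lt ?_
  rw [div_lt_iff₀ (half_pos hr)]
  linarith [mul_pos hε hr]

theorem tendstoLocallyUniformlyOn_fderiv [CompleteSpace F] [l.NeBot] (hU : IsOpen U)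
    (hf : TendstoLocallyUniformlyOn f g l U) (hd : ∀ i, DifferentiableOn ℂ (f i) U) :
    DifferentiableOn ℂ g U ∧
      TendstoLocallyUniformlyOn (fun i => fderiv ℂ (f i)) (fderiv ℂ g) l U := by
  have hlim : ∀ x ∈ U, ∃ L, Tendsto (fun i => fderiv ℂ (f i) x) l (𝓝 L) := fun x hx => by
    obtain ⟨t, ht, hcauchy⟩ := exists_uniformCauchySeqOn_fderiv hU hf hd hx
    exact cauchy_map_iff_exists_tendsto.1 (hcauchy.cauchy_map (mem_of_mem_nhds ht))
  choose! g' hg' using hlim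
  have hconv : TendstoLocallyUniformlyOn (fun i => fderiv ℂ (f i)) g' l U := by
    intro V hV x hx
    obtain ⟨t, ht, hcauchy⟩ := exists_uniformCauchySeqOn_fderiv hU hf hd hx
    exact ⟨t ∩ U, mem_nhdsWithin_of_mem_nhds (inter_mem ht (hU.mem_nhds hx)),
      (hcauchy.mono Set.inter_subset_left).tendstoUniformlyOn_of_tendsto
        (fun y hy => hg' y hy.2) V hV⟩
  have hder : ∀ x ∈ U, HasFDerivAt g (g' x) x := fun x hx =>
    hasFDerivAt_of_tendstoLocallyUniformlyOn hU hconv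
      (fun i y hy => ((hd i).differentiableAt (hU.mem_nhds hy)).hasFDerivAt)
      (fun y hy => hf.tendsto_at hy) hx
  exact ⟨fun x hx => (hder x hx).differentiableAt.differentiableWithinAt,
    hconv.congr_right fun x hx => (hder x hx).fderiv.symm⟩

end LocallyUniformLimit

theorem contDiffOn_of_tendstoLocallyUniformlyOn.{u, v} {E : Type u} {ι : Type v}
    [NormedAddCommGroup E] [NormedSpace ℂ E] [LocallyCompactSpace E] {l : Filter ι} [l.NeBot]
    {U : Set E} (hU : IsOpen U) (n : ℕ) :
    ∀ {F : Type u} [NormedAddCommGroup F] [NormedSpace ℂ F] [CompleteSpace F] {f : ι → E → F}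
      {g : E → F}, TendstoLocallyUniformlyOn f g l U → (∀ i, ContDiffOn ℂ n (f i) U) →
      ContDiffOn ℂ n g U ∧ ∀ x ∈ U,
        Tendsto (fun i => iteratedFDeriv ℂ n (f i) x) l (𝓝 (iteratedFDeriv ℂ n g x)) := by
  induction n with
  | zero =>
    intro F _ _ _ f g hf hd
    refine ⟨contDiffOn_zero.2 (hf.continuousOn (Eventually.of_forall fun i =>
      (hd i).continuousOn).frequently), fun x hx => ?_⟩
    simp only [iteratedFDeriv_zero_eq_comp, Function.comp_apply]
    exact ((continuousMultilinearCurryFin0 ℂ E F).symm.continuous.tendsto _).comp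
      (hf.tendsto_at hx)
  | succ n ih =>
    intro F _ _ _ f g hf hd
    push_cast at hd ⊢
    have hd' := fun i => (contDiffOn_succ_iff_fderiv_of_isOpen hU).1 (hd i)
    obtain ⟨hdiff, hlim⟩ := tendstoLocallyUniformlyOn_fderiv hU hf fun i => (hd' i).1
    obtain ⟨hdiff', hlim'⟩ := ih hlim fun i => (hd' i).2.2
    refine ⟨(contDiffOn_succ_iff_fderiv_of_isOpen hU).2 ⟨hdiff, by simp, hdiff'⟩,
      fun x hx => ?_⟩
    simp only [iteratedFDeriv_succ_eq_comp_right, Function.comp_apply]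
    exact ((continuousMultilinearCurryRightEquiv' ℂ n E F).symm.continuous.tendsto _).comp
      (hlim' x hx)

/-! ### The operator on symmetric functions -/

section Symmetric

variable {N : ℕ}

theorem holNearOne_of_contDiffAt {f : (Fin N → ℂ) → ℂ} (hf : ContDiffAt ℂ 1 f 1) : HolNearOne f :=
  (hf.eventually (by simp)).mono fun _ hu => hu.differentiableAt (by simp)

theorem contDiffAt_prod_apply {g : ℂ → ℂ} (hg : AnalyticAt ℂ g 1) (n : WithTop ℕ∞) :
    ContDiffAt ℂ n (fun u : Fin N → ℂ => ∏ j, g (u j)) 1 :=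
  contDiffAt_prod fun j _ => ContDiffAt.comp (1 : Fin N → ℂ) (g := g) (f := fun u => u j)
    hg.contDiffAt (contDiffAt_apply ℂ ℂ j 1)

/-- The value at `1^N` of `diffOp n q` on `f(u) ∏ⱼ g(uⱼ)`, up to the factor `g(1)^N`, for a
symmetric function `f`, expressed through the partial derivatives of `f` at `1^N`. -/
noncomputable def symmValue (n : ℕ) (q : ℂ) (f : (Fin N → ℂ) → ℂ) (g : ℂ → ℂ) : ℂ :=
  f 1 * productValue N n q g + ∑ s : JetIndex (n + 1), s.deriv f *
    ∑ x, s.weight x * productValue N n q fun z => s.factor x z * g z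

/-- The Taylor jet of order `n + 1` at `1^N` of a symmetric function `f`, times `∏ⱼ g(uⱼ)`, as a
linear combination of products `∏ⱼ h(uⱼ)`, on which `diffOp` has known values. -/
noncomputable def symmJet (n : ℕ) (f : (Fin N → ℂ) → ℂ) (g : ℂ → ℂ) (u : Fin N → ℂ) : ℂ :=
  f 1 * ∏ j, g (u j) + ∑ s : JetIndex (n + 1), s.deriv f *
    ∑ x, s.weight x * ∏ j, (s.factor x (u j) * g (u j))

theorem holNearOne_sum_jetIndex_prod {k : ℕ} (s : JetIndex k) {g : ℂ → ℂ}
    (hg : AnalyticAt ℂ g 1) :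
    HolNearOne fun u : Fin N → ℂ => ∑ x, s.weight x * ∏ j, (s.factor x (u j) * g (u j)) :=
  HolNearOne.sum Finset.univ s.weight fun x _ =>
    holNearOne_prod N ((s.analyticAt_factor x 1).fun_mul hg)

theorem hasDiffOpValue_sum_jetIndex_prod (n : ℕ) (q : ℂ) {k : ℕ} (s : JetIndex k) {g : ℂ → ℂ}
    (hg : AnalyticAt ℂ g 1) (h1 : g 1 ≠ 0) :
    HasDiffOpValue n q
      (fun u : Fin N → ℂ => ∑ x, s.weight x * ∏ j, (s.factor x (u j) * g (u j)))
      (g 1 ^ N * ∑ x, s.weight x * productValue N n q fun z => s.factor x z * g z) := by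
  have hfactor (x) : AnalyticAt ℂ (fun z => s.factor x z * g z) 1 :=
    (s.analyticAt_factor x 1).fun_mul hg
  have hfactor_one (x) : s.factor x 1 * g 1 = g 1 := by rw [s.factor_one, one_mul]
  have hprod (x) : HasDiffOpValue n q (fun u : Fin N → ℂ => ∏ j, (s.factor x (u j) * g (u j)))
      (g 1 ^ N * productValue N n q fun z => s.factor x z * g z) := by
    have hne : s.factor x 1 * g 1 ≠ 0 := by rwa [hfactor_one]
    have hval := hasDiffOpValue_prod N n q (hfactor x) hne
    rwa [hfactor_one] at hval
  simp only [Finset.mul_sum, mul_left_comm (g 1 ^ N)]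
  exact HasDiffOpValue.sum Finset.univ s.weight (fun x _ => holNearOne_prod N (hfactor x))
    fun x _ => hprod x

theorem holNearOne_symmJet (n : ℕ) (f : (Fin N → ℂ) → ℂ) {g : ℂ → ℂ} (hg : AnalyticAt ℂ g 1) :
    HolNearOne (symmJet n f g) := by
  have hsum := HolNearOne.sum Finset.univ (fun s : JetIndex (n + 1) => s.deriv f) fun s _ =>
    holNearOne_sum_jetIndex_prod (N := N) s hg
  exact ((holNearOne_prod N hg).and hsum).mono fun u hu => (hu.1.const_mul _).add hu.2

theorem hasDiffOpValue_symmJet (n : ℕ) (q : ℂ) (f : (Fin N → ℂ) → ℂ) {g : ℂ → ℂ}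
    (hg : AnalyticAt ℂ g 1) (h1 : g 1 ≠ 0) :
    HasDiffOpValue n q (symmJet n f g) (g 1 ^ N * symmValue n q f g) := by
  have hholSum := HolNearOne.sum Finset.univ (fun s : JetIndex (n + 1) => s.deriv f) fun s _ =>
    holNearOne_sum_jetIndex_prod (N := N) s hg
  have hsum := HasDiffOpValue.sum Finset.univ (fun s : JetIndex (n + 1) => s.deriv f)
    (fun s _ => holNearOne_sum_jetIndex_prod (N := N) s hg) fun s _ =>
      hasDiffOpValue_sum_jetIndex_prod n q s hg h1
  have hholProd := holNearOne_prod N hg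
  have hprod := (hasDiffOpValue_prod N n q hg h1).const_mul (f 1) hholProd
  have hvalue := hprod.add (hholProd.mono fun u hu => hu.const_mul _) hholSum hsum
  rw [symmValue, mul_add, Finset.mul_sum]
  simp only [mul_left_comm (g 1 ^ N)]
  exact hvalue

theorem hasDiffOpValue_symm {n : ℕ} (q : ℂ) {f : (Fin N → ℂ) → ℂ} {g : ℂ → ℂ}
    (hf : ContDiffAt ℂ (n + 2) f 1) (hsymm : SymmNearOne f) (hg : AnalyticAt ℂ g 1)
    (h1 : g 1 ≠ 0) :
    HasDiffOpValue n q (fun u => f u * ∏ j, g (u j)) (g 1 ^ N * symmValue n q f g) := by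
  have hdiff : ContDiffAt ℂ ((n + 1 : ℕ) + 1) f 1 := by exact_mod_cast hf
  have hbounded : (fun u : Fin N → ℂ => ∏ j, g (u j)) =O[𝓝 1] fun _ => (1 : ℝ) :=
    (contDiffAt_prod_apply hg 0).continuousAt.isBigO_one ℝ
  have hjet := (hsymm.isLittleO_sub_jet (Nat.le_add_left 1 n) hdiff).mul_isBigO hbounded
  simp only [mul_one] at hjet
  refine (hasDiffOpValue_symmJet n q f hg h1).congr_of_isLittleO
    (holNearOne_symmJet n f hg) (holNearOne_of_contDiffAt ?_) (Nat.le_succ n)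
    (hjet.congr_left fun u => ?_)
  · exact (hdiff.of_le le_add_self).mul (contDiffAt_prod_apply hg 1)
  · simp only [symmJet, sub_mul, add_mul, Finset.sum_mul, Finset.mul_sum,
      Finset.prod_mul_distrib, mul_assoc]

end Symmetric

/-! ### The Schur generating function near `1^N` -/

section SchurGen

variable {N : ℕ}

theorem vandermondePoly_ne_zero (N : ℕ) : vandermondePoly N ≠ 0 :=
  Finset.prod_ne_zero_iff.2 fun _ hp => (irreducible_X_sub_X (Finset.mem_filter.1 hp).2.ne).ne_zero

theorem eval_vandermondePoly (u : Fin N → ℂ) : MvPolynomial.eval u (vandermondePoly N) =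
    vandermondeSign N * (Matrix.vandermonde u).det := by
  simp only [vandermondePoly, map_prod, map_sub, MvPolynomial.eval_X,
    prod_sub_eq_vandermondeSign_mul_det]

theorem eval_alternant (e : Fin N → ℕ) (u : Fin N → ℂ) :
    MvPolynomial.eval u (alternant e) = (Matrix.of fun i j => u i ^ e j).det := by
  rw [alternant, RingHom.map_det]
  congr 1
  ext i j
  simp

theorem rename_alternantQuotient (e : Fin N → ℕ) (σ : Equiv.Perm (Fin N)) :
    MvPolynomial.rename σ (alternantQuotient e) = alternantQuotient e := by
  refine mul_left_cancel₀ (vandermondePoly_ne_zero N) (MvPolynomial.funext fun v => ?_)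
  have hv := congrArg (MvPolynomial.eval v) (vandermondePoly_mul_alternantQuotient e)
  have hvσ := congrArg (MvPolynomial.eval (v ∘ σ)) (vandermondePoly_mul_alternantQuotient e)
  have hnum : (Matrix.of fun i j => (v ∘ σ) i ^ e j).det =
      (Equiv.Perm.sign σ : ℤ) * (Matrix.of fun i j => v i ^ e j).det :=
    Matrix.det_permute σ (Matrix.of fun i j => v i ^ e j)
  have hden : (Matrix.vandermonde (v ∘ σ)).det =
      (Equiv.Perm.sign σ : ℤ) * (Matrix.vandermonde v).det :=
    Matrix.det_permute σ (Matrix.vandermonde v)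
  have hsign : ((Equiv.Perm.sign σ : ℤ) : ℂ) ≠ 0 := by exact_mod_cast (Equiv.Perm.sign σ).ne_zero
  rw [map_mul, eval_vandermondePoly, eval_alternant] at hv hvσ
  rw [hden, hnum, ← hv, mul_left_comm (vandermondeSign N), mul_assoc] at hvσ
  rw [map_mul, map_mul, eval_vandermondePoly, MvPolynomial.eval_rename]
  exact mul_left_cancel₀ hsign hvσ

theorem schurChar_perm (lam : Signature N) (σ : Equiv.Perm (Fin N)) (u : Fin N → ℂ) :
    schurChar lam (u ∘ σ) = schurChar lam u := by
  rw [schurChar, schurChar, ← MvPolynomial.eval_rename, rename_alternantQuotient]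
  congr 2
  exact Equiv.prod_comp σ u

theorem isOpen_forall_ne_zero (N : ℕ) : IsOpen {u : Fin N → ℂ | ∀ i, u i ≠ 0} := by
  simp only [Set.ofPred_forall]
  exact isOpen_iInter_of_finite fun i => isOpen_ne_fun (continuous_apply i) continuous_const

variable (ρ : PMF (Signature N)) (lam : Signature N)

theorem contDiffOn_schurTerm (n : WithTop ℕ∞) :
    ContDiffOn ℂ n (schurTerm ρ lam) {u | ∀ i, u i ≠ 0} := fun _ hu =>
  (analyticAt_const.fun_mul (AnalyticAt.fun_div (analyticAt_schurChar lam hu) analyticAt_const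
    (schurChar_one_ne_zero lam))).contDiffAt.contDiffWithinAt

theorem contDiffAt_schurTerm (n : WithTop ℕ∞) : ContDiffAt ℂ n (schurTerm ρ lam) 1 :=
  (contDiffOn_schurTerm ρ lam n).contDiffAt
    ((isOpen_forall_ne_zero N).mem_nhds fun _ => one_ne_zero)

theorem schurTerm_one : schurTerm ρ lam 1 = ((ρ lam).toReal : ℂ) := by
  rw [schurTerm, div_self (schurChar_one_ne_zero lam), mul_one]

theorem schurGen_one : schurGen ρ 1 = 1 := by
  simp only [schurGen, schurTerm_one]
  rw [← Complex.ofReal_tsum, ← ENNReal.tsum_toReal_eq ρ.apply_ne_top, ρ.tsum_coe,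
    ENNReal.toReal_one, Complex.ofReal_one]

theorem schurGen_perm (σ : Equiv.Perm (Fin N)) (u : Fin N → ℂ) :
    schurGen ρ (u ∘ σ) = schurGen ρ u := by
  simp only [schurGen, schurTerm, schurChar_perm]

variable {ρ}

namespace SchurGenConverges

theorem exists_open (hρ : SchurGenConverges ρ) :
    ∃ U : Set (Fin N → ℂ), IsOpen U ∧ 1 ∈ U ∧ U ⊆ {u | ∀ i, u i ≠ 0} ∧
      TendstoLocallyUniformlyOn (fun (s : Finset (Signature N)) u => ∑ lam ∈ s, schurTerm ρ lam u)
        (schurGen ρ) atTop U := by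
  obtain ⟨U, hU, hs⟩ := hρ
  obtain ⟨V, hVU, hV, h1⟩ := mem_nhds_iff.1 hU
  refine ⟨V ∩ {u | ∀ i, u i ≠ 0}, hV.inter (isOpen_forall_ne_zero N), ⟨h1, fun _ => one_ne_zero⟩,
    Set.inter_subset_right, ?_⟩
  exact (hasSumUniformlyOn_iff_tendstoUniformlyOn.1
    hs.hasSumUniformlyOn).tendstoLocallyUniformlyOn.mono (Set.inter_subset_left.trans hVU)

theorem contDiffAt (hρ : SchurGenConverges ρ) (n : ℕ) : ContDiffAt ℂ n (schurGen ρ) 1 := by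
  obtain ⟨U, hU, h1, hU0, hlim⟩ := hρ.exists_open
  exact (contDiffOn_of_tendstoLocallyUniformlyOn hU n hlim fun s => ContDiffOn.sum fun lam _ =>
    (contDiffOn_schurTerm ρ lam n).mono hU0).1.contDiffAt (hU.mem_nhds h1)

theorem hasSum_iteratedFDeriv (hρ : SchurGenConverges ρ) (n : ℕ) (v : Fin n → Fin N → ℂ) :
    HasSum (fun lam => iteratedFDeriv ℂ n (schurTerm ρ lam) 1 v)
      (iteratedFDeriv ℂ n (schurGen ρ) 1 v) := by
  obtain ⟨U, hU, h1, hU0, hlim⟩ := hρ.exists_open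
  have hderiv := (contDiffOn_of_tendstoLocallyUniformlyOn hU n hlim fun s =>
    ContDiffOn.sum fun lam _ => (contDiffOn_schurTerm ρ lam n).mono hU0).2 1 h1
  refine (((ContinuousMultilinearMap.apply ℂ (fun _ : Fin n => Fin N → ℂ) ℂ
    v).continuous.tendsto _).comp hderiv).congr fun s => ?_
  rw [Function.comp_apply, ContinuousMultilinearMap.apply_apply, iteratedFDeriv_fun_sum_apply
    fun lam _ => contDiffAt_schurTerm ρ lam n, sum_apply]

theorem hasSum_schurTerm_one (hρ : SchurGenConverges ρ) :
    HasSum (fun lam => schurTerm ρ lam 1) (schurGen ρ 1) := by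
  simpa using hρ.hasSum_iteratedFDeriv 0 Fin.elim0

end SchurGenConverges

variable (ρ) in
theorem symmValue_schurTerm (n : ℕ) (q : ℝ) :
    symmValue n q (schurTerm ρ lam) (fun _ => 1) = ((ρ lam).toReal : ℂ) * ∑ i,
      (descPochhammer ℂ n).eval (lam.shifted i : ℂ) * (ppWeight q lam i : ℂ) := by
  have hhol : HolNearOne fun u => schurChar lam u / schurChar lam 1 := by
    simp only [div_eq_mul_inv]
    exact (holNearOne_schurChar lam).mono fun u hu => hu.mul_const _
  have hsymm : SymmNearOne (schurTerm ρ lam) := fun σ => .of_forall fun u => by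
    simp only [schurTerm, schurChar_perm]
  have hval := hasDiffOpValue_symm (n := n) (q : ℂ) (contDiffAt_schurTerm ρ lam _) hsymm
    analyticAt_const one_ne_zero
  simp only [one_pow, one_mul, Finset.prod_const_one, mul_one] at hval
  exact hval.unique ((hasDiffOpValue_schurChar lam n q).const_mul _ hhol)

theorem SchurGenConverges.hasSum_symmValue (hρ : SchurGenConverges ρ) (n : ℕ) (q : ℝ) :
    HasSum (fun lam => ((ρ lam).toReal : ℂ) * ∑ i,
      (descPochhammer ℂ n).eval (lam.shifted i : ℂ) * (ppWeight q lam i : ℂ))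
      (symmValue n q (schurGen ρ) fun _ => 1) := by
  simp only [← symmValue_schurTerm]
  exact (hρ.hasSum_schurTerm_one.mul_right _).add
    (hasSum_sum fun s _ => (hρ.hasSum_iteratedFDeriv _ _).mul_right _)

end SchurGen

/-! ### Derivatives of compositions -/

section Composition

variable {𝕜 E F G : Type*} [NontriviallyNormedField 𝕜] [NormedAddCommGroup E] [NormedSpace 𝕜 E]
  [NormedAddCommGroup F] [NormedSpace 𝕜 F] [NormedAddCommGroup G] [NormedSpace 𝕜 G] {n : ℕ}

theorem iteratedFDeriv_comp_const_add_clm {f : F → G} (L : E →L[𝕜] F) (c : F) (x : E)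
    (hf : ContDiffAt 𝕜 n f (c + L x)) :
    iteratedFDeriv 𝕜 n (fun y => f (c + L y)) x =
      (iteratedFDeriv 𝕜 n f (c + L x)).compContinuousLinearMap fun _ => L := by
  have hshift : ContDiffAt 𝕜 n (fun w => f (c + w)) (L x) :=
    hf.comp (L x) (contDiffAt_const.add contDiffAt_id)
  obtain ⟨s, hs, hopen, hx⟩ := eventually_nhds_iff.1 (hshift.eventually (by simp))
  have hcomp := L.iteratedFDerivWithin_comp_right (fun y hy => (hs y hy).contDiffWithinAt)
    hopen.uniqueDiffOn (hopen.preimage L.continuous).uniqueDiffOn hx le_rfl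
  rwa [iteratedFDerivWithin_of_isOpen n hopen hx,
    iteratedFDerivWithin_of_isOpen n (hopen.preimage L.continuous) hx,
    iteratedFDeriv_comp_add_left] at hcomp

theorem norm_iteratedFDeriv_comp_le_of_contDiffAt {g : F → G} {f : E → F} {x : E} {C D : ℝ}
    (hg : ContDiff 𝕜 n g) (hf : ContDiffAt 𝕜 n f x)
    (hC : ∀ i ≤ n, ‖iteratedFDeriv 𝕜 i g (f x)‖ ≤ C)
    (hD : ∀ i, 1 ≤ i → i ≤ n → ‖iteratedFDeriv 𝕜 i f x‖ ≤ D ^ i) :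
    ‖iteratedFDeriv 𝕜 n (g ∘ f) x‖ ≤ n.factorial * C * D ^ n := by
  obtain ⟨s, hs, hopen, hx⟩ := eventually_nhds_iff.1 (hf.eventually (by simp))
  rw [← iteratedFDerivWithin_of_isOpen n hopen hx]
  refine norm_iteratedFDerivWithin_comp_le hg.contDiffOn
    (fun y hy => (hs y hy).contDiffWithinAt) le_rfl uniqueDiffOn_univ hopen.uniqueDiffOn
    (Set.mapsTo_univ f s) hx (fun i hi => ?_) fun i hi hin => ?_
  · rw [iteratedFDerivWithin_univ]
    exact hC i hi
  · rw [iteratedFDerivWithin_of_isOpen i hopen hx]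
    exact hD i hi hin

theorem tendsto_norm_iteratedFDeriv_comp {ι : Type*} {l : Filter ι} {g : F → G} {f : ι → E → F}
    {x : E} {c : F} (hg : ContDiff 𝕜 n g) (hf : ∀ a, ContDiffAt 𝕜 n (f a) x)
    (hc : ∀ a, f a x = c) (hn : 1 ≤ n)
    (hlim : ∀ k, 1 ≤ k → Tendsto (fun a => ‖iteratedFDeriv 𝕜 k (f a) x‖) l (𝓝 0)) :
    Tendsto (fun a => ‖iteratedFDeriv 𝕜 n (g ∘ f a) x‖) l (𝓝 0) := by
  let C : ℝ := ∑ i ∈ Finset.range (n + 1), ‖iteratedFDeriv 𝕜 i g c‖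
  let D (a : ι) : ℝ := ∑ i ∈ Finset.Icc 1 n, ‖iteratedFDeriv 𝕜 i (f a) x‖ ^ (i : ℝ)⁻¹
  have hC (a : ι) (i : ℕ) (hi : i ≤ n) : ‖iteratedFDeriv 𝕜 i g (f a x)‖ ≤ C := by
    rw [hc]
    exact Finset.single_le_sum (f := fun i => ‖iteratedFDeriv 𝕜 i g c‖)
      (fun _ _ => norm_nonneg _) (Finset.mem_range.2 (Nat.lt_succ_of_le hi))
  have hD (a : ι) (i : ℕ) (hi : 1 ≤ i) (hin : i ≤ n) :
      ‖iteratedFDeriv 𝕜 i (f a) x‖ ≤ D a ^ i := by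
    rw [← Real.rpow_inv_natCast_pow (norm_nonneg (iteratedFDeriv 𝕜 i (f a) x))
      (Nat.one_le_iff_ne_zero.1 hi)]
    refine pow_le_pow_left₀ (Real.rpow_nonneg (norm_nonneg _) _) ?_ i
    exact Finset.single_le_sum (f := fun i : ℕ => ‖iteratedFDeriv 𝕜 i (f a) x‖ ^ (i : ℝ)⁻¹)
      (fun _ _ => Real.rpow_nonneg (norm_nonneg _) _) (Finset.mem_Icc.2 ⟨hi, hin⟩)
  have hDlim : Tendsto D l (𝓝 0) := by
    rw [← Finset.sum_const_zero (s := Finset.Icc 1 n)]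
    refine tendsto_finsetSum _ fun i hi => ?_
    have hi0 : (i : ℝ)⁻¹ ≠ 0 :=
      inv_ne_zero (Nat.cast_ne_zero.2 (Nat.one_le_iff_ne_zero.1 (Finset.mem_Icc.1 hi).1))
    rw [← Real.zero_rpow hi0]
    exact (hlim i (Finset.mem_Icc.1 hi).1).rpow_const (.inr (by positivity))
  refine squeeze_zero (fun _ => norm_nonneg _)
    (fun a => norm_iteratedFDeriv_comp_le_of_contDiffAt hg (hf a) (hC a) (hD a)) ?_
  simpa [Nat.one_le_iff_ne_zero.1 hn] using (hDlim.pow n).const_mul (n.factorial * C)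

theorem norm_multilinear_le_sum_single {m : ℕ} (A : (Fin m → 𝕜) [×n]→L[𝕜] G) :
    ‖A‖ ≤ ∑ i : Fin n → Fin m, ‖A fun a => Pi.single (i a) 1‖ := by
  refine A.opNorm_le_bound (Finset.sum_nonneg fun _ _ => norm_nonneg _) fun v => ?_
  have hv : v = fun a => ∑ j, v a j • (Pi.single j 1 : Fin m → 𝕜) :=
    funext fun a => pi_eq_sum_univ' (v a)
  conv_lhs => rw [hv]
  rw [ContinuousMultilinearMap.map_sum, Finset.sum_mul]
  refine (norm_sum_le _ _).trans (Finset.sum_le_sum fun i _ => ?_)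
  rw [ContinuousMultilinearMap.map_smul_univ, norm_smul, norm_prod, mul_comm]
  gcongr with a
  exact norm_le_pi_norm (v a) (i a)

end Composition

/-! ### Sequences of functions of a growing number of variables -/

section Composition

/-- The inclusion of `ℂ^K` into `ℂ^N` along the first `K` coordinate directions. -/
noncomputable def coordIncl (N K : ℕ) : (Fin K → ℂ) →L[ℂ] (Fin N → ℂ) :=
  ∑ b : Fin K, (ContinuousLinearMap.proj (R := ℂ) (φ := fun _ : Fin K => ℂ) b).smulRight
    (coordDir N b)

theorem coordIncl_single (N : ℕ) {K : ℕ} (b : Fin K) :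
    coordIncl N K (Pi.single b 1) = coordDir N b := by
  simp [coordIncl, Pi.single_apply]

theorem one_add_coordIncl_zero (N K : ℕ) : 1 + coordIncl N K 0 = 1 := by
  rw [map_zero, add_zero]

theorem iteratedFDeriv_comp_coordIncl {N K m : ℕ} {f : (Fin N → ℂ) → ℂ}
    (hf : ContDiffAt ℂ m f 1) (i : Fin m → Fin K) :
    (iteratedFDeriv ℂ m (fun y => f (1 + coordIncl N K y)) 0 fun a => Pi.single (i a) 1) =
      coordDeriv f fun a => (i a : ℕ) := by
  rw [iteratedFDeriv_comp_const_add_clm (coordIncl N K) 1 0 (by rwa [one_add_coordIncl_zero]),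
    one_add_coordIncl_zero, ContinuousMultilinearMap.compContinuousLinearMap_apply]
  simp only [coordIncl_single, coordDeriv]

theorem contDiffAt_comp_coordIncl {N K m : ℕ} {f : (Fin N → ℂ) → ℂ} (hf : ContDiffAt ℂ m f 1) :
    ContDiffAt ℂ m (fun y => f (1 + coordIncl N K y)) 0 := by
  rw [← one_add_coordIncl_zero N K] at hf
  exact hf.comp (0 : Fin K → ℂ) (contDiffAt_const.add (coordIncl N K).contDiff.contDiffAt)

variable {f : ∀ N, (Fin N → ℂ) → ℂ}

theorem tendsto_norm_iteratedFDeriv_comp_coordIncl {m : ℕ} (hf : ∀ N, ContDiffAt ℂ m (f N) 1)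
    (hlim : ∀ i : Fin m → ℕ, Tendsto (fun N => coordDeriv (f N) i) atTop (𝓝 0)) (K : ℕ) :
    Tendsto (fun N => ‖iteratedFDeriv ℂ m (fun y => f N (1 + coordIncl N K y)) 0‖)
      atTop (𝓝 0) := by
  refine squeeze_zero (fun _ => norm_nonneg _) (fun N => norm_multilinear_le_sum_single _) ?_
  simp only [iteratedFDeriv_comp_coordIncl (hf _)]
  simpa using tendsto_finsetSum Finset.univ fun (i : Fin m → Fin K) _ =>
    (hlim fun a => i a).norm

theorem tendsto_coordDeriv_comp {g : ℂ → ℂ} {c : ℂ} (hg : ∀ m : ℕ, ContDiff ℂ m g)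
    (hf : ∀ N (m : ℕ), ContDiffAt ℂ m (f N) 1) (hc : ∀ N, f N 1 = c)
    (hlim : ∀ m : ℕ, 1 ≤ m → ∀ i : Fin m → ℕ,
      Tendsto (fun N => coordDeriv (f N) i) atTop (𝓝 0)) {m : ℕ} (hm : 1 ≤ m) (i : Fin m → ℕ) :
    Tendsto (fun N => coordDeriv (g ∘ f N) i) atTop (𝓝 0) := by
  obtain ⟨K, hK⟩ : ∃ K, ∀ a, i a < K := ⟨∑ a, i a + 1, fun a => Nat.lt_succ_of_le
    (Finset.single_le_sum (fun _ _ => Nat.zero_le _) (Finset.mem_univ a))⟩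
  have hnorm := tendsto_norm_iteratedFDeriv_comp (x := (0 : Fin K → ℂ)) (hg m)
    (fun N => contDiffAt_comp_coordIncl (hf N m))
    (fun N => by rw [one_add_coordIncl_zero, hc]) hm
    fun k hk => tendsto_norm_iteratedFDeriv_comp_coordIncl (fun N => hf N k) (hlim k hk) K
  refine squeeze_zero_norm (fun N => ?_) hnorm
  have hderiv := iteratedFDeriv_comp_coordIncl ((hg m).contDiffAt.comp 1 (hf N m))
    fun a => ⟨i a, hK a⟩
  rw [← hderiv]
  refine (ContinuousMultilinearMap.le_opNorm _ _).trans
    (mul_le_of_le_one_right (norm_nonneg _) ?_)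
  exact Finset.prod_le_one (fun _ _ => norm_nonneg _) fun a _ => by
    rw [Pi.norm_single, norm_one]

end Composition

section AxisRemainder

variable {N : ℕ} {f : (Fin N → ℂ) → ℂ}

/-- The restriction of `f` to the line through `1^N` in the direction of the first coordinate. -/
def axisRestrict (f : (Fin N → ℂ) → ℂ) (z : ℂ) : ℂ :=
  f (1 + (z - 1) • coordDir N 0)

/-- The difference between `f` and its additive approximation built from `axisRestrict f`, each of
whose summands depends on one coordinate. -/
def axisRemainder (f : (Fin N → ℂ) → ℂ) (u : Fin N → ℂ) : ℂ :=
  f u - ∑ j, axisRestrict f (u j)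

theorem axisRestrict_one (f : (Fin N → ℂ) → ℂ) : axisRestrict f 1 = f 1 := by
  rw [axisRestrict, sub_self, zero_smul, add_zero]

theorem axisRestrict_eq (f : (Fin N → ℂ) → ℂ) : axisRestrict f = fun z =>
    f ((1 - coordDir N 0) + ContinuousLinearMap.toSpanSingleton ℂ (coordDir N 0) z) := by
  ext z
  rw [axisRestrict, ContinuousLinearMap.toSpanSingleton_apply, sub_smul, one_smul]
  congr 1
  abel

theorem one_sub_coordDir_add (N : ℕ) : (1 - coordDir N 0) +
    ContinuousLinearMap.toSpanSingleton ℂ (coordDir N 0) 1 = 1 := by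
  rw [ContinuousLinearMap.toSpanSingleton_apply, one_smul, sub_add_cancel]

theorem contDiffAt_axisRestrict {m : ℕ} (hf : ContDiffAt ℂ m f 1) :
    ContDiffAt ℂ m (axisRestrict f) 1 := by
  rw [← one_sub_coordDir_add N] at hf
  rw [axisRestrict_eq]
  exact hf.comp (1 : ℂ) (contDiffAt_const.add (ContinuousLinearMap.contDiff _).contDiffAt)

theorem analyticAt_axisRestrict (hf : HolNearOne f) : AnalyticAt ℂ (axisRestrict f) 1 := by
  have hline : Continuous fun z : ℂ => 1 + (z - 1) • coordDir N 0 := by fun_prop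
  have hlim : Tendsto (fun z : ℂ => 1 + (z - 1) • coordDir N 0) (𝓝 1) (𝓝 1) := by
    simpa using hline.tendsto 1
  refine Complex.analyticAt_iff_eventually_differentiableAt.2 ?_
  filter_upwards [hlim.eventually hf] with z hz using hz.comp z (by fun_prop)

theorem iteratedDeriv_axisRestrict {m : ℕ} (hf : ContDiffAt ℂ m f 1) :
    iteratedDeriv m (axisRestrict f) 1 = coordDeriv f fun _ : Fin m => 0 := by
  have hcomp := iteratedFDeriv_comp_const_add_clm
    (ContinuousLinearMap.toSpanSingleton ℂ (coordDir N 0)) (1 - coordDir N 0) 1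
    (by rwa [one_sub_coordDir_add])
  rw [one_sub_coordDir_add, ← axisRestrict_eq] at hcomp
  rw [iteratedDeriv_eq_iteratedFDeriv, hcomp,
    ContinuousMultilinearMap.compContinuousLinearMap_apply]
  simp only [ContinuousLinearMap.toSpanSingleton_apply, one_smul, coordDeriv]

theorem contDiffAt_axisRestrict_apply {m : ℕ} (hf : ContDiffAt ℂ m f 1) (j : Fin N) :
    ContDiffAt ℂ m (fun u : Fin N → ℂ => axisRestrict f (u j)) 1 :=
  ContDiffAt.comp (1 : Fin N → ℂ) (f := fun u => u j) (contDiffAt_axisRestrict hf)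
    (contDiffAt_apply ℂ ℂ j 1)

theorem contDiffAt_axisRemainder {m : ℕ} (hf : ContDiffAt ℂ m f 1) :
    ContDiffAt ℂ m (axisRemainder f) 1 :=
  hf.sub (ContDiffAt.sum fun j _ => contDiffAt_axisRestrict_apply hf j)

theorem axisRemainder_one (hf : f 1 = 0) : axisRemainder f 1 = 0 := by
  simp [axisRemainder, axisRestrict_one, hf]

theorem coordDeriv_axisRestrict_apply {m : ℕ} (hf : ContDiffAt ℂ m f 1) (i : Fin m → ℕ)
    (j : Fin N) : coordDeriv (fun u => axisRestrict f (u j)) i =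
      (∏ a, coordDir N (i a) j) * coordDeriv f fun _ : Fin m => 0 := by
  have hcomp := iteratedFDeriv_comp_const_add_clm (f := axisRestrict f)
    (ContinuousLinearMap.proj (R := ℂ) (φ := fun _ : Fin N => ℂ) j) 0 1
    (by simpa using contDiffAt_axisRestrict hf)
  simp only [ContinuousLinearMap.proj_apply, zero_add, Pi.one_apply] at hcomp
  rw [coordDeriv, hcomp, ContinuousMultilinearMap.compContinuousLinearMap_apply,
    iteratedFDeriv_apply_eq_iteratedDeriv_mul_prod, iteratedDeriv_axisRestrict hf, smul_eq_mul]
  rfl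

theorem coordDeriv_axisRemainder {m : ℕ} (hf : ContDiffAt ℂ m f 1) (i : Fin m → ℕ) :
    coordDeriv (axisRemainder f) i =
      coordDeriv f i - (∑ j : Fin N, ∏ a, coordDir N (i a) j) *
        coordDeriv f fun _ : Fin m => 0 := by
  have hsum (j : Fin N) (_ : j ∈ Finset.univ) := contDiffAt_axisRestrict_apply hf j
  have hderiv : iteratedFDeriv ℂ m (axisRemainder f) 1 = iteratedFDeriv ℂ m f 1 -
      ∑ j, iteratedFDeriv ℂ m (fun u : Fin N → ℂ => axisRestrict f (u j)) 1 := by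
    rw [← iteratedFDeriv_fun_sum_apply hsum]
    exact iteratedFDeriv_sub_apply hf (ContDiffAt.sum hsum)
  rw [coordDeriv, hderiv, sub_apply, sum_apply, Finset.sum_mul]
  simp only [← coordDeriv_axisRestrict_apply hf]
  rfl

theorem sum_prod_coordDir_of_ne (N : ℕ) {m : ℕ} {i : Fin m → ℕ} {a a' : Fin m}
    (ha : i a ≠ i a') : ∑ j : Fin N, ∏ b, coordDir N (i b) j = 0 := by
  refine Finset.sum_eq_zero fun j _ => Finset.prod_eq_zero_iff.2 ?_
  by_cases hj : (j : ℕ) = i a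
  · exact ⟨a', Finset.mem_univ a', if_neg fun h => ha (hj.symm.trans h)⟩
  · exact ⟨a, Finset.mem_univ a, if_neg hj⟩

theorem sum_prod_coordDir_const {N c m : ℕ} (hc : c < N) (hm : m ≠ 0) :
    ∑ j : Fin N, ∏ _a : Fin m, coordDir N c j = 1 := by
  simp only [coordDir_val ⟨c, hc⟩, Finset.prod_const, Finset.card_univ, Fintype.card_fin]
  simp [Pi.single_apply, ite_pow, hm]

theorem tendsto_coordDeriv_axisRemainder {f : ∀ N, (Fin N → ℂ) → ℂ} {a b : ℕ → ℂ}
    (hf : ∀ N (m : ℕ), ContDiffAt ℂ m (f N) 1)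
    (hpure : ∀ i k : ℕ, 1 ≤ k →
      Tendsto (fun N : ℕ => coordDeriv (f N) (fun _ : Fin k => i) - N * a k) atTop (𝓝 (b k)))
    (hmixed : ∀ (m : ℕ) (i : Fin m → ℕ), 2 ≤ (Set.range i).ncard →
      Tendsto (fun N : ℕ => coordDeriv (f N) i) atTop (𝓝 0))
    {m : ℕ} (hm : 1 ≤ m) (i : Fin m → ℕ) :
    Tendsto (fun N => coordDeriv (axisRemainder (f N)) i) atTop (𝓝 0) := by
  simp only [coordDeriv_axisRemainder (hf _ m)]
  by_cases hconst : ∀ s t, i s = i t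
  · obtain ⟨c, rfl⟩ : ∃ c, i = fun _ => c := ⟨i ⟨0, hm⟩, funext fun s => hconst s _⟩
    have hlim := (hpure c m hm).sub (hpure 0 m hm)
    rw [sub_self] at hlim
    refine hlim.congr' ?_
    filter_upwards [eventually_gt_atTop c] with N hN
    rw [sum_prod_coordDir_const hN (Nat.one_le_iff_ne_zero.1 hm), one_mul, sub_sub_sub_cancel_right]
  · push Not at hconst
    obtain ⟨s, t, hst⟩ := hconst
    have hcard : 2 ≤ (Set.range i).ncard := by
      rw [← Set.ncard_pair hst]
      exact Set.ncard_le_ncard (by rintro x (rfl | rfl) <;> exact Set.mem_range_self _)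
        (Set.finite_range i)
    simpa only [sum_prod_coordDir_of_ne _ hst, zero_mul, sub_zero] using hmixed m i hcard

end AxisRemainder

/-! ### Asymptotics of the operator values -/

section Products

variable {g : ℕ → ℂ → ℂ} {ψ φ : PowerSeries ℂ}

theorem taylorAt_deriv_div_mul {f g : ℂ → ℂ} {c : ℂ} (hf : AnalyticAt ℂ f c) (hf0 : f c ≠ 0)
    (hg : AnalyticAt ℂ g c) (hg0 : g c ≠ 0) :
    taylorAt c (fun u => deriv (fun z => f z * g z) u / (f u * g u)) =
      taylorAt c (fun u => deriv f u / f u) + taylorAt c (fun u => deriv g u / g u) := by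
  rw [← taylorAt_add (hf.deriv.fun_div hf hf0) (hg.deriv.fun_div hg hg0)]
  refine taylorAt_congr ?_
  filter_upwards [hf.eventually_analyticAt, hg.eventually_analyticAt,
    hf.continuousAt.eventually_ne hf0, hg.continuousAt.eventually_ne hg0] with z hfz hgz hfz0 hgz0
  rw [deriv_fun_mul hfz.differentiableAt hgz.differentiableAt]
  field_simp

theorem seriesExpansion_deriv_div_mul (hg : ∀ N, AnalyticAt ℂ (g N) 1) (hg0 : ∀ N, g N 1 ≠ 0)
    (h : SeriesExpansion (fun N => PowerSeries.C ((N : ℂ)⁻¹) *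
      taylorAt 1 fun u => deriv (g N) u / g N u) ψ φ)
    {f : ℂ → ℂ} (hf : AnalyticAt ℂ f 1) (hf0 : f 1 ≠ 0) :
    SeriesExpansion (fun N => PowerSeries.C ((N : ℂ)⁻¹) *
      taylorAt 1 fun u => deriv (fun z => f z * g N z) u / (f u * g N u))
      ψ (taylorAt 1 (fun u => deriv f u / f u) + φ) := by
  simp only [taylorAt_deriv_div_mul hf hf0 (hg _) (hg0 _), mul_add]
  simpa only [zero_add] using (SeriesExpansion.const _).natCast_inv_mul.add h

theorem exists_hasExpansion_sum_weight (n : ℕ) (q : ℂ) (hg : ∀ N, AnalyticAt ℂ (g N) 1)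
    (hg0 : ∀ N, g N 1 ≠ 0)
    (h : SeriesExpansion (fun N => PowerSeries.C ((N : ℂ)⁻¹) *
      taylorAt 1 fun u => deriv (g N) u / g N u) ψ φ) {k : ℕ} (s : JetIndex k) :
    ∃ B, HasExpansion (fun N => (N : ℂ)⁻¹ ^ (n + 1) *
      ∑ x, s.weight x * productValue N n q fun z => s.factor x z * g N z) 0 B := by
  have hfactor (x) : s.factor x 1 ≠ 0 := by
    rw [s.factor_one]
    exact one_ne_zero
  -- The factors do not affect the leading term, whose coefficient is `∑ x, s.weight x = 0`.
  have hsum := HasExpansion.sum Finset.univ fun x _ =>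
    (hasExpansion_productValue n q (g := fun N z => s.factor x z * g N z)
      (.of_forall fun N => (s.analyticAt_factor x 1).fun_mul (hg N))
      (.of_forall fun N => mul_ne_zero (hfactor x) (hg0 N))
      (seriesExpansion_deriv_div_mul hg hg0 h (s.analyticAt_factor x 1)
        (hfactor x))).const_mul (s.weight x)
  rw [← Finset.sum_mul, s.sum_weight, zero_mul] at hsum
  simp only [Finset.mul_sum, mul_left_comm _ (s.weight _)]
  exact ⟨_, hsum⟩

theorem hasExpansion_symmValue (n : ℕ) (q : ℂ) {f : ∀ N, (Fin N → ℂ) → ℂ} (hf1 : ∀ N, f N 1 = 1)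
    (hf : ∀ m : ℕ, 1 ≤ m → ∀ i : Fin m → ℕ, Tendsto (fun N => coordDeriv (f N) i) atTop (𝓝 0))
    (hg : ∀ N, AnalyticAt ℂ (g N) 1) (hg0 : ∀ N, g N 1 ≠ 0)
    (h : SeriesExpansion (fun N => PowerSeries.C ((N : ℂ)⁻¹) *
      taylorAt 1 fun u => deriv (g N) u / g N u) ψ φ) :
    HasExpansion (fun N => (N : ℂ)⁻¹ ^ (n + 1) * symmValue n q (f N) (g N))
      (limitValue n q ψ) (correctionValue n q ψ φ) := by
  have hjet (s : JetIndex (n + 1)) : HasExpansion (fun N => s.deriv (f N) *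
      ((N : ℂ)⁻¹ ^ (n + 1) *
        ∑ x, s.weight x * productValue N n q fun z => s.factor x z * g N z)) 0 0 := by
    obtain ⟨B, hB⟩ := exists_hasExpansion_sum_weight n q hg hg0 h s
    have hmul := (hf s.order (Nat.le_add_left 1 _) fun a => (s.pattern a : ℕ)).mul hB
    rw [zero_mul] at hmul
    exact hmul.congr fun N => by simp only [sub_zero, JetIndex.deriv, mul_left_comm]
  have hsum := (hasExpansion_productValue n q (.of_forall hg) (.of_forall hg0) h).add
    (HasExpansion.sum Finset.univ fun s _ => hjet s)
  simp only [Finset.sum_const_zero, add_zero] at hsum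
  refine hsum.congr' (.of_forall fun N => ?_)
  simp only [symmValue, hf1, one_mul, mul_add, Finset.mul_sum, mul_left_comm (JetIndex.deriv _ _)]

end Products

section Logarithm

variable {N : ℕ} {F : (Fin N → ℂ) → ℂ}

theorem contDiffAt_clog_comp (h1 : F 1 = 1) {m : ℕ} (hF : ContDiffAt ℂ m F 1) :
    ContDiffAt ℂ m (fun u => Complex.log (F u)) 1 :=
  (Complex.contDiffAt_log (by rw [h1]; exact Complex.one_mem_slitPlane)).comp 1 hF

theorem exp_axisRemainder_log_mul (h1 : F 1 = 1) (hF : HolNearOne F) :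
    (fun u => Complex.exp (axisRemainder (fun u => Complex.log (F u)) u) *
      ∏ j, axisRestrict F (u j)) =ᶠ[𝓝 1] F := by
  have hne : ∀ᶠ u in 𝓝 1, F u ≠ 0 :=
    hF.self_of_nhds.continuousAt.eventually_ne (by rw [h1]; exact one_ne_zero)
  have hne_axis : ∀ᶠ u in 𝓝 (1 : Fin N → ℂ), ∀ j, axisRestrict F (u j) ≠ 0 :=
    eventually_all.2 fun j => ((continuous_apply j).tendsto (1 : Fin N → ℂ)).eventually
      ((analyticAt_axisRestrict hF).continuousAt.eventually_ne
        (by rw [axisRestrict_one, h1]; exact one_ne_zero))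
  filter_upwards [hne, hne_axis] with u hu hu_axis
  have hexp : Complex.exp (∑ j, axisRestrict (fun u => Complex.log (F u)) (u j)) =
      ∏ j, axisRestrict F (u j) := by
    rw [Complex.exp_sum]
    exact Finset.prod_congr rfl fun j _ => Complex.exp_log (hu_axis j)
  rw [axisRemainder, Complex.exp_sub, Complex.exp_log hu, hexp,
    div_mul_cancel₀ _ (Finset.prod_ne_zero_iff.2 fun j _ => hu_axis j)]

theorem SymmNearOne.axisRemainder_clog (hF : SymmNearOne F) :
    SymmNearOne (axisRemainder fun u => Complex.log (F u)) := fun σ => by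
  filter_upwards [hF σ] with u hu
  have hsum := Equiv.sum_comp σ fun j => axisRestrict (fun u => Complex.log (F u)) (u j)
  simp only [axisRemainder, hu, Function.comp_apply, hsum]

theorem symmValue_eq_symmValue_exp_axisRemainder (n : ℕ) (q : ℂ) (h1 : F 1 = 1)
    (hF : ∀ m : ℕ, ContDiffAt ℂ m F 1) (hsymm : SymmNearOne F) :
    symmValue n q F (fun _ => 1) = symmValue n q
      (Complex.exp ∘ axisRemainder fun u => Complex.log (F u)) (axisRestrict F) := by
  have hhol := holNearOne_of_contDiffAt (hF 1)
  have haxis_one : axisRestrict F 1 = 1 := by rw [axisRestrict_one, h1]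
  have hval := hasDiffOpValue_symm (n := n) q (g := fun _ => 1)
    (by exact_mod_cast hF (n + 2)) hsymm analyticAt_const one_ne_zero
  have hval_exp := hasDiffOpValue_symm (n := n) q
    (f := Complex.exp ∘ axisRemainder fun u => Complex.log (F u))
    (by exact_mod_cast (contDiffAt_axisRemainder (contDiffAt_clog_comp h1 (hF (n + 2)))).cexp)
    (fun σ => (hsymm.axisRemainder_clog σ).fun_comp Complex.exp)
    (analyticAt_axisRestrict hhol) (by rw [haxis_one]; exact one_ne_zero)
  simp only [Finset.prod_const_one, mul_one, one_pow, one_mul, haxis_one,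
    Function.comp_apply] at hval hval_exp
  refine hval.unique (hval_exp.congr_of_isLittleO (k := n) ?_ hhol le_rfl ?_)
  · exact holNearOne_of_contDiffAt
      ((hF 1).congr_of_eventuallyEq (exp_axisRemainder_log_mul h1 hhol))
  · exact (Asymptotics.isLittleO_zero _ _).congr'
      ((exp_axisRemainder_log_mul h1 hhol).mono fun u hu => by simp [hu]) EventuallyEq.rfl

end Logarithm

section Asymptotics

variable {F : ∀ N : ℕ, (Fin N → ℂ) → ℂ} {a b : ℕ → ℂ}

theorem seriesExpansion_axisRestrict (h1 : ∀ N, F N 1 = 1)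
    (hF : ∀ N (m : ℕ), ContDiffAt ℂ m (F N) 1)
    (hpure : ∀ k : ℕ, 1 ≤ k → Tendsto (fun N : ℕ =>
      coordDeriv (fun u => Complex.log (F N u)) (fun _ : Fin k => 0) - N * a k) atTop (𝓝 (b k)))
    (ha : TaylorOneConverges a) (hb : TaylorOneConverges b) :
    SeriesExpansion (fun N => PowerSeries.C ((N : ℂ)⁻¹) *
      taylorAt 1 fun u => deriv (axisRestrict (F N)) u / axisRestrict (F N) u)
      (taylorAt 1 (deriv (taylorOne a))) (taylorAt 1 (deriv (taylorOne b))) := by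
  intro j
  have hslit (N) : axisRestrict (F N) 1 ∈ Complex.slitPlane := by
    rw [axisRestrict_one, h1]
    exact Complex.one_mem_slitPlane
  have htaylor (N) := taylorAt_deriv_div
    (analyticAt_axisRestrict (holNearOne_of_contDiffAt (hF N 1))) (hslit N)
  have hderiv (N) : iteratedDeriv (j + 1) (fun z => Complex.log (axisRestrict (F N) z)) 1 = _ :=
    iteratedDeriv_axisRestrict (contDiffAt_clog_comp (h1 N) (hF N (j + 1)))
  simp only [htaylor, taylorAt_deriv, PowerSeries.coeff_C_mul, PowerSeries.coeff_derivative,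
    coeff_taylorAt_taylorOne ha, coeff_taylorAt_taylorOne hb, coeff_taylorAt, hderiv]
  have hlim := (hpure (j + 1) (Nat.le_add_left 1 j)).mul_const
    (((j + 1).factorial : ℂ)⁻¹ * ((j : ℂ) + 1))
  rw [HasExpansion, div_eq_mul_inv (b (j + 1)), mul_assoc]
  refine hlim.congr' ?_
  filter_upwards [eventually_ne_atTop 0] with N hN
  have hN0 : (N : ℂ) ≠ 0 := Nat.cast_ne_zero.2 hN
  field_simp

theorem hasExpansion_symmValue_one (n : ℕ) (q : ℂ) (h1 : ∀ N, F N 1 = 1)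
    (hF : ∀ N (m : ℕ), ContDiffAt ℂ m (F N) 1) (hsymm : ∀ N, SymmNearOne (F N))
    (hpure : ∀ i k : ℕ, 1 ≤ k → Tendsto (fun N : ℕ =>
      coordDeriv (fun u => Complex.log (F N u)) (fun _ : Fin k => i) - N * a k) atTop (𝓝 (b k)))
    (hmixed : ∀ (m : ℕ) (i : Fin m → ℕ), 2 ≤ (Set.range i).ncard →
      Tendsto (fun N : ℕ => coordDeriv (fun u => Complex.log (F N u)) i) atTop (𝓝 0))
    (ha : TaylorOneConverges a) (hb : TaylorOneConverges b) :
    HasExpansion (fun N => (N : ℂ)⁻¹ ^ (n + 1) * symmValue n q (F N) fun _ => 1)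
      (limitValue n q (taylorAt 1 (deriv (taylorOne a))))
      (correctionValue n q (taylorAt 1 (deriv (taylorOne a)))
        (taylorAt 1 (deriv (taylorOne b)))) := by
  have hlog (N) (m : ℕ) := contDiffAt_clog_comp (h1 N) (hF N m)
  have hremainder_one (N) : axisRemainder (fun u => Complex.log (F N u)) 1 = 0 :=
    axisRemainder_one (by rw [h1, Complex.log_one])
  simp only [symmValue_eq_symmValue_exp_axisRemainder n q (h1 _) (hF _) (hsymm _)]
  refine hasExpansion_symmValue n q (fun N => ?_) (fun m hm i => ?_)
    (fun N => analyticAt_axisRestrict (holNearOne_of_contDiffAt (hF N 1))) (fun N => ?_)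
    (seriesExpansion_axisRestrict h1 hF (hpure 0) ha hb)
  · rw [Function.comp_apply, hremainder_one, Complex.exp_zero]
  · exact tendsto_coordDeriv_comp (fun _ => Complex.contDiff_exp)
      (fun N m => contDiffAt_axisRemainder (hlog N m)) hremainder_one
      (fun m hm i => tendsto_coordDeriv_axisRemainder hlog hpure hmixed hm i) hm i
  · rw [axisRestrict_one, h1]
    exact one_ne_zero

end Asymptotics

/-! ### Perelomov-Popov moments -/

section PerelomovPopov

variable {N : ℕ} {q : ℝ}

theorem ppWeight_nonneg (hq : q ∈ Set.Icc (-1 : ℝ) 1) (lam : Signature N) (i : Fin N) :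
    0 ≤ ppWeight q lam i := by
  refine Finset.prod_nonneg fun j hj => ?_
  rcases (lam.shifted_strictAnti.injective.ne (Finset.ne_of_mem_erase hj)).lt_or_gt with h | h
  · have hgap : (lam.shifted j : ℝ) + 1 ≤ lam.shifted i := by exact_mod_cast h
    exact div_nonneg (by linarith [hq.2]) (by linarith)
  · have hgap : (lam.shifted i : ℝ) + 1 ≤ lam.shifted j := by exact_mod_cast h
    exact div_nonneg_of_nonpos (by linarith [hq.1]) (by linarith)

theorem ppIntegral_eq_sum (hq : q ∈ Set.Icc (-1 : ℝ) 1) (lam : Signature N) (P : ℂ[X]) :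
    ppIntegral q lam P = ∑ i, (ppWeight q lam i : ℂ) / N * P.eval ((lam.shifted i : ℂ) / N) := by
  rw [ppIntegral, ppMeasure, MeasureTheory.integral_finsetSum_measure]
  · refine Finset.sum_congr rfl fun i _ => ?_
    rw [MeasureTheory.integral_smul_measure, MeasureTheory.integral_dirac,
      ENNReal.toReal_ofReal (div_nonneg (ppWeight_nonneg hq lam i) (Nat.cast_nonneg N)),
      Complex.real_smul]
    push_cast
    rfl
  · intro i _
    exact (MeasureTheory.integrable_dirac enorm_lt_top).smul_measure ENNReal.ofReal_ne_top

theorem mul_eval_descPochhammer {R : Type*} [CommRing R] (n : ℕ) (x : R) :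
    x * (descPochhammer R n).eval x =
      (descPochhammer R (n + 1)).eval x + n * (descPochhammer R n).eval x := by
  rw [descPochhammer_succ_right, eval_mul, eval_sub, eval_X, eval_natCast]
  ring

theorem pow_eq_sum_stirlingSecond {R : Type*} [CommRing R] (k : ℕ) (x : R) :
    x ^ k = ∑ n ∈ Finset.range (k + 1), (k.stirlingSecond n : R) *
      (descPochhammer R n).eval x := by
  induction k with
  | zero => simp
  | succ k ih =>
    have hshift : ∑ n ∈ Finset.range (k + 1), (n : R) * k.stirlingSecond n *
        (descPochhammer R n).eval x = ∑ n ∈ Finset.range (k + 1), ((n : R) + 1) *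
          k.stirlingSecond (n + 1) * (descPochhammer R (n + 1)).eval x := by
      have hsum := Finset.sum_range_succ (fun n : ℕ => (n : R) * k.stirlingSecond n *
        (descPochhammer R n).eval x) (k + 1)
      rw [Nat.stirlingSecond_eq_zero_of_lt k.lt_succ_self, Finset.sum_range_succ'] at hsum
      simpa using hsum.symm
    calc x ^ (k + 1)
        = ∑ n ∈ Finset.range (k + 1), (k.stirlingSecond n : R) *
            (descPochhammer R (n + 1)).eval x + ∑ n ∈ Finset.range (k + 1),
            (n : R) * k.stirlingSecond n * (descPochhammer R n).eval x := by
          rw [pow_succ', ih, Finset.mul_sum, ← Finset.sum_add_distrib]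
          refine Finset.sum_congr rfl fun n _ => ?_
          rw [mul_left_comm, mul_eval_descPochhammer]
          ring
      _ = ∑ n ∈ Finset.range (k + 1), ((k + 1).stirlingSecond (n + 1) : R) *
            (descPochhammer R (n + 1)).eval x := by
          rw [hshift, ← Finset.sum_add_distrib]
          refine Finset.sum_congr rfl fun n _ => ?_
          rw [Nat.stirlingSecond_succ_succ]
          push_cast
          ring
      _ = _ := by
          rw [Finset.sum_range_succ' _ (k + 1), Nat.stirlingSecond_succ_zero, Nat.cast_zero,
            zero_mul, add_zero]

/-- The expected moment of order `k` of the Perelomov-Popov measures, where `T n` is the expectation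
of `∑ i, (descPochhammer ℂ n).eval (lam.shifted i) * ppWeight q lam i`. -/
noncomputable def momentOf (T : ℕ → ℂ) (N k : ℕ) : ℂ :=
  (N : ℂ)⁻¹ ^ (k + 1) * ∑ n ∈ Finset.range (k + 1), (k.stirlingSecond n : ℂ) * T n

theorem momentOf_sum_descPochhammer {ι : Type*} (s : Finset ι) (x w : ι → ℂ) (N k : ℕ) :
    momentOf (fun n => ∑ i ∈ s, (descPochhammer ℂ n).eval (x i) * w i) N k =
      ∑ i ∈ s, w i / N * (x i / N) ^ k := by
  rw [momentOf]
  simp only [Finset.mul_sum]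
  rw [Finset.sum_comm]
  refine Finset.sum_congr rfl fun i _ => ?_
  rw [div_pow, pow_eq_sum_stirlingSecond k (x i), Finset.sum_div, Finset.mul_sum]
  refine Finset.sum_congr rfl fun n _ => ?_
  ring

theorem ppIntegral_eq_sum_momentOf (hq : q ∈ Set.Icc (-1 : ℝ) 1) (lam : Signature N) (P : ℂ[X]) :
    ppIntegral q lam P = P.sum fun k c => c * momentOf (fun n => ∑ i,
      (descPochhammer ℂ n).eval (lam.shifted i : ℂ) * (ppWeight q lam i : ℂ)) N k := by
  simp only [momentOf_sum_descPochhammer]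
  simp only [ppIntegral_eq_sum hq, eval_eq_sum, Polynomial.sum, Finset.mul_sum]
  rw [Finset.sum_comm]
  simp only [mul_left_comm]

theorem hasSum_ppIntegral {ρ : PMF (Signature N)} (hq : q ∈ Set.Icc (-1 : ℝ) 1) {T : ℕ → ℂ}
    (hT : ∀ n, HasSum (fun lam => ((ρ lam).toReal : ℂ) * ∑ i,
      (descPochhammer ℂ n).eval (lam.shifted i : ℂ) * (ppWeight q lam i : ℂ)) (T n)) (P : ℂ[X]) :
    HasSum (fun lam => ((ρ lam).toReal : ℂ) * ppIntegral q lam P)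
      (P.sum fun k c => c * momentOf T N k) := by
  have hmoment (k : ℕ) : HasSum (fun lam => momentOf (fun n => ((ρ lam).toReal : ℂ) * ∑ i,
      (descPochhammer ℂ n).eval (lam.shifted i : ℂ) * (ppWeight q lam i : ℂ)) N k)
      (momentOf T N k) :=
    (hasSum_sum fun n _ => (hT n).mul_left _).mul_left _
  refine (hasSum_sum fun k _ => (hmoment k).mul_left (P.coeff k)).congr_fun fun lam => ?_
  rw [ppIntegral_eq_sum_momentOf hq, Polynomial.sum, Finset.mul_sum]
  simp only [momentOf, Finset.mul_sum, mul_left_comm ((ρ lam).toReal : ℂ)]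

end PerelomovPopov

theorem momentOf_succ (T : ℕ → ℂ) (N k : ℕ) :
    momentOf T N (k + 1) = (N : ℂ)⁻¹ ^ (k + 2) * T (k + 1) +
      (((k + 1).choose 2 : ℂ) * ((N : ℂ)⁻¹ * ((N : ℂ)⁻¹ ^ (k + 1) * T k)) +
        ∑ n ∈ Finset.range k, ((k + 1).stirlingSecond n : ℂ) * (N : ℂ)⁻¹ ^ (k - 1 - n) *
          ((N : ℂ)⁻¹ * ((N : ℂ)⁻¹ * ((N : ℂ)⁻¹ ^ (n + 1) * T n)))) := by
  have hlow : ∀ n ∈ Finset.range k, (N : ℂ)⁻¹ ^ (k + 2) =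
      (N : ℂ)⁻¹ ^ (k - 1 - n) * (N : ℂ)⁻¹ * (N : ℂ)⁻¹ * (N : ℂ)⁻¹ ^ (n + 1) := fun n hn => by
    rw [← pow_succ, ← pow_succ, ← pow_add]
    congr 1
    grind
  rw [momentOf, Finset.sum_range_succ, Finset.sum_range_succ, Nat.stirlingSecond_self,
    Nat.stirlingSecond_succ_self_left, mul_add, mul_add, Finset.mul_sum, Finset.sum_congr rfl
      fun n hn => by rw [hlow n hn]]
  push_cast
  ring_nf

theorem hasExpansion_momentOf {T : ℕ → ℕ → ℂ} {L C : ℕ → ℂ}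
    (h : ∀ n, HasExpansion (fun N => (N : ℂ)⁻¹ ^ (n + 1) * T N n) (L n) (C n)) (k : ℕ) :
    HasExpansion (fun N => momentOf (T N) N k) (L k) (C k + k.choose 2 * L (k - 1)) := by
  rcases k with _ | k
  · simpa [momentOf] using h 0
  have hlow (n : ℕ) : HasExpansion (fun N => ((k + 1).stirlingSecond n : ℂ) *
      (N : ℂ)⁻¹ ^ (k - 1 - n) * ((N : ℂ)⁻¹ * ((N : ℂ)⁻¹ * ((N : ℂ)⁻¹ ^ (n + 1) * T N n)))) 0 0 := by
    simpa only [mul_zero, add_zero] using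
      ((HasExpansion.natCast_inv.pow (k - 1 - n)).const_mul _).mul
        (h n).natCast_inv_mul.natCast_inv_mul
  simpa [momentOf_succ] using (h (k + 1)).add (((h k).natCast_inv_mul.const_mul _).add
    (HasExpansion.sum (Finset.range k) fun n _ => hlow n))

/-- The linear functional on polynomials with moments `μ k`. -/
noncomputable def functionalOfMoments (μ : ℕ → ℂ) : ℂ[X] →ₗ[ℂ] ℂ :=
  Polynomial.lsum fun k => LinearMap.toSpanSingleton ℂ ℂ (μ k)

theorem functionalOfMoments_apply (μ : ℕ → ℂ) (P : ℂ[X]) :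
    functionalOfMoments μ P = P.sum fun k c => c * μ k := rfl

theorem functionalOfMoments_X_pow (μ : ℕ → ℂ) (k : ℕ) : functionalOfMoments μ (X ^ k) = μ k := by
  rw [functionalOfMoments_apply, ← monomial_one_right_eq_X_pow,
    sum_monomial_index 1 (fun k c => c * μ k) (zero_mul _), one_mul]

theorem isInfinitesimalLimit_of_hasExpansion {φN : ℕ → ℂ[X] → ℂ} {M : ℕ → ℕ → ℂ} {μ μ' : ℕ → ℂ}
    (hφ : ∀ N P, φN N P = P.sum fun k c => c * M N k)
    (h : ∀ k, HasExpansion (fun N => M N k) (μ k) (μ' k)) :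
    IsInfinitesimalLimit φN (functionalOfMoments μ) (functionalOfMoments μ') := by
  have hexpansion (P : ℂ[X]) : HasExpansion (fun N => φN N P) (functionalOfMoments μ P)
      (functionalOfMoments μ' P) := by
    simp only [hφ, functionalOfMoments_apply, Polynomial.sum]
    exact HasExpansion.sum _ fun k _ => (h k).const_mul _
  exact ⟨fun P => (hexpansion P).tendsto, hexpansion⟩

theorem theorem2
    (ρ : ∀ N : ℕ, PMF (Signature N))
    (hρ : ∀ N, SchurGenConverges (ρ N))
    (a b : ℕ → ℂ)
    (hpure : ∀ i k : ℕ, 1 ≤ k →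
      Tendsto (fun N : ℕ => logSchurDeriv (ρ N) (fun _ : Fin k => i) - N * a k) atTop (𝓝 (b k)))
    (hmixed : ∀ (m : ℕ) (i : Fin m → ℕ), 2 ≤ (Set.range i).ncard →
      Tendsto (fun N : ℕ => logSchurDeriv (ρ N) i) atTop (𝓝 0))
    (hΨ : TaylorOneConverges a) (hΦ : TaylorOneConverges b) :
    (∀ q ∈ Set.Icc (-1 : ℝ) 1, ∀ (N : ℕ) (P : ℂ[X]),
      Summable fun lam : Signature N => ((ρ N lam).toReal : ℂ) * ppIntegral q lam P) ∧
    ∃ φ φ' : ℝ → ℂ[X] →ₗ[ℂ] ℂ, ∀ q ∈ Set.Icc (-1 : ℝ) 1,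
      IsInfinitesimalLimit (fun N P => ppExpect q (ρ N) P) (φ q) (φ' q) ∧
      (∀ k : ℕ, φ q (X ^ k) = limitMoment (taylorOne a) q k) ∧
      (∀ k : ℕ, φ' q (X ^ k) = infinitesimalMoment (taylorOne a) (taylorOne b) q k) ∧
      ∀ᶠ z in 𝓝 (0 : ℂ),
        Summable (fun k : ℕ => φ 0 (X ^ k) * z ^ (k + 1)) ∧
        Summable (fun k : ℕ => φ' 0 (X ^ k) * z ^ (k + 1)) ∧
        Summable (fun k : ℕ => φ' q (X ^ k) * z ^ (k + 1)) ∧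
        Summable (fun k : ℕ => ((k : ℂ) + 1) * φ 0 (X ^ k) * z ^ (k + 2)) ∧
        Complex.exp (q * ∑' k : ℕ, φ 0 (X ^ k) * z ^ (k + 1)) *
            (∑' k : ℕ, φ' q (X ^ k) * z ^ (k + 1)) =
          (∑' k : ℕ, φ' 0 (X ^ k) * z ^ (k + 1)) +
            (q : ℂ) / 2 * (∑' k : ℕ, ((k : ℂ) + 1) * φ 0 (X ^ k) * z ^ (k + 2)) := by
  have hsum (q : ℝ) (hq : q ∈ Set.Icc (-1 : ℝ) 1) (N : ℕ) :=
    hasSum_ppIntegral hq fun n => (hρ N).hasSum_symmValue n q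
  have hΨa := analyticAt_taylorOne hΨ
  have hΦa := analyticAt_taylorOne hΦ
  refine ⟨fun q hq N P => (hsum q hq N P).summable,
    fun q => functionalOfMoments (limitMoment (taylorOne a) q),
    fun q => functionalOfMoments (infinitesimalMoment (taylorOne a) (taylorOne b) q),
    fun q hq => ⟨isInfinitesimalLimit_of_hasExpansion (fun N P => (hsum q hq N P).tsum_eq)
      fun k => ?_, fun k => functionalOfMoments_X_pow _ k,
      fun k => functionalOfMoments_X_pow _ k, ?_⟩⟩
  · rw [limitMoment_eq_limitValue hΨa, ← correctionValue_add_limitValue hΨa hΦa]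
    exact hasExpansion_momentOf (fun n => hasExpansion_symmValue_one n q
      (fun N => schurGen_one (ρ N)) (fun N => (hρ N).contDiffAt)
      (fun N σ => .of_forall (schurGen_perm (ρ N) σ)) hpure hmixed hΨ hΦ) k
  · simp only [functionalOfMoments_X_pow]
    exact eventually_generating_identity hΨa hΦa q
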